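/- Setting. Let $f:\mathbb R^d\to\mathbb R$ be differentiable with $L$-Lipschitz gradient ($L>0$), bounded below with infimum $f^\star$, and $\mu$-PŁ: $\|\nabla f(x)\|^2\ge 2\mu(f(x)-f^\star)$ for all $x$ ($\mu>0$). Let $p$ be a Markov kernel on a measurable space $\mathcal Z$ with a unique invariant distribution $\pi$ and with mixing time $t_{\rm mix}\in\{1,2,\dots\}$, i.e. $\tfrac12|p^{(k)}(\cdot\mid z)-\pi|(\mathcal Z)\le 2^{-\lfloor k/t_{\rm mix}\rfloor}$ for all $z\in\mathcal Z$, $k\ge0$. Let $g:\mathbb R^d\times\mathcal Z\to\mathbb R^d$ be measurable in $z$ and $L_g$-Lipschitz in $x$, with $\nabla f(x)=\int g(x,z)\,\pi(dz)$ and, for constants $A,B,C\ge0$, $\|g(x,z)\|^2\le A\|\nabla f(x)\|^2+B(f(x)-f^\star)+C$ for all $x,z$. Let $\delta\in(0,1)$, $a\ge 2/\mu$, $K_0>0$, and consider $$x_{k+1}=x_k-\frac{a}{k+K_0}\,G_k,\qquad G_k=g(x_k,Z_k)+M_{k+1},\qquad k=0,1,\dots,$$ with a possibly random $x_0$. Put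 $\mathcal F_k=\sigma(x_0,M_\ell,Z_\ell,\ \ell\le k)$ and assume that $(Z_k)$ is a Markov chain with respect to $(\mathcal F_k)$ with kernel $p$ (i.e. $\mathbb P(Z_{k+1}\in S\mid\mathcal F_k)=p(S\mid Z_k)$ a.s. for every measurable $S$) and an arbitrary initial distribution, that the $M_k$ are integrable with $\mathbb E[M_{k+1}\mid\mathcal F_k]=0$, and that $\|G_k\|^2\le A\|\nabla f(x_k)\|^2+B(f(x_k)-f^\star)+C$ a.s. for all $k$. Write $\Delta_k=f(x_k)-f^\star$. Constants. For positive numbers $\mathfrak m_1,\dots,\mathfrak m_4$ define $$D_1=2a\mathfrak m_1t_{\rm mix}L\sqrt d\,\Delta_0+10a\mathfrak m_2t_{\rm mix}\sqrt d+\frac{ea^2\mathfrak m_4t_{\rm mix}(L+L_g)\sqrt d}{\mu a-1},\qquad D_2=8a\mathfrak m_1t_{\rm mix}L\sqrt d+\frac{ea^2\mathfrak m_3t_{\rm mix}(L+L_g)L\sqrt d}{\mu a-1},$$ $$\nu_1=32(ae)^2L(t_{\rm mix}^2d+1)\Big(\frac{2AL+B}{2\mu a-3}\Big(2\Delta_0+\frac{D_1}{D_2}+\frac{ea^2CL}{D_2}\Big)+\frac{C}{2\mu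 a-2}\Big),\qquad \nu_2=64(ae)^2L(t_{\rm mix}^2d+1)\frac{2AL+B}{2\mu a-3},$$ $$\Gamma_1=ea^2CL+2(D_1+D_2\Delta_0),\qquad \Gamma_2=4\nu_1\big(1+3\,\overline{\log(K_0)}\big)+2\sqrt{\nu_1(\overline K_0\Delta_0+2\Gamma_1)},$$ where $\overline K_0\ge K_0/\log(2/\delta)$ and $\overline{\log(K_0)}\ge\log(2K_0/\delta)/\log(2/\delta)$ are any numbers, and $$\mathfrak c_1(\delta)=\max\Big\{\tfrac{aL}{2}\big(2A+\tfrac B\mu\big),\ \mu a,\ 2D_2,\ 24\nu_2(2\log(48\nu_2)+1)\log\frac{48\nu_2(2\log(48\nu_2)+1)}{\delta}\Big\}.$$ (In degenerate cases, division by $0$ and $\log 0$ are read as $0$, and $\log y$ as $\log|y|$ for $y<0$.) Theorem. There are positive constants $\mathfrak m_1,\dots,\mathfrak m_4$, depending only on $A,B,C,L$, such that in every setting as above the following holds. (1) If $K_0\ge\mathfrak c_1(\delta)$, then with probability at least $1-\delta$, simultaneously for all $k\ge1$, $$\Delta_k\le\frac{K_0\Delta_0+\Gamma_1+\Gamma_2\log\frac{2K_0}{\delta}+\Gamma_2\log\frac{2k}{\delta}}{k+K_0}.$$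 (2) The threshold is of order $\log(1/\delta)$: there is $\kappa$ independent of $\delta$ with $\mathfrak c_1(\delta)\le\kappa\log(2/\delta)$ for all $\delta\in(0,1)$. (3) The bound is of order $t_{\rm mix}^2\log(k/\delta)/(\mu^2k)$: for all $r,R$ and all values of $\overline K_0,\overline{\log(K_0)}$ there is $H$, depending only on these and on $A,B,C,L,L_g,d$, such that the right-hand side of (1) is at most $H\,t_{\rm mix}^2\log(2k/\delta)/(\mu^2k)$ for all $k\ge1$, $\delta\in(0,1)$, $t_{\rm mix}\ge1$, $0<\mu\le L$, $a\in[2/\mu,r/\mu]$, $0\le\Delta_0\le R$ and all $K_0\ge\mathfrak c_1(\delta)$ with $K_0/\log(2/\delta)\le\overline K_0$ and $\log(2K_0/\delta)/\log(2/\delta)\le\overline{\log(K_0)}$. -/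

import Mathlib

open MeasureTheory ProbabilityTheory

universe u v

namespace MarkovSGD

noncomputable section

/-- `ℝ^d` with its Euclidean norm. -/
abbrev E (d : ℕ) : Type := EuclideanSpace ℝ (Fin d)

/-! ### The objective -/

/-- The suboptimality `f x - f⋆`, where `f⋆ = inf f`. -/
def subopt {d : ℕ} (f : E d → ℝ) (x : E d) : ℝ := f x - ⨅ y, f y

/-- `f` is differentiable and its gradient is `L`-Lipschitz. -/
structure IsSmooth {d : ℕ} (f : E d → ℝ) (L : ℝ) : Prop where
  differentiable : Differentiable ℝ f
  lipschitz : ∀ x y, ‖gradient f x - gradient f y‖ ≤ L * ‖x - y‖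

/-- The Polyak-Łojasiewicz condition with constant `μ`; it presupposes that `f⋆` is finite. -/
structure IsPL {d : ℕ} (f : E d → ℝ) (μ : ℝ) : Prop where
  bddBelow : BddBelow (Set.range f)
  le_norm_sq : ∀ x, 2 * μ * subopt f x ≤ ‖gradient f x‖ ^ 2

/-- The right-hand side `A ‖∇f(x)‖² + B (f(x) - f⋆) + C` of the ABC condition. -/
def abcBound {d : ℕ} (f : E d → ℝ) (A B C : ℝ) (x : E d) : ℝ :=
  A * ‖gradient f x‖ ^ 2 + B * subopt f x + C

/-! ### The Markov chain -/

section Chain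

variable {S : Type v} [MeasurableSpace S]

instance isMarkovKernel_pow (p : Kernel S S) [IsMarkovKernel p] (k : ℕ) :
    IsMarkovKernel (p ^ k) := by
  induction k with
  | zero =>
    rw [pow_zero]
    exact inferInstanceAs (IsMarkovKernel (Kernel.id : Kernel S S))
  | succ k ih =>
    rw [pow_succ]
    exact inferInstanceAs (IsMarkovKernel ((p ^ k) ∘ₖ p))

/-- The total variation distance `(1/2) |ρ₁ - ρ₂|(S)` (with values in `[0,1]`), where `|ρ₁ - ρ₂|`
is the total variation measure of the signed measure `ρ₁ - ρ₂`. -/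
def tvDist (ρ₁ ρ₂ : Measure S) [IsFiniteMeasure ρ₁] [IsFiniteMeasure ρ₂] : ℝ :=
  (1 / 2) * (ρ₁.toSignedMeasure - ρ₂.toSignedMeasure).totalVariation.real Set.univ

/-- `π` is the unique invariant distribution of `p`, and the chain is uniformly geometrically
ergodic with mixing time `t`: for all `k` and `z`, the distance of `p^k(z, ·)` and `π` is at
most `2^(-⌊k/t⌋)` (`k / t` is division of natural numbers). -/
structure IsGeometricallyErgodic (p : Kernel S S) [IsMarkovKernel p]
    (π : Measure S) [IsProbabilityMeasure π] (t : ℕ) : Prop where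
  one_le : 1 ≤ t
  invariant : Kernel.Invariant p π
  unique : ∀ π' : Measure S, IsProbabilityMeasure π' → Kernel.Invariant p π' → π' = π
  mixing : ∀ (k : ℕ) (z : S), tvDist ((p ^ k) z) π ≤ ((1 : ℝ) / 2) ^ (k / t)

/-- The assumptions on the Markovian gradient samples `g (x, z)`: measurability in `z`,
stationary mean `∇f(x)`, `Lg`-Lipschitz in `x`, and the ABC growth bound. -/
structure IsGradientSample {d : ℕ} (f : E d → ℝ) (π : Measure S) (g : E d → S → E d)
    (Lg A B C : ℝ) : Prop where
  measurable : ∀ x, Measurable (g x)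
  mean : ∀ x, gradient f x = ∫ z, g x z ∂π
  lipschitz : ∀ x y z, ‖g x z - g y z‖ ≤ Lg * ‖x - y‖
  growth : ∀ x z, ‖g x z‖ ^ 2 ≤ abcBound f A B C x

end Chain

/-! ### The noise and the iteration -/

section Noise

variable {Ω : Type u} {S : Type v} [MeasurableSpace S] {d : ℕ}

/-- The σ-algebra `ℱ_k` generated by `x₀` and by `M_ℓ`, `Z_ℓ` for `ℓ ≤ k`. -/
def history (x₀ : Ω → E d) (M : ℕ → Ω → E d) (Z : ℕ → Ω → S) (k : ℕ) : MeasurableSpace Ω :=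
  MeasurableSpace.comap x₀ inferInstance ⊔
    ⨆ ℓ : ℕ, ⨆ _ : ℓ ≤ k,
      (MeasurableSpace.comap (M ℓ) inferInstance ⊔ MeasurableSpace.comap (Z ℓ) inferInstance)

variable [MeasurableSpace Ω]

/-- `Z` is a time-homogeneous Markov chain, with respect to the filtration `F`, with initial
distribution `π₀` and transition kernel `p`. -/
structure IsMarkovChain (P : Measure Ω) (F : ℕ → MeasurableSpace Ω) (Z : ℕ → Ω → S)
    (π₀ : Measure S) (p : Kernel S S) : Prop where
  measurable : ∀ k, Measurable (Z k)
  initial : P.map (Z 0) = π₀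
  transition : ∀ (k : ℕ) (s : Set S), MeasurableSet s →
    P⟦Z (k + 1) ⁻¹' s | F k⟧ =ᵐ[P] fun ω => (p (Z k ω)).real s

/-- `M` is a martingale difference sequence with respect to the filtration `F`. -/
structure IsMartingaleDifference (P : Measure Ω) (F : ℕ → MeasurableSpace Ω)
    (M : ℕ → Ω → E d) : Prop where
  measurable : ∀ k, Measurable (M k)
  integrable : ∀ k, Integrable (M k) P
  condExp_eq_zero : ∀ k, P[M (k + 1) | F k] =ᵐ[P] 0

/-- The noisy gradient `G_k = g (x_k, Z_k) + M_{k+1}`. -/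
def noisyGradient (g : E d → S → E d) (Z : ℕ → Ω → S) (M x : ℕ → Ω → E d)
    (k : ℕ) (ω : Ω) : E d :=
  g (x k ω) (Z k ω) + M (k + 1) ω

/-- `x` is the SGD sequence with stepsizes `α_k = a / (k + K₀)`, started in the (possibly random)
point `x 0`. -/
structure IsSGD (g : E d → S → E d) (Z : ℕ → Ω → S) (M x : ℕ → Ω → E d) (a K₀ : ℝ) : Prop where
  measurable_zero : Measurable (x 0)
  step : ∀ k ω, x (k + 1) ω = x k ω - (a / ((k : ℝ) + K₀)) • noisyGradient g Z M x k ω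

end Noise

/-! ### The explicit constants -/

/-- The parameters of the problem: dimension `d`, mixing time `t`, the constants of the
assumptions, the stepsize constant `a`, and four constants `m₁, …, m₄`. -/
structure Params where
  (d t : ℕ)
  (μ L Lg A B C a : ℝ)
  (m₁ m₂ m₃ m₄ : ℝ)

namespace Params

variable (q : Params)

/-- `D₁`, as a function of the initial suboptimality `Δ₀`. -/
def D₁ (Δ₀ : ℝ) : ℝ :=
  2 * q.a * q.m₁ * q.t * q.L * √q.d * Δ₀ + 10 * q.a * q.m₂ * q.t * √q.d
    + Real.exp 1 * q.a ^ 2 * q.m₄ * q.t * (q.L + q.Lg) * √q.d / (q.μ * q.a - 1)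

/-- `D₂`. -/
def D₂ : ℝ :=
  8 * q.a * q.m₁ * q.t * q.L * √q.d
    + Real.exp 1 * q.a ^ 2 * q.m₃ * q.t * (q.L + q.Lg) * q.L * √q.d / (q.μ * q.a - 1)

/-- `ν₁`. -/
def ν₁ (Δ₀ : ℝ) : ℝ :=
  32 * (q.a * Real.exp 1) ^ 2 * q.L * ((q.t : ℝ) ^ 2 * q.d + 1) *
    ((2 * q.A * q.L + q.B) / (2 * q.μ * q.a - 3) *
        (2 * Δ₀ + q.D₁ Δ₀ / q.D₂ + Real.exp 1 * q.a ^ 2 * q.C * q.L / q.D₂)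
      + q.C / (2 * q.μ * q.a - 2))

/-- `ν₂`. -/
def ν₂ : ℝ :=
  64 * (q.a * Real.exp 1) ^ 2 * q.L * ((q.t : ℝ) ^ 2 * q.d + 1) *
    ((2 * q.A * q.L + q.B) / (2 * q.μ * q.a - 3))

/-- `Γ₁`. -/
def Γ₁ (Δ₀ : ℝ) : ℝ :=
  Real.exp 1 * q.a ^ 2 * q.C * q.L + 2 * (q.D₁ Δ₀ + q.D₂ * Δ₀)

/-- `Γ₂`; here `Kbar` and `logbar` stand for upper bounds of `K₀ / log (2/δ)` and of
`log (2 K₀/δ) / log (2/δ)`. -/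
def Γ₂ (Kbar logbar Δ₀ : ℝ) : ℝ :=
  4 * q.ν₁ Δ₀ * (1 + 3 * logbar) + 2 * √(q.ν₁ Δ₀ * (Kbar * Δ₀ + 2 * q.Γ₁ Δ₀))

/-- The lower bound on `K₀`. -/
def minK₀ (δ : ℝ) : ℝ :=
  max (max (q.a * q.L / 2 * (2 * q.A + q.B / q.μ)) (q.μ * q.a))
    (max (2 * q.D₂)
      (24 * q.ν₂ * (2 * Real.log (48 * q.ν₂) + 1) *
        Real.log (48 * q.ν₂ * (2 * Real.log (48 * q.ν₂) + 1) / δ)))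

/-- The high-probability bound on the suboptimality of the `k`-th iterate. -/
def bound (K₀ δ Kbar logbar Δ₀ : ℝ) (k : ℕ) : ℝ :=
  (K₀ * Δ₀ + q.Γ₁ Δ₀ + q.Γ₂ Kbar logbar Δ₀ * Real.log (2 * K₀ / δ)
    + q.Γ₂ Kbar logbar Δ₀ * Real.log (2 * k / δ)) / (k + K₀)

end Params

end

end MarkovSGD

/-!
Write `n = k + K₀` and `α = a / n` for the stepsize of step `k`, `y = μ a ≥ 2`, `Δ` for the
suboptimality and `Q = 2 A L + B`. Since `‖∇f‖² ≤ 2 L Δ`, the growth condition gives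
`‖g‖², ‖G‖² ≤ Q Δ + C`. The descent lemma and the Polyak-Łojasiewicz inequality give a contraction
by the factor `1 - y / n` in each step, perturbed by a term of order `α²` and by
`-α ⟪∇f, G - ∇f⟫`.

The perturbation is not centred, because the samples `Z` are dependent. It is treated by the Poisson
equation: as the kernel mixes geometrically, `h = ∑ⱼ (pʲ φ - π φ)` solves `h - p h = φ - π φ` and is
at most of order `t` times the supremum of `φ` (`poissonSol`). With `φ = g (x, ·)`, `G - ∇f` is a
martingale difference, the innovation, plus `h (Z_k) - h (Z_{k+1})`. The latter is summed by parts;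
as `g` and `∇f` are Lipschitz in `x`, this costs a term of order `α²` in each step and a corrector
`α ⟪∇f, h⟫` at both ends (`IsSetting.bias_le`, `IsSetting.subopt_le_of_forall_lt`). What remains
is a weighted sum of martingale differences, whose weights are products of the contraction factors.

Suppose that the asserted bound `Δ_j ≤ b_j / (j + K₀)` holds for all `j < k`. Then the differences
are bounded by quantities known at time `0`. The Azuma-Hoeffding inequality, applied to the sum
stopped at the first violation of the bound and normalized by these (random) quantities, bounds the
sum by a `deviation` except with probability `δ / (2 k²)` (`measure_sum_ge_le_exp`,
`measure_deviation_le`). Off these exceptional events, which have total probability less than `δ`,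
the bound for `j < k` implies the bound for `k`: all error terms add up to
at most the level `b_k` (`Params.total_le_level`). The critical term is the part of the deviation
proportional to `b_k`; its square is of relative size `ν₂ log (k / δ) / n`, which is small exactly
because `K₀` is above its threshold (`Params.deviation_le`). The constants `m₁, …, m₄` are chosen
so large that the correctors and the terms of order `α²` use up only a small part of the level.

The logarithms in the threshold are harmless unless `ν₂` is small. This occurs only for constant
objectives: if `f` is not constant, gradient ascent makes the suboptimality unbounded under the
Polyak-Łojasiewicz condition, so the growth condition forces `Q ≥ 2 μ`
(`two_mul_le_of_subopt_pos`), whence `ν₂` is at least a large multiple of `y`. For constant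
objectives the suboptimality vanishes and the bound is nonnegative. The claims about the orders of
threshold and bound are elementary estimates (`Params.minK₀_le`, `Params.IsAdmissible.bound_le`).
-/

namespace MarkovSGD

/-! ### Smooth functions and the Polyak-Łojasiewicz condition -/

section Smooth

variable {d : ℕ} {f : E d → ℝ} {L μ A B C : ℝ}

/-- The descent lemma. -/
theorem IsSmooth.le_add_inner (hf : IsSmooth f L) (x v : E d) :
    f (x + v) ≤ f x + inner ℝ (gradient f x) v + L / 2 * ‖v‖ ^ 2 := by
  have hder : ∀ s : ℝ, HasDerivAt (fun s : ℝ => f (x + s • v))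
      (inner ℝ (gradient f (x + s • v)) v) s := by
    intro s
    have h1 : HasFDerivAt f (InnerProductSpace.toDual ℝ (E d) (gradient f (x + s • v)))
        (x + s • v) := (hf.differentiable _).hasGradientAt.hasFDerivAt
    have h2 : HasDerivAt (fun s : ℝ => x + s • v) v s := by
      simpa using ((hasDerivAt_id s).smul_const v).const_add x
    have h3 := h1.comp_hasDerivAt s h2
    rw [InnerProductSpace.toDual_apply_apply] at h3
    exact h3
  have hφ : ∀ s : ℝ, HasDerivAt
      (fun s : ℝ => f (x + s • v) - s * inner ℝ (gradient f x) v - L / 2 * ‖v‖ ^ 2 * s ^ 2)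
      (inner ℝ (gradient f (x + s • v)) v - inner ℝ (gradient f x) v
        - L * ‖v‖ ^ 2 * s) s := by
    intro s
    have := ((hder s).sub ((hasDerivAt_id s).mul_const (inner ℝ (gradient f x) v))).sub
      ((hasDerivAt_pow 2 s).const_mul (L / 2 * ‖v‖ ^ 2))
    refine this.congr_deriv ?_
    norm_num
    ring
  have hanti : AntitoneOn
      (fun s : ℝ => f (x + s • v) - s * inner ℝ (gradient f x) v - L / 2 * ‖v‖ ^ 2 * s ^ 2)
      (Set.Icc 0 1) := by
    refine antitoneOn_of_deriv_nonpos (convex_Icc 0 1)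
      (fun s _ => (hφ s).continuousAt.continuousWithinAt)
      (fun s _ => (hφ s).differentiableAt.differentiableWithinAt) fun s hs => ?_
    rw [interior_Icc] at hs
    rw [(hφ s).deriv, ← inner_sub_left]
    have h1 := real_inner_le_norm (gradient f (x + s • v) - gradient f x) v
    have h2 := hf.lipschitz (x + s • v) x
    rw [add_sub_cancel_left, norm_smul, Real.norm_of_nonneg hs.1.le] at h2
    nlinarith [mul_le_mul_of_nonneg_right h2 (norm_nonneg v)]
  have := hanti (Set.left_mem_Icc.2 zero_le_one) (Set.right_mem_Icc.2 zero_le_one) zero_le_one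
  simp only [one_smul, zero_smul, add_zero, one_pow, one_mul, zero_mul, mul_one, sub_zero,
    ne_eq, OfNat.ofNat_ne_zero, not_false_eq_true, zero_pow, mul_zero] at this
  linarith

theorem IsSmooth.sub_le (hf : IsSmooth f L) (x v : E d) :
    f x + inner ℝ (gradient f x) v - L / 2 * ‖v‖ ^ 2 ≤ f (x + v) := by
  have hgrad : ∀ y, gradient (fun y => -f y) y = -gradient f y := fun y => by
    have h : HasGradientAt (fun y => -f y) (-gradient f y) y := by
      rw [hasGradientAt_iff_hasFDerivAt, map_neg]
      exact (hf.differentiable y).hasGradientAt.hasFDerivAt.neg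
    exact h.gradient
  have hg : IsSmooth (fun y => -f y) L := by
    refine ⟨hf.differentiable.neg, fun y z => ?_⟩
    rw [hgrad, hgrad, ← neg_sub_neg, neg_neg, neg_neg, norm_sub_rev, ← norm_neg]
    simpa [norm_sub_rev] using hf.lipschitz y z
  have := hg.le_add_inner x v
  rw [hgrad, inner_neg_left] at this
  linarith

theorem IsPL.subopt_nonneg (hp : IsPL f μ) (x : E d) : 0 ≤ subopt f x :=
  sub_nonneg.2 (ciInf_le hp.bddBelow x)

theorem norm_gradient_sq_le (hL : 0 < L) (hf : IsSmooth f L) (hp : IsPL f μ) (x : E d) :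
    ‖gradient f x‖ ^ 2 ≤ 2 * L * subopt f x := by
  have h1 := hf.le_add_inner x (-(1 / L) • gradient f x)
  have h2 : 0 ≤ f (x + -(1 / L) • gradient f x) - ⨅ y, f y := hp.subopt_nonneg _
  rw [inner_smul_right, norm_smul, mul_pow, real_inner_self_eq_norm_sq] at h1
  have h3 : ‖-(1 / L)‖ ^ 2 = 1 / L ^ 2 := by
    rw [Real.norm_eq_abs, sq_abs]; ring
  rw [h3] at h1
  have h4 : L / 2 * (1 / L ^ 2 * ‖gradient f x‖ ^ 2) = 1 / (2 * L) * ‖gradient f x‖ ^ 2 := by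
    field_simp
  have h5 : -(1 / L) * ‖gradient f x‖ ^ 2 = -2 * (1 / (2 * L) * ‖gradient f x‖ ^ 2) := by
    field_simp
  rw [h4, h5] at h1
  have h6 : 1 / (2 * L) * ‖gradient f x‖ ^ 2 ≤ subopt f x := by
    unfold subopt; linarith
  rw [one_div, inv_mul_le_iff₀ (by positivity)] at h6
  exact h6

/-- Gradient ascent with stepsize `1 / L` increases the suboptimality geometrically. -/
theorem exists_subopt_ge (hL : 0 < L) (hμ : 0 < μ) (hf : IsSmooth f L) (hp : IsPL f μ)
    {x : E d} (hx : 0 < subopt f x) (R : ℝ) : ∃ y, R ≤ subopt f y := by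
  have hstep : ∀ z : E d, (1 + μ / L) * subopt f z ≤ subopt f (z + (1 / L) • gradient f z) := by
    intro z
    have h1 := hf.sub_le z ((1 / L) • gradient f z)
    rw [inner_smul_right, norm_smul, mul_pow, real_inner_self_eq_norm_sq, Real.norm_eq_abs,
      sq_abs] at h1
    have h2 : L / 2 * ((1 / L) ^ 2 * ‖gradient f z‖ ^ 2) = 1 / (2 * L) * ‖gradient f z‖ ^ 2 := by
      field_simp
    have h3 : 1 / L * ‖gradient f z‖ ^ 2 = 2 * (1 / (2 * L) * ‖gradient f z‖ ^ 2) := by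
      field_simp
    rw [h2, h3] at h1
    have h4 := mul_le_mul_of_nonneg_left (hp.le_norm_sq z) (show 0 ≤ 1 / (2 * L) by positivity)
    have h5 : 1 / (2 * L) * (2 * μ * subopt f z) = μ / L * subopt f z := by field_simp
    unfold subopt at *
    linarith
  have hpow : ∀ n : ℕ, ∃ y, (1 + μ / L) ^ n * subopt f x ≤ subopt f y := by
    intro n
    induction n with
    | zero => exact ⟨x, by simp⟩
    | succ n ih =>
      obtain ⟨y, hy⟩ := ih
      refine ⟨_, le_trans ?_ (hstep y)⟩
      rw [pow_succ', mul_assoc]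
      exact mul_le_mul_of_nonneg_left hy (by positivity)
  obtain ⟨n, hn⟩ := pow_unbounded_of_one_lt (R / subopt f x)
    (show 1 < 1 + μ / L by have : 0 < μ / L := by positivity
                           linarith)
  obtain ⟨y, hy⟩ := hpow n
  exact ⟨y, ((div_lt_iff₀ hx).1 hn).le.trans hy⟩

theorem abcBound_le (hL : 0 < L) (hA : 0 ≤ A) (hf : IsSmooth f L) (hp : IsPL f μ) (x : E d) :
    abcBound f A B C x ≤ (2 * A * L + B) * subopt f x + C := by
  have := mul_le_mul_of_nonneg_left (norm_gradient_sq_le hL hf hp x) hA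
  unfold abcBound
  linarith

theorem abcBound_nonneg (hA : 0 ≤ A) (hB : 0 ≤ B) (hC : 0 ≤ C) (hp : IsPL f μ) (x : E d) :
    0 ≤ abcBound f A B C x := by
  have := mul_nonneg hB (hp.subopt_nonneg x)
  unfold abcBound
  positivity

theorem continuous_gradient (hf : IsSmooth f L) : Continuous (gradient f) :=
  (LipschitzWith.of_dist_le_mul (K := L.toNNReal) fun x y => by
    rw [dist_eq_norm, dist_eq_norm]
    exact (hf.lipschitz x y).trans
      (mul_le_mul_of_nonneg_right (Real.le_coe_toNNReal L) (norm_nonneg _))).continuous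

variable {S : Type v} [MeasurableSpace S] {π : Measure S}
  {g : E d → S → E d} {Lg : ℝ}

theorem IsGradientSample.norm_le (hg : IsGradientSample f π g Lg A B C) (x : E d) (z : S) :
    ‖g x z‖ ≤ √(abcBound f A B C x) :=
  Real.le_sqrt_of_sq_le (hg.growth x z)

theorem IsGradientSample.norm_gradient_le [IsProbabilityMeasure π]
    (hg : IsGradientSample f π g Lg A B C) (x : E d) :
    ‖gradient f x‖ ≤ √(abcBound f A B C x) := by
  rw [hg.mean x]
  simpa using norm_integral_le_of_norm_le_const (μ := π) (ae_of_all _ fun z => hg.norm_le x z)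

/-- A non-constant PŁ function is unbounded, so the growth bound cannot have a small linear part:
this is what keeps the logarithms in the threshold for `K₀` away from their degenerate range. -/
theorem two_mul_le_of_subopt_pos [IsProbabilityMeasure π] (hL : 0 < L) (hμ : 0 < μ)
    (hA : 0 ≤ A) (hB : 0 ≤ B) (hC : 0 ≤ C) (hf : IsSmooth f L) (hp : IsPL f μ)
    (hg : IsGradientSample f π g Lg A B C)
    {x : E d} (hx : 0 < subopt f x) : 2 * μ ≤ 2 * A * L + B := by
  by_contra! h
  obtain ⟨y, hy⟩ := exists_subopt_ge hL hμ hf hp hx ((C + 1) / (2 * μ - (2 * A * L + B)))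
  rw [div_le_iff₀ (by linarith)] at hy
  have h1 := hp.le_norm_sq y
  have h2 := abcBound_le (A := A) (B := B) (C := C) hL hA hf hp y
  have h3 := pow_le_pow_left₀ (norm_nonneg _) (hg.norm_gradient_le y) 2
  rw [Real.sq_sqrt (abcBound_nonneg hA hB hC hp y)] at h3
  linarith

theorem le_of_subopt_pos (hL : 0 < L) (hf : IsSmooth f L) (hp : IsPL f μ)
    {x : E d} (hx : 0 < subopt f x) : μ ≤ L := by
  have h1 := hp.le_norm_sq x
  have h2 := norm_gradient_sq_le hL hf hp x
  by_contra! h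
  nlinarith

theorem pos_dim_of_subopt_pos {x : E d} (hx : 0 < subopt f x) : 1 ≤ d := by
  rcases Nat.eq_zero_or_pos d with rfl | h
  · have : (⨅ y, f y) = f x := by
      rw [iInf_congr (fun y => congrArg f (Subsingleton.elim y x))]
      simp
    unfold subopt at hx
    linarith
  · exact h

end Smooth

/-! ### The Poisson equation of a uniformly ergodic chain -/

section Poisson

variable {S : Type v} [MeasurableSpace S] {d : ℕ}

theorem integrable_of_norm_le {T : Type*} [MeasurableSpace T] {ρ : Measure T} [IsFiniteMeasure ρ]
    {φ : T → E d} (hφ : Measurable φ) {G : ℝ} (hb : ∀ z, ‖φ z‖ ≤ G) : Integrable φ ρ :=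
  Integrable.of_bound hφ.aestronglyMeasurable G (ae_of_all _ hb)

theorem norm_integral_sub_integral_le_tvDist (ρ₁ ρ₂ : Measure S) [IsFiniteMeasure ρ₁]
    [IsFiniteMeasure ρ₂] {φ : S → E d} (hφ : Measurable φ) {G : ℝ} (hb : ∀ z, ‖φ z‖ ≤ G) :
    ‖(∫ z, φ z ∂ρ₁) - ∫ z, φ z ∂ρ₂‖ ≤ 2 * tvDist ρ₁ ρ₂ * G := by
  set j := (ρ₁.toSignedMeasure - ρ₂.toSignedMeasure).toJordanDecomposition with hj
  have h1 : ρ₁.toSignedMeasure - ρ₂.toSignedMeasure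
      = j.posPart.toSignedMeasure - j.negPart.toSignedMeasure :=
    (SignedMeasure.toSignedMeasure_toJordanDecomposition _).symm
  have h2 : ρ₁ + j.negPart = ρ₂ + j.posPart := by
    rw [← Measure.toSignedMeasure_eq_toSignedMeasure_iff, Measure.toSignedMeasure_add,
      Measure.toSignedMeasure_add]
    rw [sub_eq_sub_iff_add_eq_add] at h1
    rw [h1, add_comm]
  have hi : ∀ ρ : Measure S, IsFiniteMeasure ρ → Integrable φ ρ :=
    fun ρ _ => integrable_of_norm_le hφ hb
  have h3 : (∫ z, φ z ∂ρ₁) + ∫ z, φ z ∂j.negPart = (∫ z, φ z ∂ρ₂) + ∫ z, φ z ∂j.posPart := by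
    rw [← integral_add_measure (hi _ inferInstance) (hi _ inferInstance), h2,
      integral_add_measure (hi _ inferInstance) (hi _ inferInstance)]
  have h4 : (∫ z, φ z ∂ρ₁) - ∫ z, φ z ∂ρ₂ = (∫ z, φ z ∂j.posPart) - ∫ z, φ z ∂j.negPart := by
    rw [sub_eq_sub_iff_add_eq_add, h3, add_comm]
  have h5 : 2 * tvDist ρ₁ ρ₂ = j.posPart.real Set.univ + j.negPart.real Set.univ := by
    rw [tvDist, SignedMeasure.totalVariation, ← hj, measureReal_add_apply]
    ring
  rw [h4, h5, add_mul]
  refine (norm_sub_le _ _).trans (add_le_add ?_ ?_) <;>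
  · rw [mul_comm]
    exact norm_integral_le_of_norm_le_const (ae_of_all _ hb)

/-- The coefficients `c_j` of the bound `‖E[φ(Z_j) | Z_0] - [t ≤ j] ∫ φ dπ‖ ≤ c_j sup ‖φ‖`. -/
noncomputable def mixCoef (t j : ℕ) : ℝ := if j < t then 1 else 2 * (1 / 2) ^ (j / t)

theorem hasSum_mixCoef {t : ℕ} (ht : 1 ≤ t) : HasSum (mixCoef t) (3 * t) := by
  have : NeZero t := ⟨by omega⟩
  have h1 : HasSum (fun q : ℕ => if q = 0 then (1 : ℝ) else 2 * (1 / 2) ^ q) 3 := by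
    rw [← hasSum_nat_add_iff' 1]
    have h := (hasSum_geometric_of_lt_one (r := (1 / 2 : ℝ)) (by norm_num) (by norm_num))
    norm_num at h ⊢
    refine h.congr_fun fun q => ?_
    rw [pow_succ]
    ring
  have h2 : HasSum (fun _ : Fin t => (1 : ℝ)) t := by
    simpa using hasSum_fintype (fun _ : Fin t => (1 : ℝ))
  have h3 := h1.mul h2 (h1.summable.mul_of_nonneg h2.summable
    (fun q => by dsimp only; split_ifs <;> positivity) fun _ => zero_le_one)
  rw [← (Nat.divModEquiv t).hasSum_iff] at h3
  refine h3.congr_fun fun j => ?_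
  simp only [mixCoef, Function.comp, Nat.divModEquiv_apply, mul_one,
    Nat.div_eq_zero_iff, NeZero.ne t, false_or]

/-- The `j`-th term of the series solution of the Poisson equation. -/
noncomputable def poissonTerm (p : Kernel S S) (π : Measure S) (t : ℕ) (φ : S → E d) (j : ℕ)
    (z : S) : E d :=
  (∫ w, φ w ∂(p ^ j) z) - if t ≤ j then ∫ w, φ w ∂π else 0

/-- A solution of the Poisson equation `h - p h = φ - ∫ φ dπ`. The mean `∫ φ dπ` is subtracted only
from the terms `j ≥ t`; this shifts the usual solution by a constant and makes its sup norm at most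
`3 t sup ‖φ‖`. -/
noncomputable def poissonSol (p : Kernel S S) (π : Measure S) (t : ℕ) (φ : S → E d) (z : S) :
    E d :=
  ∑' j, poissonTerm p π t φ j z

theorem measurable_poissonTerm (p : Kernel S S) (π : Measure S) (t : ℕ)
    {φ : S → E d} (hφ : Measurable φ) (j : ℕ) :
    Measurable fun z => poissonTerm p π t φ j z :=
  (hφ.stronglyMeasurable.integral_kernel (κ := p ^ j)).measurable.sub measurable_const

variable {p : Kernel S S} [IsMarkovKernel p] {π : Measure S} [IsProbabilityMeasure π] {t : ℕ}

theorem norm_poissonTerm_le (hp : IsGeometricallyErgodic p π t) {φ : S → E d}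
    (hφ : Measurable φ) {G : ℝ} (hb : ∀ z, ‖φ z‖ ≤ G) (j : ℕ) (z : S) :
    ‖poissonTerm p π t φ j z‖ ≤ mixCoef t j * G := by
  unfold poissonTerm mixCoef
  by_cases h : t ≤ j
  · rw [if_pos h, if_neg (not_lt.2 h)]
    refine (norm_integral_sub_integral_le_tvDist _ _ hφ hb).trans ?_
    have hG : 0 ≤ G := (norm_nonneg _).trans (hb z)
    gcongr
    exact hp.mixing j z
  · rw [if_neg h, if_pos (not_le.1 h), sub_zero, one_mul]
    simpa using norm_integral_le_of_norm_le_const (μ := (p ^ j) z) (ae_of_all _ hb)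

theorem summable_poissonTerm (hp : IsGeometricallyErgodic p π t) {φ : S → E d}
    (hφ : Measurable φ) {G : ℝ} (hb : ∀ z, ‖φ z‖ ≤ G) (z : S) :
    Summable fun j => poissonTerm p π t φ j z :=
  ((hasSum_mixCoef hp.one_le).summable.mul_right G).of_norm_bounded
    fun j => norm_poissonTerm_le hp hφ hb j z

theorem norm_poissonSol_le (hp : IsGeometricallyErgodic p π t) {φ : S → E d}
    (hφ : Measurable φ) {G : ℝ} (hb : ∀ z, ‖φ z‖ ≤ G) (z : S) :
    ‖poissonSol p π t φ z‖ ≤ 3 * t * G :=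
  tsum_of_norm_bounded ((hasSum_mixCoef hp.one_le).mul_right G)
    fun j => norm_poissonTerm_le hp hφ hb j z

theorem poissonSol_sub (hp : IsGeometricallyErgodic p π t) {φ ψ : S → E d}
    (hφ : Measurable φ) (hψ : Measurable ψ) {G G' : ℝ} (hb : ∀ z, ‖φ z‖ ≤ G)
    (hb' : ∀ z, ‖ψ z‖ ≤ G') (z : S) :
    poissonSol p π t (fun w => φ w - ψ w) z = poissonSol p π t φ z - poissonSol p π t ψ z := by
  unfold poissonSol
  rw [← (summable_poissonTerm hp hφ hb z).tsum_sub (summable_poissonTerm hp hψ hb' z)]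
  refine tsum_congr fun j => ?_
  unfold poissonTerm
  rw [integral_sub (integrable_of_norm_le hφ hb) (integrable_of_norm_le hψ hb'),
    integral_sub (integrable_of_norm_le hφ hb) (integrable_of_norm_le hψ hb')]
  split_ifs
  · abel
  · simp

theorem measurable_poissonSol (hp : IsGeometricallyErgodic p π t) {φ : S → E d}
    (hφ : Measurable φ) {G : ℝ} (hb : ∀ z, ‖φ z‖ ≤ G) :
    Measurable (poissonSol p π t φ) := by
  refine measurable_of_tendsto_metrizable
    (f := fun n z => ∑ j ∈ Finset.range n, poissonTerm p π t φ j z)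
    (fun n => Finset.measurable_sum _ fun j _ => measurable_poissonTerm p π t hφ j) ?_
  rw [tendsto_pi_nhds]
  exact fun z => (summable_poissonTerm hp hφ hb z).hasSum.tendsto_sum_nat

theorem integral_pow_succ {φ : S → E d} (hφ : Measurable φ) {G : ℝ} (hb : ∀ z, ‖φ z‖ ≤ G)
    (j : ℕ) (z : S) :
    ∫ y, ∫ w, φ w ∂(p ^ j) y ∂p z = ∫ w, φ w ∂(p ^ (j + 1)) z := by
  have h : p ^ (j + 1) = (p ^ j) ∘ₖ p := pow_succ p j
  rw [h, Kernel.integral_comp (integrable_of_norm_le hφ hb)]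

theorem poissonSol_sub_integral (hp : IsGeometricallyErgodic p π t) {φ : S → E d}
    (hφ : Measurable φ) {G : ℝ} (hb : ∀ z, ‖φ z‖ ≤ G) (z : S) :
    poissonSol p π t φ z - ∫ y, poissonSol p π t φ y ∂p z = φ z - ∫ w, φ w ∂π := by
  have hsum := hasSum_mixCoef hp.one_le
  have hint : ∀ j, Integrable (fun y => poissonTerm p π t φ j y) (p z) := fun j =>
    integrable_of_norm_le (measurable_poissonTerm p π t hφ j)
      fun y => norm_poissonTerm_le hp hφ hb j y
  have h1 : HasSum (fun j => ∫ y, poissonTerm p π t φ j y ∂p z)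
      (∫ y, poissonSol p π t φ y ∂p z) := by
    refine hasSum_integral_of_summable_integral_norm hint ?_
    refine (hsum.summable.mul_right G).of_nonneg_of_le
      (fun j => integral_nonneg fun y => norm_nonneg _) fun j => ?_
    calc ∫ y, ‖poissonTerm p π t φ j y‖ ∂p z ≤ ∫ _, mixCoef t j * G ∂p z :=
          integral_mono (hint j).norm (integrable_const _)
            fun y => norm_poissonTerm_le hp hφ hb j y
      _ = mixCoef t j * G := by simp
  have h2 : ∀ j, poissonTerm p π t φ j z - ∫ y, poissonTerm p π t φ j y ∂p z
      = (∫ w, φ w ∂(p ^ j) z) - ∫ w, φ w ∂(p ^ (j + 1)) z := by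
    intro j
    have h3 : ∫ y, poissonTerm p π t φ j y ∂p z
        = (∫ w, φ w ∂(p ^ (j + 1)) z) - if t ≤ j then ∫ w, φ w ∂π else 0 := by
      unfold poissonTerm
      rw [integral_sub _ (integrable_const _), integral_pow_succ hφ hb]
      · simp
      · refine integrable_of_norm_le
          (hφ.stronglyMeasurable.integral_kernel (κ := p ^ j)).measurable (G := G) fun y => ?_
        simpa using norm_integral_le_of_norm_le_const (μ := (p ^ j) y) (ae_of_all _ hb)
    rw [h3]
    unfold poissonTerm
    abel
  have h4 := ((summable_poissonTerm hp hφ hb z).hasSum.sub h1).tendsto_sum_nat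
  simp only [h2, Finset.sum_range_sub'] at h4
  have h5 : Filter.Tendsto (fun j => ∫ w, φ w ∂(p ^ j) z) Filter.atTop
      (nhds (∫ w, φ w ∂π)) := by
    rw [tendsto_iff_norm_sub_tendsto_zero]
    refine squeeze_zero' (Filter.Eventually.of_forall fun j => norm_nonneg _) ?_
      (by simpa using (hsum.summable.mul_right G).tendsto_atTop_zero)
    filter_upwards [Filter.eventually_ge_atTop t] with j hj
    simpa only [poissonTerm, if_pos hj] using norm_poissonTerm_le hp hφ hb j z
  have h6 := tendsto_nhds_unique h4 (tendsto_const_nhds.sub h5)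
  have h7 : ∫ w, φ w ∂(p ^ 0) z = φ z := by
    have h : p ^ 0 = Kernel.id := pow_zero p
    rw [h, Kernel.id_apply, integral_dirac' _ _ hφ.stronglyMeasurable]
  rw [h7] at h6
  exact h6

end Poisson

/-! ### Conditional expectations along the chain, and concentration -/

section Probability

variable {Ω : Type u} {m mΩ : MeasurableSpace Ω} {P : Measure Ω} [IsProbabilityMeasure P]

section Transition

variable {S : Type v} [MeasurableSpace S] {T : Type*} [MeasurableSpace T]
  {p : Kernel S S} [IsMarkovKernel p] {Z Z' : Ω → S} {Y : Ω → T}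

/-- Disintegration: given the past `m`, the next state `Z'` has law `p (Z, ·)`, jointly with any
`m`-measurable variable `Y`. -/
theorem map_restrict_eq_compProd (hm : m ≤ mΩ) (hZ : Measurable[m] Z) (hZ' : Measurable Z')
    (htrans : ∀ s : Set S, MeasurableSet s →
      P⟦Z' ⁻¹' s | m⟧ =ᵐ[P] fun ω => (p (Z ω)).real s)
    (hY : Measurable[m] Y) {s : Set Ω} (hs : MeasurableSet[m] s) :
    (P.restrict s).map (fun ω => ((Y ω, Z ω), Z' ω))
      = ((P.restrict s).map fun ω => (Y ω, Z ω)) ⊗ₘ (p.comap Prod.snd measurable_snd) := by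
  have hYZ : Measurable[m] fun ω => (Y ω, Z ω) := hY.prodMk hZ
  have hYZ' : Measurable fun ω => (Y ω, Z ω) := hYZ.mono hm le_rfl
  refine Measure.ext_prod fun {A B} hA hB => ?_
  have hsA : MeasurableSet[m] ((fun ω => (Y ω, Z ω)) ⁻¹' A ∩ s) := (hYZ hA).inter hs
  rw [Measure.map_apply (hYZ'.prodMk hZ') (hA.prod hB), Measure.compProd_apply_prod hA hB,
    setLIntegral_map hA (Kernel.measurable_coe _ hB) hYZ', Measure.restrict_restrict (hYZ' hA),
    Measure.restrict_apply ((hYZ'.prodMk hZ') (hA.prod hB))]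
  have h1 : ∫ ω in (fun ω => (Y ω, Z ω)) ⁻¹' A ∩ s, (p (Z ω)).real B ∂P
      = P.real (Z' ⁻¹' B ∩ ((fun ω => (Y ω, Z ω)) ⁻¹' A ∩ s)) := by
    rw [← setIntegral_congr_ae (hm _ hsA) ((htrans B hB).mono fun ω h _ => h),
      setIntegral_condExp hm ((integrable_const _).indicator (hZ' hB)) hsA,
      integral_indicator_const _ (hZ' hB), smul_eq_mul, mul_one,
      measureReal_restrict_apply (hZ' hB)]
  let κ : Kernel (T × S) S := p.comap Prod.snd measurable_snd
  have h2 : ∀ q, κ q B = ENNReal.ofReal ((p q.2).real B) := fun q => by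
    rw [Kernel.comap_apply, ofReal_measureReal]
  change _ = ∫⁻ ω in _, κ (Y ω, Z ω) B ∂P
  simp_rw [h2]
  rw [← ofReal_integral_eq_lintegral_ofReal, h1, ofReal_measureReal]
  · congr 1
    ext ω
    simp only [Set.mem_inter_iff, Set.mem_preimage, Set.mem_prod]
    tauto
  · refine Integrable.of_bound (C := 1) ?_ (ae_of_all _ fun ω => ?_)
    · exact ((Kernel.measurable_coe p hB).comp (hZ.mono hm le_rfl)).ennreal_toReal
        |>.aestronglyMeasurable
    · rw [Real.norm_of_nonneg measureReal_nonneg]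
      exact measureReal_le_one
  · exact ae_of_all _ fun ω => measureReal_nonneg

theorem condExp_comp_next (hm : m ≤ mΩ) (hZ : Measurable[m] Z) (hZ' : Measurable Z')
    (htrans : ∀ s : Set S, MeasurableSet s →
      P⟦Z' ⁻¹' s | m⟧ =ᵐ[P] fun ω => (p (Z ω)).real s)
    (hY : Measurable[m] Y) {Φ : T × S → ℝ} (hΦ : Measurable Φ) {K : ℝ}
    (hK : ∀ ω z, |Φ (Y ω, z)| ≤ K) :
    P[fun ω => Φ (Y ω, Z' ω) | m] =ᵐ[P] fun ω => ∫ z, Φ (Y ω, z) ∂p (Z ω) := by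
  have hYm : Measurable Y := hY.mono hm le_rfl
  have hκ : StronglyMeasurable fun q : T × S =>
      ∫ z, Φ (q.1, z) ∂(p.comap (Prod.snd : T × S → S) measurable_snd) q :=
    StronglyMeasurable.integral_kernel_prod_right'
      (κ := p.comap (Prod.snd : T × S → S) measurable_snd)
      (f := fun q : (T × S) × S => Φ (q.1.1, q.2)) (by
        exact (hΦ.comp (by fun_prop)).stronglyMeasurable)
  have hkm : StronglyMeasurable[m] fun ω => ∫ z, Φ (Y ω, z) ∂p (Z ω) :=
    hκ.comp_measurable (hY.prodMk hZ)
  have hint : Integrable (fun ω => Φ (Y ω, Z' ω)) P :=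
    Integrable.of_bound (hΦ.comp (hYm.prodMk hZ')).aestronglyMeasurable K
      (ae_of_all _ fun ω => hK ω _)
  have hint' : Integrable (fun ω => ∫ z, Φ (Y ω, z) ∂p (Z ω)) P :=
    Integrable.of_bound (hkm.mono hm).aestronglyMeasurable K (ae_of_all _ fun ω => by
      simpa using norm_integral_le_of_norm_le_const (μ := p (Z ω))
        (ae_of_all _ fun z => (Real.norm_eq_abs _).trans_le (hK ω z)))
  refine (ae_eq_condExp_of_forall_setIntegral_eq hm hint (fun s _ _ => hint'.integrableOn)
    (fun s hs _ => ?_) hkm.aestronglyMeasurable).symm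
  have hYZ' : Measurable fun ω => (Y ω, Z ω) := (hY.prodMk hZ).mono hm le_rfl
  have hmap := map_restrict_eq_compProd hm hZ hZ' htrans hY hs
  have hΨ : Measurable fun q : (T × S) × S => Φ (q.1.1, q.2) := hΦ.comp (by fun_prop)
  have h1 : ∫ ω in s, Φ (Y ω, Z' ω) ∂P
      = ∫ q, Φ (q.1.1, q.2) ∂((P.restrict s).map (fun ω => ((Y ω, Z ω), Z' ω))) :=
    (integral_map (hYZ'.prodMk hZ').aemeasurable hΨ.aestronglyMeasurable).symm
  have hΨi : Integrable (fun q : (T × S) × S => Φ (q.1.1, q.2))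
      ((P.restrict s).map (fun ω => ((Y ω, Z ω), Z' ω))) := by
    rw [integrable_map_measure hΨ.aestronglyMeasurable (hYZ'.prodMk hZ').aemeasurable]
    exact hint.restrict
  rw [h1, hmap, Measure.integral_compProd (hmap ▸ hΨi), integral_map hYZ'.aemeasurable]
  · simp only [Kernel.comap_apply]
  · exact hκ.aestronglyMeasurable

end Transition

section Concentration

theorem exp_le_cosh_add {θ s : ℝ} (h : |θ| ≤ s) :
    Real.exp θ ≤ Real.cosh s + Real.sinh s / s * θ := by
  rcases (abs_nonneg θ).trans h |>.eq_or_lt with rfl | hs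
  · rw [abs_nonpos_iff.1 h]
    simp
  obtain ⟨h1, h2⟩ := abs_le.1 h
  have := convexOn_exp.2 (Set.mem_univ s) (Set.mem_univ (-s))
    (show 0 ≤ (s + θ) / (2 * s) by have : 0 ≤ s + θ := by linarith
                                   positivity)
    (show 0 ≤ (s - θ) / (2 * s) by have : 0 ≤ s - θ := by linarith
                                   positivity)
    (by field_simp; ring)
  rw [Real.cosh_eq, Real.sinh_eq]
  simp only [smul_eq_mul] at this
  have e : (s + θ) / (2 * s) * s + (s - θ) / (2 * s) * -s = θ := by field_simp; ring
  rw [e] at this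
  refine this.trans_eq ?_
  field_simp
  ring

/-- **Azuma-Hoeffding inequality** with predictable bounds `s i` for the increments, normalized so
that the exponential parameter is `1`. -/
theorem measure_sum_ge_le_exp {F : ℕ → MeasurableSpace Ω} (hmono : Monotone F)
    (hle : ∀ i, F i ≤ mΩ) {θ s : ℕ → Ω → ℝ} {n : ℕ} {ℓ : ℝ}
    (hθ : ∀ i, Measurable[F (i + 1)] (θ i)) (hs : ∀ i, Measurable[F i] (s i))
    (hbound : ∀ i < n, ∀ᵐ ω ∂P, |θ i ω| ≤ s i ω)
    (hsum : ∀ ω, ∑ i ∈ Finset.range n, s i ω ^ 2 ≤ 2 * ℓ)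
    (hcond : ∀ i < n, P[θ i | F i] =ᵐ[P] 0) :
    P {ω | 2 * ℓ ≤ ∑ i ∈ Finset.range n, θ i ω} ≤ ENNReal.ofReal (Real.exp (-ℓ)) := by
  set K := √(2 * ℓ)
  have hsK : ∀ i < n, ∀ ω, s i ω ≤ K := fun i hi ω =>
    Real.le_sqrt_of_sq_le ((Finset.single_le_sum (f := fun i => s i ω ^ 2)
      (fun j _ => sq_nonneg _) (Finset.mem_range.2 hi)).trans (hsum ω))
  let W : ℕ → Ω → ℝ := fun k ω => Real.exp (∑ i ∈ Finset.range k, (θ i ω - s i ω ^ 2 / 2))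
  have hWm : ∀ k, Measurable[F k] (W k) := fun k => by
    refine Real.measurable_exp.comp (Finset.measurable_sum _ fun i hi => ?_)
    have hik : i < k := Finset.mem_range.1 hi
    exact ((hθ i).mono (hmono hik) le_rfl).sub
      ((((hs i).mono (hmono hik.le) le_rfl).pow_const 2).div_const 2)
  have hWb : ∀ k ≤ n, ∀ᵐ ω ∂P, W k ω ≤ Real.exp (k * K) := fun k hk => by
    have h : ∀ᵐ ω ∂P, ∀ i ∈ Finset.range k, |θ i ω| ≤ s i ω :=
      (Finset.eventually_all _).2 fun i hi => hbound i ((Finset.mem_range.1 hi).trans_le hk)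
    filter_upwards [h] with ω hω
    refine Real.exp_le_exp.2 ((Finset.sum_le_card_nsmul _ _ K fun i hi => ?_).trans_eq
      (by simp))
    have h1 := (le_abs_self _).trans (hω i hi)
    have h2 := hsK i ((Finset.mem_range.1 hi).trans_le hk) ω
    nlinarith [sq_nonneg (s i ω)]
  have hWi : ∀ k ≤ n, Integrable (W k) P := fun k hk => by
    refine Integrable.of_bound ((hWm k).mono (hle k) le_rfl).aestronglyMeasurable
      (Real.exp (k * K)) ?_
    filter_upwards [hWb k hk] with ω hω
    rwa [Real.norm_of_nonneg (Real.exp_nonneg _)]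
  have hmain : ∀ k ≤ n, ∫ ω, W k ω ∂P ≤ 1 := by
    intro k
    induction k with
    | zero => intro _; simp [W]
    | succ k ih =>
      intro hk
      have hkn : k < n := hk
      let U : Ω → ℝ := fun ω =>
        W k ω * (Real.exp (-(s k ω ^ 2 / 2)) * (Real.sinh (s k ω) / s k ω))
      have hUm : Measurable[F k] U :=
        (hWm k).mul ((Real.measurable_exp.comp ((hs k).pow_const 2 |>.div_const 2 |>.neg)).mul
          ((Real.measurable_sinh.comp (hs k)).div (hs k)))
      have hUi : Integrable (fun ω => U ω * θ k ω) P := by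
        refine Integrable.of_bound ((hUm.mono (hle k) le_rfl).mul
          ((hθ k).mono (hle _) le_rfl)).aestronglyMeasurable
          (Real.exp (k * K) * Real.exp K) ?_
        filter_upwards [hWb k hkn.le, hbound k hkn] with ω h1 h2
        have hs0 : 0 ≤ s k ω := (abs_nonneg _).trans h2
        have h3 : 0 ≤ Real.sinh (s k ω) := Real.sinh_nonneg_iff.2 hs0
        have h4 : Real.sinh (s k ω) / s k ω * |θ k ω| ≤ Real.exp K := by
          calc Real.sinh (s k ω) / s k ω * |θ k ω| ≤ Real.sinh (s k ω) / s k ω * s k ω := by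
                gcongr
            _ ≤ Real.sinh (s k ω) := by
                rcases hs0.eq_or_lt with h0 | h0
                · simp [← h0]
                · rw [div_mul_cancel₀ _ h0.ne']
            _ ≤ Real.exp (s k ω) := by
                rw [← Real.cosh_add_sinh]
                linarith [Real.cosh_pos (s k ω)]
            _ ≤ Real.exp K := Real.exp_le_exp.2 (hsK k hkn ω)
        have h5 : Real.exp (-(s k ω ^ 2 / 2)) ≤ 1 := Real.exp_le_one_iff.2 (by
          have := sq_nonneg (s k ω)
          linarith)
        rw [norm_mul, Real.norm_eq_abs, Real.norm_eq_abs, abs_of_nonneg (by positivity)]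
        calc W k ω * (Real.exp (-(s k ω ^ 2 / 2)) * (Real.sinh (s k ω) / s k ω)) * |θ k ω|
            = W k ω * (Real.exp (-(s k ω ^ 2 / 2)) *
                (Real.sinh (s k ω) / s k ω * |θ k ω|)) := by ring
          _ ≤ Real.exp (k * K) * (1 * Real.exp K) := by gcongr
          _ = _ := by ring
      have hθi : Integrable (θ k) P := by
        refine Integrable.of_bound ((hθ k).mono (hle _) le_rfl).aestronglyMeasurable K ?_
        filter_upwards [hbound k hkn] with ω h
        exact h.trans (hsK k hkn ω)
      have hU0 : ∫ ω, U ω * θ k ω ∂P = 0 := by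
        rw [← integral_condExp (hle k)]
        have h : P[fun ω => U ω * θ k ω | F k] =ᵐ[P] U * P[θ k | F k] :=
          condExp_mul_of_stronglyMeasurable_left (μ := P) hUm.stronglyMeasurable hUi hθi
        rw [integral_congr_ae h]
        refine integral_eq_zero_of_ae ?_
        filter_upwards [hcond k hkn] with ω hω
        simp [hω]
      calc ∫ ω, W (k + 1) ω ∂P ≤ ∫ ω, (W k ω + U ω * θ k ω) ∂P := by
            refine integral_mono_ae (hWi _ hk) ((hWi k hkn.le).add hUi) ?_
            filter_upwards [hbound k hkn] with ω h
            have e : W (k + 1) ω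
                = W k ω * (Real.exp (-(s k ω ^ 2 / 2)) * Real.exp (θ k ω)) := by
              simp only [W]
              rw [Finset.sum_range_succ, Real.exp_add, ← Real.exp_add (-(s k ω ^ 2 / 2))]
              ring_nf
            have h1 := exp_le_cosh_add h
            have h2 := Real.cosh_le_exp_half_sq (s k ω)
            have h3 : Real.exp (-(s k ω ^ 2 / 2)) * Real.cosh (s k ω) ≤ 1 := by
              rw [Real.exp_neg, inv_mul_le_iff₀ (Real.exp_pos _), mul_one]
              exact h2
            rw [e]
            calc W k ω * (Real.exp (-(s k ω ^ 2 / 2)) * Real.exp (θ k ω))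
                ≤ W k ω * (Real.exp (-(s k ω ^ 2 / 2)) *
                    (Real.cosh (s k ω) + Real.sinh (s k ω) / s k ω * θ k ω)) := by
                  have : 0 ≤ W k ω := Real.exp_nonneg _
                  gcongr
              _ = W k ω * (Real.exp (-(s k ω ^ 2 / 2)) * Real.cosh (s k ω))
                    + U ω * θ k ω := by simp only [U]; ring
              _ ≤ W k ω * 1 + U ω * θ k ω := by
                  have : 0 ≤ W k ω := Real.exp_nonneg _
                  gcongr
              _ = _ := by ring
        _ = ∫ ω, W k ω ∂P := by rw [integral_add (hWi k hkn.le) hUi, hU0, add_zero]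
        _ ≤ 1 := ih hkn.le
  have hsub : {ω | 2 * ℓ ≤ ∑ i ∈ Finset.range n, θ i ω} ⊆ {ω | Real.exp ℓ ≤ W n ω} := by
    intro ω hω
    refine Real.exp_le_exp.2 ?_
    rw [Finset.sum_sub_distrib, ← Finset.sum_div]
    have := hsum ω
    simp only [Set.mem_ofPred_eq] at hω
    linarith
  refine (measure_mono hsub).trans ?_
  have h1 := mul_meas_ge_le_integral_of_nonneg (ae_of_all _ fun ω => Real.exp_nonneg _)
    (hWi n le_rfl) (Real.exp ℓ)
  rw [← ofReal_measureReal]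
  refine ENNReal.ofReal_le_ofReal ?_
  rw [Real.exp_neg, ← one_div, le_div_iff₀ (Real.exp_pos ℓ), mul_comm]
  exact h1.trans (hmain n le_rfl)

end Concentration

end Probability

/-! ### Recursions with the weights `∏ (1 - y / (j + K))` -/

section Recursion

/-- The factor `∏_{i < j < k} (1 - y / (j + K))` by which a perturbation made in step `i` is damped
until time `k`. -/
noncomputable def damping (y K : ℝ) (i k : ℕ) : ℝ := ∏ j ∈ Finset.Ico (i + 1) k, (1 - y / (j + K))

theorem damping_succ {y K : ℝ} {i k : ℕ} (h : i < k) :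
    damping y K i (k + 1) = damping y K i k * (1 - y / (k + K)) :=
  Finset.prod_Ico_succ_top h _

theorem damping_self_succ (y K : ℝ) (k : ℕ) : damping y K k (k + 1) = 1 := by
  simp [damping]

theorem sum_damping_pow_succ (y K : ℝ) (r : ℕ) (c : ℕ → ℝ) (k : ℕ) :
    ∑ i ∈ Finset.range (k + 1), damping y K i (k + 1) ^ r * c i
      = (1 - y / (k + K)) ^ r * ∑ i ∈ Finset.range k, damping y K i k ^ r * c i + c k := by
  rw [Finset.sum_range_succ, damping_self_succ, one_pow, one_mul, Finset.mul_sum]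
  congr 1
  refine Finset.sum_congr rfl fun i hi => ?_
  rw [damping_succ (Finset.mem_range.1 hi), mul_pow]
  ring

variable {y K : ℝ}

/-- A recursion with contraction factors `1 - y / n`, `n = i + K`, and errors `ρ / n²` decays like
`1 / n`, up to the damped sum of the further perturbations `c i`. -/
theorem le_of_damped_recursion (hy : 2 ≤ y) (hK : y ≤ K) {φ c : ℕ → ℝ} {ρ : ℝ} (hρ : 0 ≤ ρ)
    (h0 : 0 ≤ φ 0) {k : ℕ}
    (h : ∀ i < k, φ (i + 1) ≤ (1 - y / (i + K)) * φ i + ρ / (i + K) ^ 2 + c i) :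
    φ k ≤ (K * φ 0 + ρ / (y - 1)) / (k + K) + ∑ i ∈ Finset.range k, damping y K i k * c i := by
  set M := K * φ 0 + ρ / (y - 1) with hM
  have hM0 : 0 ≤ M := add_nonneg (mul_nonneg (by linarith) h0) (div_nonneg hρ (by linarith))
  have hMρ : ρ ≤ M * (y - 1) := by
    rw [← div_le_iff₀ (by linarith)]
    have : 0 ≤ K * φ 0 := mul_nonneg (by linarith) h0
    linarith
  induction k with
  | zero =>
    have : 0 ≤ ρ / (y - 1) := div_nonneg hρ (by linarith)
    have hK0 : 0 < K := by linarith
    simp only [Nat.cast_zero, zero_add, Finset.range_zero, Finset.sum_empty, add_zero]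
    rw [le_div_iff₀ hK0]
    linarith
  | succ k ih =>
    have h1 := ih fun i hi => h i (by omega)
    have h2 := h k (by omega)
    have h3 := sum_damping_pow_succ y K 1 c k
    simp only [pow_one] at h3
    rw [h3]
    have hk : (0 : ℝ) ≤ k := k.cast_nonneg
    set n : ℝ := k + K with hn
    have hn0 : 0 < n := by linarith
    have hyn : 0 ≤ 1 - y / n := by
      rw [sub_nonneg, div_le_one hn0]
      linarith
    have h4 : (1 - y / n) * (M / n) + ρ / n ^ 2 ≤ M / (n + 1) := by
      have e : (1 - y / n) * (M / n) + ρ / n ^ 2 = (M * (n - y) + ρ) / n ^ 2 := by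
        field_simp
      rw [e, div_le_div_iff₀ (by positivity) (by linarith)]
      nlinarith [mul_le_mul_of_nonneg_right hMρ (show 0 ≤ n + 1 by linarith)]
    have e : ((k + 1 : ℕ) : ℝ) + K = n + 1 := by push_cast; ring
    rw [e]
    have h5 := mul_le_mul_of_nonneg_left h1 hyn
    rw [mul_add] at h5
    linarith

theorem sum_damping_sq_div_pow_four_le (hy : 2 ≤ y) (hK : 100 * y ≤ K) (k : ℕ) :
    ∑ i ∈ Finset.range k, damping y K i k ^ 2 * (1 / (i + K) ^ 4)
      ≤ 5 / 4 / ((2 * y - 3) * (k + K) ^ 3) := by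
  induction k with
  | zero =>
    have : 0 < 2 * y - 3 := by linarith
    have : 0 < K := by linarith
    simp only [Finset.range_zero, Finset.sum_empty, Nat.cast_zero, zero_add]
    positivity
  | succ k ih =>
    rw [sum_damping_pow_succ]
    have hk : (0 : ℝ) ≤ k := k.cast_nonneg
    have e : ((k + 1 : ℕ) : ℝ) + K = (k + K) + 1 := by push_cast; ring
    rw [e]
    refine (add_le_add_left (mul_le_mul_of_nonneg_left ih (sq_nonneg _)) _).trans ?_
    have hn : 100 * y ≤ k + K := by linarith
    generalize (k : ℝ) + K = n at hn
    have hn0 : 0 < n := by linarith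
    have hy3 : 0 < 2 * y - 3 := by linarith
    have hy3' := hy3.ne'
    have e2 : (1 - y / n) ^ 2 * (5 / 4 / ((2 * y - 3) * n ^ 3)) + 1 / n ^ 4
        = (5 * (n - y) ^ 2 + 4 * (2 * y - 3) * n) / (4 * (2 * y - 3) * n ^ 5) := by
      generalize 2 * y - 3 = w at hy3'
      field_simp
    have e3 : 5 / 4 / ((2 * y - 3) * (n + 1) ^ 3) = 5 / (4 * (2 * y - 3) * (n + 1) ^ 3) := by
      field_simp
    rw [e2, e3, div_le_div_iff₀ (by positivity) (by positivity)]
    have key : (5 * (n - y) ^ 2 + 4 * (2 * y - 3) * n) * (n + 1) ^ 3 ≤ 5 * n ^ 5 := by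
      have h1 : 50 * y ^ 2 * n ^ 3 ≤ (2 * y - 3) * n ^ 4 := by
        have : 50 * y ^ 2 ≤ (2 * y - 3) * n := by nlinarith
        nlinarith [pow_pos hn0 3]
      have hn1 : 1 ≤ n := by linarith
      have hy2 : 0 ≤ y ^ 2 := sq_nonneg y
      have h2 : y ^ 2 * n ^ 2 ≤ y ^ 2 * n ^ 3 := by gcongr; norm_num
      have h3 : y ^ 2 * n ≤ y ^ 2 * n ^ 3 := by
        gcongr; exact le_self_pow₀ hn1 (by norm_num)
      have h4 : y ^ 2 ≤ y ^ 2 * n ^ 3 := le_mul_of_one_le_right hy2 (one_le_pow₀ hn1)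
      have h5 : 0 ≤ y * n ^ 3 := by positivity
      have h6 : 0 ≤ y * n ^ 2 := by positivity
      have h7 : 0 ≤ y * n := by positivity
      have h8 : 0 ≤ n ^ 3 := by positivity
      have h9 : 0 ≤ n ^ 2 := by positivity
      nlinarith
    have : 0 < 4 * (2 * y - 3) := by linarith
    nlinarith [mul_le_mul_of_nonneg_left key this.le]

theorem sum_damping_sq_div_pow_three_le (hy : 2 ≤ y) (hK : 100 * y ≤ K) (k : ℕ) :
    ∑ i ∈ Finset.range k, damping y K i k ^ 2 * (1 / (i + K) ^ 3)
      ≤ 5 / 4 / ((2 * y - 2) * (k + K) ^ 2) := by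
  induction k with
  | zero =>
    have : 0 < 2 * y - 2 := by linarith
    have : 0 < K := by linarith
    simp only [Finset.range_zero, Finset.sum_empty, Nat.cast_zero, zero_add]
    positivity
  | succ k ih =>
    rw [sum_damping_pow_succ]
    have hk : (0 : ℝ) ≤ k := k.cast_nonneg
    have e : ((k + 1 : ℕ) : ℝ) + K = (k + K) + 1 := by push_cast; ring
    rw [e]
    refine (add_le_add_left (mul_le_mul_of_nonneg_left ih (sq_nonneg _)) _).trans ?_
    have hn : 100 * y ≤ k + K := by linarith
    generalize (k : ℝ) + K = n at hn
    have hn0 : 0 < n := by linarith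
    have hy3 : 0 < 2 * y - 2 := by linarith
    have hy3' : y - 1 ≠ 0 := by linarith
    have e2 : (1 - y / n) ^ 2 * (5 / 4 / ((2 * y - 2) * n ^ 2)) + 1 / n ^ 3
        = (5 * (n - y) ^ 2 + 4 * (2 * y - 2) * n) / (4 * (2 * y - 2) * n ^ 4) := by
      field_simp
    have e3 : 5 / 4 / ((2 * y - 2) * (n + 1) ^ 2) = 5 / (4 * (2 * y - 2) * (n + 1) ^ 2) := by
      field_simp
    rw [e2, e3, div_le_div_iff₀ (by positivity) (by positivity)]
    have key : (5 * (n - y) ^ 2 + 4 * (2 * y - 2) * n) * (n + 1) ^ 2 ≤ 5 * n ^ 4 := by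
      have h1 : 100 * y ^ 2 * n ^ 2 ≤ 2 * (y - 1) * n ^ 3 := by
        have : 100 * y ^ 2 ≤ 2 * (y - 1) * n := by nlinarith
        nlinarith [pow_pos hn0 2]
      have hn1 : 1 ≤ n := by linarith
      have hy2 : 0 ≤ y ^ 2 := sq_nonneg y
      have h3 : y ^ 2 * n ≤ y ^ 2 * n ^ 2 := by
        gcongr; exact le_self_pow₀ hn1 (by norm_num)
      have h4 : y ^ 2 ≤ y ^ 2 * n ^ 2 := le_mul_of_one_le_right hy2 (one_le_pow₀ hn1)
      have h6 : y * n ^ 2 ≤ y ^ 2 * n ^ 2 := by gcongr; nlinarith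
      have h7 : y * n ≤ y ^ 2 * n := by gcongr; nlinarith
      have h9 : 0 ≤ n ^ 2 := by positivity
      nlinarith
    have : 0 < 4 * (2 * y - 2) := by linarith
    nlinarith [mul_le_mul_of_nonneg_left key this.le]

end Recursion

/-! ### Estimates for the explicit constants -/

namespace Params

variable (q : Params)

/-- The coefficient of `f - f⋆` in the growth bound `‖g‖² ≤ Q (f - f⋆) + C` that follows from the
ABC condition and smoothness. -/
noncomputable def Q : ℝ := 2 * q.A * q.L + q.B

/-- The part of `ν₁` that comes from the constant `C`. -/
noncomputable def νC : ℝ :=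
  32 * (q.a * Real.exp 1) ^ 2 * q.L * ((q.t : ℝ) ^ 2 * q.d + 1) * (q.C / (2 * q.μ * q.a - 2))

/-- The constant part of the error caused by the Markovian bias. -/
noncomputable def err₁ : ℝ :=
  9 * q.a * q.t * q.C + 12 * q.a ^ 2 * q.t * (q.L + q.Lg) * q.C / (q.μ * q.a - 1)

/-- The part of the error caused by the Markovian bias that is proportional to the
suboptimality. -/
noncomputable def err₂ : ℝ :=
  9 * q.a * q.t * (2 * q.L + q.Q) + 12 * q.a ^ 2 * q.t * (q.L + q.Lg) * q.Q / (q.μ * q.a - 1)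

/-- The parameters of a problem with a non-constant objective, with one admissible choice of
`m₁, …, m₄`. -/
structure IsTuned : Prop where
  one_le_d : 1 ≤ q.d
  one_le_t : 1 ≤ q.t
  μ_pos : 0 < q.μ
  μ_le : q.μ ≤ q.L
  Lg_nonneg : 0 ≤ q.Lg
  C_nonneg : 0 ≤ q.C
  two_le : 2 ≤ q.μ * q.a
  le_Q : 2 * q.μ ≤ q.Q
  m₁_eq : q.m₁ = 60 * (2 * q.L + q.Q) / q.L
  m₂_eq : q.m₂ = 45 * q.C + 1
  m₃_eq : q.m₃ = 300 * q.Q / q.L + 1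
  m₄_eq : q.m₄ = 300 * q.C + 1

end Params

theorem two_lt_exp_one : (2 : ℝ) < Real.exp 1 := lt_trans (by norm_num) Real.exp_one_gt_d9

namespace Params.IsTuned

variable {q : Params} (h : q.IsTuned)
include h

theorem L_pos : 0 < q.L := h.μ_pos.trans_le h.μ_le

theorem Q_pos : 0 < q.Q := by linarith [h.le_Q, h.μ_pos]

theorem a_pos : 0 < q.a := by
  by_contra! h0
  nlinarith [h.two_le, h.μ_pos]

theorem one_le_sqrt_d : 1 ≤ √(q.d : ℝ) := Real.one_le_sqrt.2 (by exact_mod_cast h.one_le_d)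

theorem one_le_t' : (1 : ℝ) ≤ q.t := by exact_mod_cast h.one_le_t

theorem err₁_nonneg : 0 ≤ q.err₁ := by
  have := h.L_pos; have := h.a_pos; have := h.one_le_t'; have := h.Lg_nonneg
  have := h.C_nonneg; have : 0 < q.μ * q.a - 1 := by linarith [h.two_le]
  unfold err₁
  positivity

theorem err₂_nonneg : 0 ≤ q.err₂ := by
  have := h.L_pos; have := h.a_pos; have := h.one_le_t'; have := h.Lg_nonneg
  have := h.Q_pos; have : 0 < q.μ * q.a - 1 := by linarith [h.two_le]
  unfold err₂
  positivity

theorem err₂_le : 50 * q.err₂ ≤ q.D₂ := by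
  have hL := h.L_pos; have ha := h.a_pos; have ht := h.one_le_t'; have := h.Lg_nonneg
  have := h.Q_pos; have : 0 < q.μ * q.a - 1 := by linarith [h.two_le]
  have he := two_lt_exp_one
  have hd := h.one_le_sqrt_d
  have e1 : 8 * q.a * q.m₁ * q.t * q.L * √q.d = 480 * q.a * q.t * (2 * q.L + q.Q) * √q.d := by
    rw [h.m₁_eq]; field_simp; ring
  have e2 : q.m₃ * q.L = 300 * q.Q + q.L := by rw [h.m₃_eq]; field_simp
  have e3 : Real.exp 1 * q.a ^ 2 * q.m₃ * q.t * (q.L + q.Lg) * q.L * √q.d / (q.μ * q.a - 1)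
      = Real.exp 1 * (q.a ^ 2 * q.t * (q.L + q.Lg) / (q.μ * q.a - 1)) * (q.m₃ * q.L) * √q.d := by
    ring
  have e4 : 12 * q.a ^ 2 * q.t * (q.L + q.Lg) * q.Q / (q.μ * q.a - 1)
      = 12 * (q.a ^ 2 * q.t * (q.L + q.Lg) / (q.μ * q.a - 1)) * q.Q := by ring
  unfold D₂ err₂
  rw [e1, e3, e4, e2]
  set w := q.a ^ 2 * q.t * (q.L + q.Lg) / (q.μ * q.a - 1) with hw
  have hw0 : 0 ≤ w := by positivity
  have h1 : 450 * q.a * q.t * (2 * q.L + q.Q) * 1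
      ≤ 480 * q.a * q.t * (2 * q.L + q.Q) * √q.d := by gcongr; norm_num
  have h2 : 2 * w * (300 * q.Q) * 1 ≤ Real.exp 1 * w * (300 * q.Q + q.L) * √q.d := by
    gcongr; linarith
  linarith

theorem err₁_le {Δ₀ : ℝ} (hΔ : 0 ≤ Δ₀) : 50 * q.err₁ < q.D₁ Δ₀ := by
  have hL := h.L_pos; have ha := h.a_pos; have ht := h.one_le_t'; have := h.Lg_nonneg
  have := h.C_nonneg; have := h.Q_pos; have : 0 < q.μ * q.a - 1 := by linarith [h.two_le]
  have he := two_lt_exp_one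
  have hd := h.one_le_sqrt_d
  have hm : 0 ≤ q.m₁ := by rw [h.m₁_eq]; positivity
  have e3 : Real.exp 1 * q.a ^ 2 * q.m₄ * q.t * (q.L + q.Lg) * √q.d / (q.μ * q.a - 1)
      = Real.exp 1 * (q.a ^ 2 * q.t * (q.L + q.Lg) / (q.μ * q.a - 1)) * q.m₄ * √q.d := by
    ring
  have e4 : 12 * q.a ^ 2 * q.t * (q.L + q.Lg) * q.C / (q.μ * q.a - 1)
      = 12 * (q.a ^ 2 * q.t * (q.L + q.Lg) / (q.μ * q.a - 1)) * q.C := by ring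
  unfold D₁ err₁
  rw [e3, e4, h.m₂_eq, h.m₄_eq]
  set w := q.a ^ 2 * q.t * (q.L + q.Lg) / (q.μ * q.a - 1) with hw
  have hw0 : 0 ≤ w := by positivity
  have h1 : 10 * q.a * (45 * q.C + 1) * q.t * 1 ≤ 10 * q.a * (45 * q.C + 1) * q.t * √q.d := by
    gcongr
  have h2 : 2 * w * (300 * q.C) * 1 ≤ Real.exp 1 * w * (300 * q.C + 1) * √q.d := by
    gcongr; linarith
  have h3 : 0 ≤ 2 * q.a * q.m₁ * q.t * q.L * √q.d * Δ₀ := by positivity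
  have h4 : 0 < 10 * q.a * q.t := by positivity
  nlinarith

theorem a_mul_L_le {K : ℝ} (hK : 2 * q.D₂ ≤ K) : 1000 * (q.a * q.L) ≤ K := by
  have hL := h.L_pos; have ha := h.a_pos; have ht := h.one_le_t'; have := h.Lg_nonneg
  have hQ := h.Q_pos; have : 0 < q.μ * q.a - 1 := by linarith [h.two_le]
  have h1 := h.err₂_le
  have h2 : 9 * q.a * 1 * (2 * q.L + 0) ≤ q.err₂ := by
    have h3 : 9 * q.a * 1 * (2 * q.L + 0) ≤ 9 * q.a * q.t * (2 * q.L + q.Q) := by gcongr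
    have h4 : 0 ≤ 12 * q.a ^ 2 * q.t * (q.L + q.Lg) * q.Q / (q.μ * q.a - 1) := by positivity
    unfold err₂
    linarith
  nlinarith [mul_pos ha hL]

theorem y_le {K : ℝ} (hK : 2 * q.D₂ ≤ K) : 1000 * (q.μ * q.a) ≤ K := by
  have h1 := h.a_mul_L_le hK
  have h2 := mul_le_mul_of_nonneg_right h.μ_le h.a_pos.le
  linarith

theorem νC_nonneg : 0 ≤ q.νC := by
  have hL := h.L_pos; have ha := h.a_pos; have := h.C_nonneg
  have : 0 < 2 * q.μ * q.a - 2 := by linarith [h.two_le]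
  unfold νC
  positivity

theorem ν₂_ge : 5000 ≤ q.ν₂ := by
  have hL := h.L_pos; have ha := h.a_pos; have ht := h.one_le_t'
  have hQ := h.Q_pos; have hy := h.two_le
  have h3 : 0 < 2 * q.μ * q.a - 3 := by linarith [h.two_le]
  have hd : (1 : ℝ) ≤ q.d := by exact_mod_cast h.one_le_d
  have he : 7 ≤ Real.exp 1 ^ 2 := by nlinarith [Real.exp_one_gt_d9]
  have h1 : 2 * (q.μ * q.a) ^ 2 ≤ q.a ^ 2 * q.L * q.Q := by
    have : q.μ * (2 * q.μ) ≤ q.L * q.Q := mul_le_mul h.μ_le h.le_Q (by linarith [h.μ_pos]) hL.le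
    nlinarith [mul_le_mul_of_nonneg_left this (sq_nonneg q.a)]
  have h2 : 6 ≤ q.a ^ 2 * q.L * q.Q / (2 * q.μ * q.a - 3) := by
    rw [le_div_iff₀ h3]
    nlinarith [sq_nonneg (q.μ * q.a - 3)]
  have h4 : (2 : ℝ) ≤ (q.t : ℝ) ^ 2 * q.d + 1 := by nlinarith [one_le_pow₀ ht (n := 2)]
  have e : q.ν₂ = 64 * Real.exp 1 ^ 2 * ((q.t : ℝ) ^ 2 * q.d + 1)
      * (q.a ^ 2 * q.L * q.Q / (2 * q.μ * q.a - 3)) := by unfold ν₂ Q; ring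
  rw [e]
  calc (5000 : ℝ) ≤ 64 * 7 * 2 * 6 := by norm_num
    _ ≤ _ := by gcongr

theorem D₁_pos {Δ₀ : ℝ} (hΔ : 0 ≤ Δ₀) : 0 < q.D₁ Δ₀ := by
  linarith [h.err₁_nonneg, h.err₁_le hΔ]

theorem D₂_nonneg : 0 ≤ q.D₂ := by linarith [h.err₂_nonneg, h.err₂_le]

theorem le_ν₁ {Δ₀ : ℝ} (hΔ : 0 ≤ Δ₀) : q.ν₂ * Δ₀ + q.νC ≤ q.ν₁ Δ₀ := by
  have hL := h.L_pos; have ha := h.a_pos; have := h.C_nonneg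
  have hQ : 0 < 2 * q.A * q.L + q.B := h.Q_pos
  have h3 : 0 < 2 * q.μ * q.a - 3 := by linarith [h.two_le]
  have := h.D₁_pos hΔ
  have := h.D₂_nonneg
  have h1 : 0 ≤ 32 * (q.a * Real.exp 1) ^ 2 * q.L * ((q.t : ℝ) ^ 2 * q.d + 1) *
      ((2 * q.A * q.L + q.B) / (2 * q.μ * q.a - 3)
        * (q.D₁ Δ₀ / q.D₂ + Real.exp 1 * q.a ^ 2 * q.C * q.L / q.D₂)) := by positivity
  unfold ν₁ ν₂ νC
  linarith

theorem ν₁_nonneg {Δ₀ : ℝ} (hΔ : 0 ≤ Δ₀) : 0 ≤ q.ν₁ Δ₀ := by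
  have := mul_nonneg (show 0 ≤ q.ν₂ by linarith [h.ν₂_ge]) hΔ
  linarith [h.le_ν₁ hΔ, h.νC_nonneg]

theorem Γ₁_pos {Δ₀ : ℝ} (hΔ : 0 ≤ Δ₀) : 0 < q.Γ₁ Δ₀ := by
  have hL := h.L_pos; have := h.C_nonneg
  have := h.D₁_pos hΔ
  have := h.D₂_nonneg
  unfold Γ₁
  positivity

/-- Above the threshold, `ν₂` is negligible compared with `n / log n`. -/
theorem ν₂_mul_log_le {K δ n : ℝ} (hδ : 0 < δ) (hδ' : δ < 1) (hK : q.minK₀ δ ≤ K) (hn : K ≤ n) :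
    q.ν₂ * Real.log (2 * n / δ) ≤ n / 228 := by
  have hν := h.ν₂_ge
  have hlog : 9 ≤ Real.log (48 * q.ν₂) := by
    rw [Real.le_log_iff_exp_le (by linarith)]
    have : Real.exp 9 = Real.exp 1 ^ 9 := by rw [← Real.exp_nat_mul]; norm_num
    rw [this]
    calc Real.exp 1 ^ 9 ≤ 3 ^ 9 := by
          gcongr; linarith [Real.exp_one_lt_d9]
      _ ≤ 48 * q.ν₂ := by linarith
  set X := 24 * q.ν₂ * (2 * Real.log (48 * q.ν₂) + 1) with hX
  have hXν : 456 * q.ν₂ ≤ X := by rw [hX]; nlinarith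
  have hX0 : 0 < X := by linarith
  have hKX : X * Real.log (2 * X / δ) ≤ K := by
    refine le_trans (le_of_eq ?_) ((le_max_right _ _).trans ((le_max_right _ _).trans hK))
    rw [hX]; ring_nf
  have hn0 : 0 < n := by
    refine lt_of_lt_of_le ?_ (hKX.trans hn)
    refine mul_pos hX0 (Real.log_pos ?_)
    rw [lt_div_iff₀ hδ]
    linarith
  have h1 : Real.log (2 * n / δ) = Real.log (2 * X / δ) + Real.log (n / X) := by
    rw [← Real.log_mul (by positivity) (by positivity)]
    congr 1
    field_simp
  have h2 : Real.log (n / X) ≤ n / X - 1 := Real.log_le_sub_one_of_pos (by positivity)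
  have h3 : Real.log (2 * X / δ) ≤ n / X := by
    rw [le_div_iff₀ hX0, mul_comm]
    exact hKX.trans hn
  have h4 : Real.log (2 * n / δ) ≤ 2 * n / X := by rw [h1, mul_div_assoc 2 n X]; linarith
  calc q.ν₂ * Real.log (2 * n / δ) ≤ q.ν₂ * (2 * n / X) := by gcongr
    _ ≤ q.ν₂ * (2 * n / (456 * q.ν₂)) := by gcongr
    _ = n / 228 := by field_simp; norm_num

end Params.IsTuned

namespace Params

variable (q : Params)

/-- The amount by which `(k + K₀)` times the high-probability bound exceeds `K₀ Δ₀`. At `k = 0` the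
logarithm is taken as for `k = 1`, so that the bound also holds initially. -/
noncomputable def excess (K δ Kbar logbar Δ₀ : ℝ) (k : ℕ) : ℝ :=
  q.Γ₁ Δ₀ + q.Γ₂ Kbar logbar Δ₀ * (Real.log (2 * K / δ) + Real.log (2 * (max k 1 : ℕ) / δ))

/-- The numerator of the high-probability bound. -/
noncomputable def level (K δ Kbar logbar Δ₀ : ℝ) (k : ℕ) : ℝ :=
  K * Δ₀ + q.excess K δ Kbar logbar Δ₀ k

/-- `(k + K₀)²` times the square of the deviation allowed to the martingale part at time `k`, when
the numerator of the bound is `b`. -/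
noncomputable def deviation (K δ b : ℝ) (k : ℕ) : ℝ :=
  Real.log (2 * k / δ) * (q.ν₂ * b ^ 2 / (k + K) + 2 * q.νC * b)

theorem bound_eq (K δ Kbar logbar Δ₀ : ℝ) {k : ℕ} (hk : 1 ≤ k) :
    q.bound K δ Kbar logbar Δ₀ k = q.level K δ Kbar logbar Δ₀ k / (k + K) := by
  unfold bound level excess
  rw [max_eq_left hk]
  congr 1
  ring

end Params

namespace Params.IsTuned

variable {q : Params} (h : q.IsTuned) {K δ Kbar logbar Δ₀ : ℝ} (hδ : 0 < δ) (hδ' : δ < 1)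
  (hK : q.minK₀ δ ≤ K) (hKbar : K / Real.log (2 / δ) ≤ Kbar)
  (hlogbar : Real.log (2 * K / δ) / Real.log (2 / δ) ≤ logbar) (hΔ : 0 ≤ Δ₀)

include hδ hδ' in
omit h in
theorem log_two_div_pos : 0 < Real.log (2 / δ) :=
  Real.log_pos (by rw [lt_div_iff₀ hδ]; linarith)

omit h in
theorem two_mul_D₂_le (hK : q.minK₀ δ ≤ K) : 2 * q.D₂ ≤ K :=
  (le_max_left _ _).trans ((le_max_right _ _).trans hK)

include h hK in
theorem two_thousand_le : 2000 ≤ K := by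
  linarith [h.y_le (two_mul_D₂_le hK), h.two_le]

include h hδ hδ' hK hlogbar in
theorem one_le_logbar : 1 ≤ logbar := by
  refine le_trans ?_ hlogbar
  have h1 := log_two_div_pos hδ hδ'
  rw [one_le_div h1]
  refine Real.log_le_log (by positivity) ?_
  have := h.two_thousand_le hK
  gcongr
  linarith

include h hδ hδ' hK hKbar in
theorem Kbar_nonneg : 0 ≤ Kbar := by
  refine le_trans (div_nonneg ?_ (log_two_div_pos hδ hδ').le) hKbar
  linarith [h.two_thousand_le hK]

include h hδ hδ' hK hlogbar hΔ in
theorem le_Γ₂ : 16 * q.ν₁ Δ₀ + 2 * √(q.ν₁ Δ₀ * (Kbar * Δ₀ + 2 * q.Γ₁ Δ₀))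
    ≤ q.Γ₂ Kbar logbar Δ₀ := by
  have h1 := h.one_le_logbar hδ hδ' hK hlogbar
  have h2 := h.ν₁_nonneg hΔ
  unfold Γ₂
  nlinarith

include h hδ hδ' hK hlogbar hΔ in
theorem Γ₂_nonneg : 0 ≤ q.Γ₂ Kbar logbar Δ₀ := by
  have := h.le_Γ₂ (Kbar := Kbar) hδ hδ' hK hlogbar hΔ
  have := h.ν₁_nonneg hΔ
  have := Real.sqrt_nonneg (q.ν₁ Δ₀ * (Kbar * Δ₀ + 2 * q.Γ₁ Δ₀))
  linarith

include hδ in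
omit h in
theorem log_two_div_le {k : ℕ} (hk : 1 ≤ k) : Real.log (2 / δ) ≤ Real.log (2 * k / δ) := by
  refine Real.log_le_log (by positivity) ?_
  have : (1 : ℝ) ≤ k := by exact_mod_cast hk
  gcongr
  linarith

include h hδ hδ' hK in
theorem log_K_pos : 0 < Real.log (2 * K / δ) := by
  have := h.two_thousand_le hK
  refine Real.log_pos ?_
  rw [lt_div_iff₀ hδ]
  linarith

include h hδ hδ' hK hlogbar hΔ in
theorem Γ₁_le_excess (k : ℕ) : q.Γ₁ Δ₀ ≤ q.excess K δ Kbar logbar Δ₀ k := by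
  have h1 := h.Γ₂_nonneg (Kbar := Kbar) hδ hδ' hK hlogbar hΔ
  have h2 := h.log_K_pos hδ hδ' hK
  have h3 := log_two_div_pos hδ hδ'
  have h4 := log_two_div_le hδ (le_max_right k 1)
  unfold excess
  nlinarith

include h hδ hδ' hK hlogbar hΔ in
theorem excess_pos (k : ℕ) : 0 < q.excess K δ Kbar logbar Δ₀ k :=
  (h.Γ₁_pos hΔ).trans_le (h.Γ₁_le_excess (Kbar := Kbar) hδ hδ' hK hlogbar hΔ k)

include h hδ hδ' hK hlogbar hΔ in
theorem level_pos (k : ℕ) : 0 < q.level K δ Kbar logbar Δ₀ k := by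
  have := h.excess_pos (Kbar := Kbar) hδ hδ' hK hlogbar hΔ k
  have := mul_nonneg (show 0 ≤ K by linarith [h.two_thousand_le hK]) hΔ
  unfold level
  linarith

include h hδ hδ' hK hlogbar hΔ in
theorem level_mono : Monotone (q.level K δ Kbar logbar Δ₀) := by
  intro i k hik
  have h1 := h.Γ₂_nonneg (Kbar := Kbar) hδ hδ' hK hlogbar hΔ
  unfold level excess
  have hpos : (0 : ℝ) < ((max i 1 : ℕ) : ℝ) := by exact_mod_cast (le_max_right i 1)
  have : Real.log (2 * (max i 1 : ℕ) / δ) ≤ Real.log (2 * (max k 1 : ℕ) / δ) := by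
    refine Real.log_le_log (by positivity) ?_
    gcongr
  gcongr

include h hδ hδ' hK hKbar hlogbar hΔ in
/-- The deviation allowed to the martingale part uses up less than three quarters of the excess of
the bound over the initial error. -/
theorem deviation_le {k : ℕ} (hk : 1 ≤ k) :
    √(q.deviation K δ (q.level K δ Kbar logbar Δ₀ k) k)
      ≤ 18 / 25 * q.excess K δ Kbar logbar Δ₀ k := by
  have hR := h.excess_pos (Kbar := Kbar) hδ hδ' hK hlogbar hΔ k
  have hK0 : 0 < K := by linarith [h.two_thousand_le hK]
  have hk1 : (1 : ℝ) ≤ k := by exact_mod_cast hk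
  have hl2 := log_two_div_pos hδ hδ'
  have hl := log_two_div_le hδ hk
  have hν₁ := h.ν₁_nonneg hΔ
  have hΓ₁ := h.Γ₁_pos hΔ
  have hKb := h.Kbar_nonneg hδ hδ' hK hKbar
  have hlν : q.ν₂ * Real.log (2 * k / δ) ≤ (k + K) / 228 := by
    refine le_trans ?_ (h.ν₂_mul_log_le hδ hδ' hK (show K ≤ k + K by linarith))
    have := h.ν₂_ge
    gcongr
    linarith
  have hRle : (16 * q.ν₁ Δ₀ + 2 * √(q.ν₁ Δ₀ * (Kbar * Δ₀ + 2 * q.Γ₁ Δ₀))) * Real.log (2 * k / δ)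
      ≤ q.excess K δ Kbar logbar Δ₀ k := by
    have h1 := h.le_Γ₂ (Kbar := Kbar) hδ hδ' hK hlogbar hΔ
    have h2 := h.Γ₂_nonneg (Kbar := Kbar) hδ hδ' hK hlogbar hΔ
    have h3 := h.log_K_pos hδ hδ' hK
    unfold excess
    rw [max_eq_left hk]
    have h4 := mul_le_mul_of_nonneg_right h1 (hl2.le.trans hl)
    nlinarith
  have hKl : K ≤ Kbar * Real.log (2 * k / δ) := by
    rw [div_le_iff₀ hl2] at hKbar
    exact hKbar.trans (by gcongr)
  have hsq : Real.sqrt (q.ν₁ Δ₀ * (Kbar * Δ₀ + 2 * q.Γ₁ Δ₀)) ^ 2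
      = q.ν₁ Δ₀ * (Kbar * Δ₀ + 2 * q.Γ₁ Δ₀) := Real.sq_sqrt (by positivity)
  have hν := h.le_ν₁ hΔ
  have hν₂ := h.ν₂_ge
  have hνC := h.νC_nonneg
  unfold deviation level
  generalize q.excess K δ Kbar logbar Δ₀ k = R at *
  have hg := Real.sqrt_nonneg (q.ν₁ Δ₀ * (Kbar * Δ₀ + 2 * q.Γ₁ Δ₀))
  generalize √(q.ν₁ Δ₀ * (Kbar * Δ₀ + 2 * q.Γ₁ Δ₀)) = g at *
  have hl0 := hl2.trans_le hl
  generalize Real.log (2 * k / δ) = ℓ at *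
  generalize q.ν₁ Δ₀ = ν₁ at *
  generalize q.ν₂ = ν₂ at *
  generalize q.νC = νC at *
  generalize q.Γ₁ Δ₀ = Γ₁ at *
  set n : ℝ := k + K with hn
  have hn0 : 0 < n := by positivity
  refine Real.sqrt_le_iff.2 ⟨by positivity, ?_⟩
  -- the part quadratic in the level
  have hA : ℓ * (ν₂ * (K * Δ₀ + R) ^ 2 / n) ≤ 2 * (ν₂ * ℓ * K * Δ₀ ^ 2) + R ^ 2 / 114 := by
    have h1 : (K * Δ₀ + R) ^ 2 ≤ 2 * (K * Δ₀) ^ 2 + 2 * R ^ 2 := by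
      nlinarith [sq_nonneg (K * Δ₀ - R)]
    have h2 : ν₂ * ℓ / n ≤ 1 / 228 := by
      rw [div_le_iff₀ hn0]; linarith
    have h3 : K / n ≤ 1 := by rw [div_le_one hn0]; linarith
    calc ℓ * (ν₂ * (K * Δ₀ + R) ^ 2 / n) ≤ ℓ * (ν₂ * (2 * (K * Δ₀) ^ 2 + 2 * R ^ 2) / n) := by
          gcongr
      _ = 2 * (ν₂ * ℓ * K * Δ₀ ^ 2) * (K / n) + 2 * R ^ 2 * (ν₂ * ℓ / n) := by ring
      _ ≤ 2 * (ν₂ * ℓ * K * Δ₀ ^ 2) * 1 + 2 * R ^ 2 * (1 / 228) := by gcongr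
      _ = _ := by ring
  -- the terms with `K Δ₀` are absorbed by the square root in `Γ₂`
  have hB : 2 * ν₁ * ℓ * (K * Δ₀) ≤ 2 * (g * ℓ) ^ 2 := by
    have h1 : ν₁ * (K * Δ₀) ≤ ν₁ * (Kbar * ℓ * Δ₀) := by gcongr
    have h2 : ν₁ * (Kbar * Δ₀) ≤ g ^ 2 := by rw [hsq]; nlinarith
    calc 2 * ν₁ * ℓ * (K * Δ₀) = 2 * ℓ * (ν₁ * (K * Δ₀)) := by ring
      _ ≤ 2 * ℓ * (ν₁ * (Kbar * ℓ * Δ₀)) := by gcongr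
      _ = 2 * ℓ ^ 2 * (ν₁ * (Kbar * Δ₀)) := by ring
      _ ≤ 2 * ℓ ^ 2 * g ^ 2 := by gcongr
      _ = _ := by ring
  have hC : 2 * (g * ℓ) ^ 2 + 2 * ν₁ * ℓ * R ≤ R ^ 2 / 2 := by
    have h1 : 0 ≤ g * ℓ := by positivity
    have h2 : 2 * (g * ℓ) ≤ R - 16 * ν₁ * ℓ := by linarith
    have h3 : 0 ≤ ν₁ * ℓ := by positivity
    nlinarith [mul_le_mul_of_nonneg_right h2 h1]
  have hD : 2 * (ν₂ * ℓ * K * Δ₀ ^ 2) + 2 * νC * ℓ * (K * Δ₀) ≤ 2 * ν₁ * ℓ * (K * Δ₀) := by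
    have := mul_le_mul_of_nonneg_left hν (show 0 ≤ 2 * ℓ * (K * Δ₀) by positivity)
    linarith
  have hE : 2 * νC * ℓ * R ≤ 2 * ν₁ * ℓ * R := by
    have : νC ≤ ν₁ := by nlinarith
    gcongr
  nlinarith

include h hδ hδ' hK hKbar hlogbar hΔ in
/-- The induction closes: the initial error, the Markovian bias, the discretization error and the
martingale deviation together stay below the level. -/
theorem total_le_level {k : ℕ} (hk : 1 ≤ k) {b : ℝ} (hb : b = q.level K δ Kbar logbar Δ₀ k) :
    K * Δ₀ + q.err₁ + q.err₂ * (b / K) + q.L * q.C * q.a ^ 2 / 2 + √(q.deviation K δ b k)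
      ≤ b := by
  have h1 := h.deviation_le hδ hδ' hK hKbar hlogbar hΔ hk
  have h2 := h.Γ₁_le_excess (Kbar := Kbar) hδ hδ' hK hlogbar hΔ k
  rw [← hb] at h1
  have hL := h.L_pos
  have hC := h.C_nonneg
  have h3 : 2 * (q.L * q.C * q.a ^ 2) ≤ Real.exp 1 * q.a ^ 2 * q.C * q.L := by
    have := mul_le_mul_of_nonneg_right two_lt_exp_one.le
      (show 0 ≤ q.a ^ 2 * q.C * q.L by positivity)
    linarith
  have h4 := h.err₁_le hΔ
  have h5 := h.err₂_le
  have h6 := two_mul_D₂_le hK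
  have hK0 : 0 < K := by linarith [h.two_thousand_le hK]
  have hR := h.excess_pos (Kbar := Kbar) hδ hδ' hK hlogbar hΔ k
  have e0 := h.err₁_nonneg
  have e1 := h.err₂_nonneg
  have h7 : b / K = Δ₀ + q.excess K δ Kbar logbar Δ₀ k / K := by
    rw [hb, level]; field_simp
  have h8 : q.err₂ * (q.excess K δ Kbar logbar Δ₀ k / K)
      ≤ q.excess K δ Kbar logbar Δ₀ k / 100 := by
    rw [mul_div_assoc', div_le_iff₀ hK0]
    nlinarith
  have h9 : q.err₂ * Δ₀ ≤ q.D₂ * Δ₀ / 50 := by nlinarith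
  have h10 : 0 ≤ q.D₂ * Δ₀ := mul_nonneg (by linarith) hΔ
  rw [h7, mul_add]
  unfold Γ₁ at h2
  have : b = K * Δ₀ + q.excess K δ Kbar logbar Δ₀ k := hb
  linarith

end Params.IsTuned

/-! ### One step of the iteration, and the pathwise induction -/

/-- The standing assumptions on objective, chain and gradient samples, for the parameters `q`. -/
structure IsSetting {S : Type v} [MeasurableSpace S] (q : Params) (f : E q.d → ℝ)
    (p : Kernel S S) [IsMarkovKernel p] (π : Measure S) [IsProbabilityMeasure π]
    (g : E q.d → S → E q.d) : Prop where
  tuned : q.IsTuned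
  A_nonneg : 0 ≤ q.A
  B_nonneg : 0 ≤ q.B
  smooth : IsSmooth f q.L
  pl : IsPL f q.μ
  ergodic : IsGeometricallyErgodic p π q.t
  sample : IsGradientSample f π g q.Lg q.A q.B q.C

namespace IsSetting

variable {S : Type v} [MeasurableSpace S] {q : Params} {f : E q.d → ℝ}
  {p : Kernel S S} [IsMarkovKernel p] {π : Measure S} [IsProbabilityMeasure π]
  {g : E q.d → S → E q.d} (h : IsSetting q f p π g)

/-- The growth bound for the norm of the (sampled or noisy) gradient at `x`. -/
noncomputable def growth (q : Params) (f : E q.d → ℝ) (x : E q.d) : ℝ :=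
  √(abcBound f q.A q.B q.C x)

/-- `V (x, z) = ⟪∇f x, h (x, z)⟫`, with `h (x, ·)` the solution of the Poisson equation for
`g (x, ·)`. -/
noncomputable def corrector (q : Params) (f : E q.d → ℝ) (p : Kernel S S) (π : Measure S)
    (g : E q.d → S → E q.d) (x : E q.d) (z : S) : ℝ :=
  inner ℝ (gradient f x) (poissonSol p π q.t (g x) z)

/-- The martingale difference `M + h (x, z') - (p h)(x, z)` that collects the noise of one step from
state `z` to state `z'`. -/
noncomputable def innovation (q : Params) (p : Kernel S S) (π : Measure S)
    (g : E q.d → S → E q.d) (x : E q.d) (z z' : S) (M : E q.d) : E q.d :=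
  M + (poissonSol p π q.t (g x) z' - ∫ w, poissonSol p π q.t (g x) w ∂p z)

include h

theorem subopt_nonneg (x : E q.d) : 0 ≤ subopt f x := h.pl.subopt_nonneg x

theorem norm_gradient_sq_le (x : E q.d) : ‖gradient f x‖ ^ 2 ≤ 2 * q.L * subopt f x :=
  MarkovSGD.norm_gradient_sq_le h.tuned.L_pos h.smooth h.pl x

theorem growth_sq (x : E q.d) : growth q f x ^ 2 = abcBound f q.A q.B q.C x :=
  Real.sq_sqrt (abcBound_nonneg h.A_nonneg h.B_nonneg h.tuned.C_nonneg h.pl x)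

theorem growth_sq_le (x : E q.d) : growth q f x ^ 2 ≤ q.Q * subopt f x + q.C := by
  rw [h.growth_sq]
  exact abcBound_le h.tuned.L_pos h.A_nonneg h.smooth h.pl x

theorem norm_poissonSol_le (x : E q.d) (z : S) :
    ‖poissonSol p π q.t (g x) z‖ ≤ 3 * q.t * growth q f x :=
  MarkovSGD.norm_poissonSol_le h.ergodic (h.sample.measurable x) (h.sample.norm_le x) z

theorem norm_poissonSol_sub_le (x y : E q.d) (z : S) :
    ‖poissonSol p π q.t (g x) z - poissonSol p π q.t (g y) z‖
      ≤ 3 * q.t * (q.Lg * ‖x - y‖) := by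
  rw [← poissonSol_sub h.ergodic (h.sample.measurable x) (h.sample.measurable y)
    (h.sample.norm_le x) (h.sample.norm_le y)]
  exact MarkovSGD.norm_poissonSol_le h.ergodic
    ((h.sample.measurable x).sub (h.sample.measurable y)) (h.sample.lipschitz x y) z

theorem abs_corrector_le (x : E q.d) (z : S) :
    |corrector q f p π g x z| ≤ 3 / 2 * q.t * ((2 * q.L + q.Q) * subopt f x + q.C) := by
  have h1 := abs_real_inner_le_norm (gradient f x) (poissonSol p π q.t (g x) z)
  have h2 := mul_le_mul_of_nonneg_left (h.norm_poissonSol_le x z) (norm_nonneg (gradient f x))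
  have h3 := h.growth_sq_le x
  have h4 := h.norm_gradient_sq_le x
  have h5 : ‖gradient f x‖ * growth q f x ≤ ((2 * q.L + q.Q) * subopt f x + q.C) / 2 := by
    nlinarith [sq_nonneg (‖gradient f x‖ - growth q f x)]
  have h6 := mul_le_mul_of_nonneg_left h5 (show 0 ≤ 3 * (q.t : ℝ) by positivity)
  unfold corrector
  linarith

theorem abs_corrector_sub_le {α : ℝ} (hα : 0 ≤ α) (hαL : α * q.L ≤ 1) {x x' : E q.d}
    (hx : ‖x' - x‖ ≤ α * growth q f x) (z : S) :
    |corrector q f p π g x' z - corrector q f p π g x z|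
      ≤ 6 * q.t * α * (q.L + q.Lg) * (q.Q * subopt f x + q.C) := by
  have hG : 0 ≤ growth q f x := Real.sqrt_nonneg _
  have hL := h.tuned.L_pos
  have hLg := h.tuned.Lg_nonneg
  have e : corrector q f p π g x' z - corrector q f p π g x z
      = inner ℝ (gradient f x' - gradient f x) (poissonSol p π q.t (g x) z)
        + inner ℝ (gradient f x')
          (poissonSol p π q.t (g x') z - poissonSol p π q.t (g x) z) := by
    unfold corrector
    rw [inner_sub_left, inner_sub_right]
    ring
  have h1 : ‖gradient f x' - gradient f x‖ ≤ q.L * (α * growth q f x) :=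
    (h.smooth.lipschitz x' x).trans (by gcongr)
  have h2 : ‖gradient f x'‖ ≤ 2 * growth q f x := by
    have h3 := norm_sub_norm_le (gradient f x') (gradient f x)
    have h4 : ‖gradient f x‖ ≤ growth q f x := h.sample.norm_gradient_le x
    have h5 := mul_le_mul_of_nonneg_right hαL hG
    linarith
  have h3 : ‖poissonSol p π q.t (g x') z - poissonSol p π q.t (g x) z‖
      ≤ 3 * q.t * (q.Lg * (α * growth q f x)) :=
    (h.norm_poissonSol_sub_le x' x z).trans (by gcongr)
  have h4 := h.growth_sq_le x
  rw [e]
  calc _ ≤ _ := abs_add_le _ _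
    _ ≤ ‖gradient f x' - gradient f x‖ * ‖poissonSol p π q.t (g x) z‖
        + ‖gradient f x'‖ * ‖poissonSol p π q.t (g x') z - poissonSol p π q.t (g x) z‖ :=
      add_le_add (abs_real_inner_le_norm _ _) (abs_real_inner_le_norm _ _)
    _ ≤ q.L * (α * growth q f x) * (3 * q.t * growth q f x)
        + 2 * growth q f x * (3 * q.t * (q.Lg * (α * growth q f x))) := by
      gcongr
      exact h.norm_poissonSol_le x z
    _ = (3 * q.L + 6 * q.Lg) * q.t * α * growth q f x ^ 2 := by ring
    _ ≤ (6 * q.L + 6 * q.Lg) * q.t * α * (q.Q * subopt f x + q.C) := by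
      have : 0 ≤ growth q f x ^ 2 := sq_nonneg _
      gcongr
      norm_num
    _ = _ := by ring

/-- Progress of one step, in terms of the corrector and the innovation. -/
theorem subopt_step_le {α : ℝ} (hα : 0 ≤ α) (hα' : α * q.L / 2 * (2 * q.A + q.B / q.μ) ≤ 1)
    (x M : E q.d) (z z' : S) (hG : ‖g x z + M‖ ^ 2 ≤ abcBound f q.A q.B q.C x) :
    subopt f (x - α • (g x z + M))
      ≤ (1 - q.μ * α) * subopt f x + q.L * q.C * α ^ 2 / 2
        - α * (corrector q f p π g x z - corrector q f p π g x z')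
        - α * inner ℝ (gradient f x) (innovation q p π g x z z' M) := by
  have hμ := h.tuned.μ_pos
  have hL := h.tuned.L_pos
  have h1 := h.smooth.le_add_inner x (-(α • (g x z + M)))
  rw [← sub_eq_add_neg, norm_neg, norm_smul, mul_pow, Real.norm_of_nonneg hα, inner_neg_right,
    inner_smul_right] at h1
  have h2 : inner ℝ (gradient f x) (g x z + M) = ‖gradient f x‖ ^ 2
      + (corrector q f p π g x z - corrector q f p π g x z')
      + inner ℝ (gradient f x) (innovation q p π g x z z' M) := by
    have h3 := poissonSol_sub_integral h.ergodic (h.sample.measurable x) (h.sample.norm_le x) z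
    rw [← h.sample.mean x] at h3
    have h4 : g x z + M = gradient f x
        + (poissonSol p π q.t (g x) z - poissonSol p π q.t (g x) z')
        + innovation q p π g x z z' M := by
      rw [sub_eq_sub_iff_add_eq_add, ← sub_eq_iff_eq_add] at h3
      unfold innovation
      rw [← h3]
      abel
    rw [h4, inner_add_right, inner_add_right, real_inner_self_eq_norm_sq, inner_sub_right]
    rfl
  have h5 : q.L / 2 * (α ^ 2 * ‖g x z + M‖ ^ 2)
      ≤ α / 2 * ‖gradient f x‖ ^ 2 + q.L * q.C * α ^ 2 / 2 := by
    have h6 : q.B * subopt f x ≤ q.B / (2 * q.μ) * ‖gradient f x‖ ^ 2 := by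
      have := mul_le_mul_of_nonneg_left (h.pl.le_norm_sq x)
        (div_nonneg h.B_nonneg (show 0 ≤ 2 * q.μ by linarith))
      refine le_trans (le_of_eq ?_) this
      field_simp
    have h7 : ‖g x z + M‖ ^ 2 ≤ (2 * q.A + q.B / q.μ) / 2 * ‖gradient f x‖ ^ 2 + q.C := by
      refine hG.trans ?_
      have e : (2 * q.A + q.B / q.μ) / 2 * ‖gradient f x‖ ^ 2
          = q.A * ‖gradient f x‖ ^ 2 + q.B / (2 * q.μ) * ‖gradient f x‖ ^ 2 := by
        field_simp
      unfold abcBound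
      linarith
    have h8 := mul_le_mul_of_nonneg_right hα' (show 0 ≤ α / 2 * ‖gradient f x‖ ^ 2 by positivity)
    calc q.L / 2 * (α ^ 2 * ‖g x z + M‖ ^ 2)
        ≤ q.L / 2 * (α ^ 2 * ((2 * q.A + q.B / q.μ) / 2 * ‖gradient f x‖ ^ 2 + q.C)) := by
          gcongr
      _ = α * q.L / 2 * (2 * q.A + q.B / q.μ) * (α / 2 * ‖gradient f x‖ ^ 2)
          + q.L * q.C * α ^ 2 / 2 := by ring
      _ ≤ _ := by linarith
  have h9 := mul_le_mul_of_nonneg_left (h.pl.le_norm_sq x) (show 0 ≤ α / 2 by positivity)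
  rw [h2] at h1
  unfold subopt at *
  linarith

theorem norm_innovation_le (x M : E q.d) (z z' : S)
    (hG : ‖g x z + M‖ ^ 2 ≤ abcBound f q.A q.B q.C x) :
    ‖innovation q p π g x z z' M‖ ≤ (2 + 6 * q.t) * growth q f x := by
  have h3 := poissonSol_sub_integral h.ergodic (h.sample.measurable x) (h.sample.norm_le x) z
  rw [← h.sample.mean x] at h3
  have h4 : innovation q p π g x z z' M = g x z + M - gradient f x
      + (poissonSol p π q.t (g x) z' - poissonSol p π q.t (g x) z) := by
    rw [sub_eq_sub_iff_add_eq_add, ← sub_eq_iff_eq_add] at h3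
    unfold innovation
    rw [← h3]
    abel
  have h5 : ‖g x z + M‖ ≤ growth q f x := Real.le_sqrt_of_sq_le hG
  have h6 : ‖gradient f x‖ ≤ growth q f x := h.sample.norm_gradient_le x
  have h7 := norm_sub_le (g x z + M) (gradient f x)
  have h8 := norm_sub_le (poissonSol p π q.t (g x) z') (poissonSol p π q.t (g x) z)
  have h9 := h.norm_poissonSol_le x z
  have h10 := h.norm_poissonSol_le x z'
  rw [h4]
  refine (norm_add_le _ _).trans ?_
  linarith

/-- A bound for `(2 + 6 t)² ‖∇f(x)‖² ‖g‖²` in terms of the suboptimality `Δ` at `x`. -/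
theorem norm_gradient_mul_growth_sq_le (x : E q.d) :
    (‖gradient f x‖ * ((2 + 6 * q.t) * growth q f x)) ^ 2
      ≤ 80 * q.L * ((q.t : ℝ) ^ 2 * q.d + 1) * (subopt f x * (q.Q * subopt f x + q.C)) := by
  have hd : (1 : ℝ) ≤ q.d := by exact_mod_cast h.tuned.one_le_d
  have h1 : (2 + 6 * (q.t : ℝ)) ^ 2 ≤ 40 * ((q.t : ℝ) ^ 2 * q.d + 1) := by
    nlinarith [sq_nonneg ((q.t : ℝ) - 3), sq_nonneg (q.t : ℝ)]
  have hL := h.tuned.L_pos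
  have hΔ := h.subopt_nonneg x
  rw [mul_pow, mul_pow]
  calc ‖gradient f x‖ ^ 2 * ((2 + 6 * (q.t : ℝ)) ^ 2 * growth q f x ^ 2)
      ≤ (2 * q.L * subopt f x) * (40 * ((q.t : ℝ) ^ 2 * q.d + 1)
        * (q.Q * subopt f x + q.C)) := by
        gcongr
        · exact h.norm_gradient_sq_le x
        · exact h.growth_sq_le x
    _ = _ := by ring

end IsSetting

namespace IsSetting

variable {S : Type v} [MeasurableSpace S] {q : Params} {f : E q.d → ℝ}
  {p : Kernel S S} [IsMarkovKernel p] {π : Measure S} [IsProbabilityMeasure π]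
  {g : E q.d → S → E q.d} (h : IsSetting q f p π g)

/-- One step of summation by parts for the corrector terms, with `V₀`, `V₁` the correctors at two
successive iterates and the same state, at the times `m` and `m + 1`. -/
theorem bias_le {a t w v L' y m V₀ V₁ : ℝ} (ha : 0 ≤ a) (ht : 0 ≤ t) (hw : 0 ≤ w) (hv : 0 ≤ v)
    (hL : 0 ≤ L') (hy : 1 ≤ y) (hm : 3 ≤ m) (hym : y ≤ m)
    (hd : |V₁ - V₀| ≤ 6 * t * (a / m) * L' * w) (hV : |V₁| ≤ 3 / 2 * t * v) :
    (1 - y / (m + 1)) * (a / m) * V₀ - a / (m + 1) * V₁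
      ≤ (12 * a ^ 2 * t * L' * w + 3 * a * (y - 1) * t * v) / (m + 1) ^ 2 := by
  have hm0 : 0 < m := by linarith
  have hy1 : 0 ≤ y - 1 := by linarith
  have hm2 : 1 / m ^ 2 ≤ 2 / (m + 1) ^ 2 := by
    rw [div_le_div_iff₀ (by positivity) (by positivity)]
    nlinarith
  have hm3 : 1 / (m * (m + 1)) ≤ 2 / (m + 1) ^ 2 := by
    rw [div_le_div_iff₀ (by positivity) (by positivity)]
    nlinarith
  have hym0 : 0 ≤ 1 - y / (m + 1) := by
    rw [sub_nonneg, div_le_one (by linarith)]; linarith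
  have hym1 : 1 - y / (m + 1) ≤ 1 := by
    have : 0 ≤ y / (m + 1) := by positivity
    linarith
  have t1 : (1 - y / (m + 1)) * (a / m) * (V₀ - V₁) ≤ 12 * a ^ 2 * t * L' * w / (m + 1) ^ 2 := by
    have hd' : V₀ - V₁ ≤ 6 * t * (a / m) * L' * w := by linarith [(abs_le.1 hd).1]
    calc (1 - y / (m + 1)) * (a / m) * (V₀ - V₁)
        ≤ (1 - y / (m + 1)) * (a / m) * (6 * t * (a / m) * L' * w) := by gcongr
      _ ≤ 1 * (a / m) * (6 * t * (a / m) * L' * w) := by gcongr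
      _ = 6 * a ^ 2 * t * L' * w * (1 / m ^ 2) := by field_simp
      _ ≤ 6 * a ^ 2 * t * L' * w * (2 / (m + 1) ^ 2) := by gcongr
      _ = _ := by ring
  have t2 : a * (y - 1) * (-V₁) * (1 / (m * (m + 1))) ≤ 3 * a * (y - 1) * t * v / (m + 1) ^ 2 := by
    calc a * (y - 1) * (-V₁) * (1 / (m * (m + 1)))
        ≤ a * (y - 1) * (3 / 2 * t * v) * (1 / (m * (m + 1))) := by
          gcongr; linarith [(abs_le.1 hV).1]
      _ ≤ a * (y - 1) * (3 / 2 * t * v) * (2 / (m + 1) ^ 2) := by gcongr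
      _ = _ := by ring
  have e : (1 - y / (m + 1)) * (a / m) * V₀ - a / (m + 1) * V₁
      = (1 - y / (m + 1)) * (a / m) * (V₀ - V₁)
        + a * (y - 1) * (-V₁) * (1 / (m * (m + 1))) := by
    field_simp
    ring
  rw [e, add_div]
  exact add_le_add t1 t2

set_option maxHeartbeats 1000000 in
include h in
/-- The deterministic induction step: along a path on which the bound (with numerator `b`) held
before time `k`, and on which the damped sum of innovations is not too large, the bound holds at
time `k`. The quantity that is tracked is `f(x_{i+1}) - f⋆ - α_i V(x_i, z_{i+1})`: the differences
of the corrector along the path telescope into it up to terms of order `1 / (i + K)²`. -/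
theorem subopt_le_of_forall_lt {δ K Kbar logbar : ℝ} (hδ : 0 < δ) (hδ' : δ < 1)
    (hK : q.minK₀ δ ≤ K) (hKbar : K / Real.log (2 / δ) ≤ Kbar)
    (hlogbar : Real.log (2 * K / δ) / Real.log (2 / δ) ≤ logbar)
    {x M : ℕ → E q.d} {z : ℕ → S}
    (hstep : ∀ i : ℕ, x (i + 1) = x i - (q.a / (i + K)) • (g (x i) (z i) + M (i + 1)))
    (hG : ∀ i, ‖g (x i) (z i) + M (i + 1)‖ ^ 2 ≤ abcBound f q.A q.B q.C (x i))
    {k : ℕ} (hk : 1 ≤ k) {b : ℝ} (hb : b = q.level K δ Kbar logbar (subopt f (x 0)) k)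
    (hprev : ∀ i < k, subopt f (x i) ≤ b / (i + K))
    (hdev : ∑ i ∈ Finset.range k, damping (q.μ * q.a) K i k * (-(q.a / (i + K)) *
        inner ℝ (gradient f (x i)) (innovation q p π g (x i) (z i) (z (i + 1)) (M (i + 1))))
      ≤ √(q.deviation K δ b k) / (k + K)) :
    subopt f (x k) ≤ b / (k + K) := by
  have T := h.tuned
  have hμ := T.μ_pos
  have hL := T.L_pos
  have hLg := T.Lg_nonneg
  have ha := T.a_pos
  have hC := T.C_nonneg
  have hQ := T.Q_pos
  have hy := T.two_le
  have ht0 : (0 : ℝ) ≤ q.t := q.t.cast_nonneg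
  have hΔ0 := h.subopt_nonneg (x 0)
  have hD := Params.IsTuned.two_mul_D₂_le hK
  have hyK := T.y_le hD
  have haL := T.a_mul_L_le hD
  have hK0 : 2000 ≤ K := T.two_thousand_le hK
  have hb0 : 0 < b := hb ▸ T.level_pos (Kbar := Kbar) hδ hδ' hK hlogbar hΔ0 k
  set y := q.μ * q.a with hyd
  have hy1 : 0 < y - 1 := by linarith
  -- uniform bounds along the path before time `k`
  set β := b / K with hβ
  have hβ0 : 0 ≤ β := by positivity
  have hn : ∀ i : ℕ, K ≤ (i : ℝ) + K := fun i => by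
    have : (0 : ℝ) ≤ i := i.cast_nonneg
    linarith
  have hΔ : ∀ i < k, subopt f (x i) ≤ β := fun i hi =>
    (hprev i hi).trans (div_le_div_of_nonneg_left hb0.le (by linarith) (hn i))
  set v := (2 * q.L + q.Q) * β + q.C with hv
  set w := q.Q * β + q.C with hw
  have hv0 : 0 ≤ v := by positivity
  have hw0 : 0 ≤ w := by positivity
  have hV : ∀ i < k, ∀ s, |corrector q f p π g (x i) s| ≤ 3 / 2 * q.t * v := fun i hi s => by
    refine (h.abs_corrector_le (x i) s).trans ?_
    have := hΔ i hi
    rw [hv]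
    gcongr
  have hα : ∀ i : ℕ, 0 ≤ q.a / ((i : ℝ) + K) := fun i => by
    have := hn i
    have : 0 < (i : ℝ) + K := by linarith
    positivity
  have hαL : ∀ i : ℕ, q.a / ((i : ℝ) + K) * q.L ≤ 1 := fun i => by
    have := hn i
    rw [div_mul_eq_mul_div, div_le_one (by linarith)]
    nlinarith [mul_pos ha hL]
  have hthr : ∀ i : ℕ, q.a / ((i : ℝ) + K) * q.L / 2 * (2 * q.A + q.B / q.μ) ≤ 1 := fun i => by
    have h1 : q.a * q.L / 2 * (2 * q.A + q.B / q.μ) ≤ K :=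
      (le_max_left _ _).trans ((le_max_left _ _).trans hK)
    have h2 := hn i
    have e : q.a / ((i : ℝ) + K) * q.L / 2 * (2 * q.A + q.B / q.μ)
        = q.a * q.L / 2 * (2 * q.A + q.B / q.μ) / ((i : ℝ) + K) := by ring
    rw [e, div_le_one (by linarith)]
    linarith
  have hmove : ∀ i, ‖x (i + 1) - x i‖ ≤ q.a / ((i : ℝ) + K) * growth q f (x i) := fun i => by
    rw [hstep i, sub_sub_cancel_left, norm_neg, norm_smul, Real.norm_of_nonneg (hα i)]
    exact mul_le_mul_of_nonneg_left (Real.le_sqrt_of_sq_le (hG i)) (hα i)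
  have hVd : ∀ i < k, ∀ s, |corrector q f p π g (x (i + 1)) s - corrector q f p π g (x i) s|
      ≤ 6 * q.t * (q.a / ((i : ℝ) + K)) * (q.L + q.Lg) * w := fun i hi s => by
    refine (h.abs_corrector_sub_le (hα i) (hαL i) (hmove i) s).trans ?_
    have := hΔ i hi
    have := hα i
    rw [hw]
    gcongr
  set ρ := 12 * q.a ^ 2 * q.t * (q.L + q.Lg) * w + 3 * q.a * (y - 1) * q.t * v
    + q.L * q.C * q.a ^ 2 / 2 with hρ
  have hρ0 : 0 ≤ ρ := by positivity
  set c : ℕ → ℝ := fun i => -(q.a / (i + K)) *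
    inner ℝ (gradient f (x i)) (innovation q p π g (x i) (z i) (z (i + 1)) (M (i + 1))) with hc
  let φ : ℕ → ℝ := fun i => match i with
    | 0 => subopt f (x 0) + 2 * (q.a / K) * |corrector q f p π g (x 0) (z 0)|
    | i + 1 => subopt f (x (i + 1)) - q.a / (i + K) * corrector q f p π g (x i) (z (i + 1))
  have hφ0 : 0 ≤ φ 0 := by
    have : 0 ≤ 2 * (q.a / K) * |corrector q f p π g (x 0) (z 0)| := by positivity
    simp only [φ]
    linarith
  have hdrift : ∀ i : ℕ, subopt f (x (i + 1)) ≤ (1 - y / (i + K)) * subopt f (x i)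
      + q.L * q.C * q.a ^ 2 / 2 / (i + K) ^ 2
      - q.a / (i + K) * (corrector q f p π g (x i) (z i) - corrector q f p π g (x i) (z (i + 1)))
      + c i := fun i => by
    have h1 := h.subopt_step_le (hα i) (hthr i) (x i) (M (i + 1)) (z i) (z (i + 1)) (hG i)
    rw [← hstep i] at h1
    refine h1.trans (le_of_eq ?_)
    simp only [hc, hyd]
    rw [div_pow]
    ring
  have hrec : ∀ i < k, φ (i + 1) ≤ (1 - y / (i + K)) * φ i + ρ / (i + K) ^ 2 + c i := by
    intro i hi
    have h1 := hdrift i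
    rcases i with _ | j
    · simp only [φ, Nat.cast_zero, zero_add] at h1 ⊢
      have h2 : 1 / 2 ≤ 1 - y / K := by
        have : y / K ≤ 1 / 2 := by rw [div_le_iff₀ (by linarith)]; linarith
        linarith
      have h3 : q.a / K * -corrector q f p π g (x 0) (z 0)
          ≤ q.a / K * |corrector q f p π g (x 0) (z 0)| := by
        gcongr
        exact neg_le_abs _
      have h4 : 1 / 2 * (2 * (q.a / K) * |corrector q f p π g (x 0) (z 0)|)
          ≤ (1 - y / K) * (2 * (q.a / K) * |corrector q f p π g (x 0) (z 0)|) := by gcongr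
      have h5 : q.L * q.C * q.a ^ 2 / 2 / K ^ 2 ≤ ρ / K ^ 2 := by
        gcongr
        have : 0 ≤ 12 * q.a ^ 2 * q.t * (q.L + q.Lg) * w := by positivity
        have : 0 ≤ 3 * q.a * (y - 1) * q.t * v := by positivity
        linarith
      linarith
    · simp only [φ]
      have hj := hn j
      have hjk : j < k := by omega
      have e : (((j + 1 : ℕ) : ℝ)) + K = (j + K) + 1 := by push_cast; ring
      rw [e] at h1 ⊢
      set m : ℝ := j + K with hm
      have hbias := bias_le ha.le ht0 hw0 hv0 (by linarith only [hLg, hL] : 0 ≤ q.L + q.Lg)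
        (by linarith only [hy] : 1 ≤ y) (by linarith only [hj, hK0] : 3 ≤ m)
        (by linarith only [hj, hyK, hy] : y ≤ m) (hVd j hjk (z (j + 1)))
        (hV (j + 1) hi (z (j + 1)))
      have e2 : ρ / (m + 1) ^ 2 = (12 * q.a ^ 2 * q.t * (q.L + q.Lg) * w
          + 3 * q.a * (y - 1) * q.t * v) / (m + 1) ^ 2
          + q.L * q.C * q.a ^ 2 / 2 / (m + 1) ^ 2 := by
        rw [hρ]; ring
      rw [e2]
      linarith only [h1, hbias]
  have hmain := le_of_damped_recursion hy (show y ≤ K by linarith) hρ0 hφ0 hrec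
  obtain ⟨j, rfl⟩ : ∃ j, k = j + 1 := ⟨k - 1, by omega⟩
  have htotal := T.total_le_level hδ hδ' hK hKbar hlogbar hΔ0 hk hb
  have e : (((j + 1 : ℕ) : ℝ)) + K = (j + K) + 1 := by push_cast; ring
  rw [e] at hmain hdev ⊢
  have hj := hn j
  set m : ℝ := j + K with hm
  have hm0 : 0 < m := by linarith
  have hVj := (abs_le.1 (hV j (by omega) (z (j + 1)))).2
  have hlast : q.a / m * corrector q f p π g (x j) (z (j + 1)) ≤ 3 * q.a * q.t * v / (m + 1) := by
    have h0 : 1 / m ≤ 2 / (m + 1) := by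
      rw [div_le_div_iff₀ (by positivity) (by positivity)]; linarith
    have h1 : 0 ≤ 3 / 2 * q.t * v := by positivity
    calc q.a / m * corrector q f p π g (x j) (z (j + 1)) ≤ q.a / m * (3 / 2 * q.t * v) := by
          gcongr
      _ = q.a * (3 / 2 * q.t * v) * (1 / m) := by ring
      _ ≤ q.a * (3 / 2 * q.t * v) * (2 / (m + 1)) := by gcongr
      _ = _ := by ring
  have hinit : K * φ 0 ≤ K * subopt f (x 0) + 3 * q.a * q.t * v := by
    have h1 := hV 0 (by omega) (z 0)
    have e1 : K * φ 0 = K * subopt f (x 0) + 2 * q.a * |corrector q f p π g (x 0) (z 0)| := by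
      simp only [φ]; field_simp
    rw [e1]
    have := mul_le_mul_of_nonneg_left h1 (show 0 ≤ 2 * q.a by linarith)
    linarith
  have hρy : ρ / (y - 1) ≤ 12 * q.a ^ 2 * q.t * (q.L + q.Lg) * w / (y - 1) + 3 * q.a * q.t * v
      + q.L * q.C * q.a ^ 2 / 2 := by
    have e1 : ρ / (y - 1) = 12 * q.a ^ 2 * q.t * (q.L + q.Lg) * w / (y - 1) + 3 * q.a * q.t * v
        + q.L * q.C * q.a ^ 2 / 2 / (y - 1) := by
      rw [hρ]; field_simp
    have : q.L * q.C * q.a ^ 2 / 2 / (y - 1) ≤ q.L * q.C * q.a ^ 2 / 2 :=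
      div_le_self (by positivity) (by linarith)
    linarith
  have herr : 9 * q.a * q.t * v + 12 * q.a ^ 2 * q.t * (q.L + q.Lg) * w / (y - 1)
      = q.err₁ + q.err₂ * β := by
    unfold Params.err₁ Params.err₂
    rw [hv, hw]
    ring
  have hsum : subopt f (x (j + 1)) ≤ (K * φ 0 + ρ / (y - 1)) / (m + 1)
      + √(q.deviation K δ b (j + 1)) / (m + 1) + 3 * q.a * q.t * v / (m + 1) := by
    have : φ (j + 1) = subopt f (x (j + 1)) - q.a / m * corrector q f p π g (x j) (z (j + 1)) :=
      rfl
    linarith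
  refine hsum.trans ?_
  rw [← add_div, ← add_div]
  refine div_le_div_of_nonneg_right ?_ (by linarith)
  linarith

end IsSetting

/-! ### The deviation of the martingale part -/

namespace Params

/-- The bound, at a time where the suboptimality is at most `b / (i + K)`, for the `i`-th increment
of the martingale part at time `n`. -/
noncomputable def incr (q : Params) (K b : ℝ) (n i : ℕ) : ℝ :=
  |damping (q.μ * q.a) K i n| * (q.a / (i + K)) *
    √(80 * q.L * ((q.t : ℝ) ^ 2 * q.d + 1) * (b / (i + K) * (q.Q * (b / (i + K)) + q.C)))

namespace IsTuned

variable {q : Params} (h : q.IsTuned) {K δ b : ℝ} (hδ : 0 < δ) (hδ' : δ < 1)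
  (hK : q.minK₀ δ ≤ K) (hb : 0 < b)

include h hδ hδ' hK hb

theorem deviation_pos {n : ℕ} (hn : 1 ≤ n) : 0 < q.deviation K δ b n := by
  have h1 := (log_two_div_pos hδ hδ').trans_le (log_two_div_le hδ hn)
  have h2 := h.ν₂_ge
  have h3 := h.νC_nonneg
  have hK0 : 2000 ≤ K := h.two_thousand_le hK
  unfold deviation
  positivity

theorem sum_incr_sq_le {n : ℕ} (hn : 1 ≤ n) :
    4 * Real.log (2 * n / δ) * ∑ i ∈ Finset.range n, q.incr K b n i ^ 2
      ≤ q.deviation K δ b n / (n + K) ^ 2 := by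
  have hL := h.L_pos
  have ha := h.a_pos
  have hC := h.C_nonneg
  have hQ := h.Q_pos
  have hy := h.two_le
  have hK0 : 2000 ≤ K := h.two_thousand_le hK
  have hyK : 100 * (q.μ * q.a) ≤ K := by linarith [h.y_le (two_mul_D₂_le hK)]
  have hl : 0 < Real.log (2 * n / δ) := (log_two_div_pos hδ hδ').trans_le (log_two_div_le hδ hn)
  have hy3 : 0 < 2 * (q.μ * q.a) - 3 := by linarith
  have hy2 : 0 < 2 * (q.μ * q.a) - 2 := by linarith
  have h4 := sum_damping_sq_div_pow_four_le hy hyK n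
  have h3 := sum_damping_sq_div_pow_three_le hy hyK n
  set c := 80 * q.L * ((q.t : ℝ) ^ 2 * q.d + 1) with hc
  have hc0 : 0 < c := by positivity
  have e : ∀ i ∈ Finset.range n, q.incr K b n i ^ 2
      = c * q.a ^ 2 * (q.Q * b ^ 2) * (damping (q.μ * q.a) K i n ^ 2 * (1 / (i + K) ^ 4))
        + c * q.a ^ 2 * (q.C * b) * (damping (q.μ * q.a) K i n ^ 2 * (1 / (i + K) ^ 3)) := by
    intro i _
    have : 0 < (i : ℝ) + K := by positivity
    unfold incr
    rw [mul_pow, mul_pow, sq_abs, Real.sq_sqrt (by positivity), hc]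
    field_simp
  rw [Finset.sum_congr rfl e, Finset.sum_add_distrib, ← Finset.mul_sum, ← Finset.mul_sum]
  have hN : 0 < (n : ℝ) + K := by positivity
  generalize ∑ i ∈ Finset.range n, damping (q.μ * q.a) K i n ^ 2 * (1 / (i + K) ^ 4) = S₄ at *
  generalize ∑ i ∈ Finset.range n, damping (q.μ * q.a) K i n ^ 2 * (1 / (i + K) ^ 3) = S₃ at *
  have he : 7 ≤ Real.exp 1 ^ 2 := by nlinarith [Real.exp_one_gt_d9]
  have hν₂ : 5 * c * q.a ^ 2 * q.Q / (2 * (q.μ * q.a) - 3) ≤ q.ν₂ := by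
    have e1 : q.ν₂ = 64 * q.a ^ 2 * Real.exp 1 ^ 2 * q.L * ((q.t : ℝ) ^ 2 * q.d + 1)
        * q.Q / (2 * (q.μ * q.a) - 3) := by unfold ν₂ Q; ring
    rw [e1]
    refine div_le_div_of_nonneg_right ?_ hy3.le
    have h0 : 0 ≤ q.a ^ 2 * q.L * ((q.t : ℝ) ^ 2 * q.d + 1) * q.Q := by positivity
    rw [hc]
    nlinarith [mul_le_mul_of_nonneg_left he h0]
  have hνC : 5 * c * q.a ^ 2 * q.C / (2 * (q.μ * q.a) - 2) ≤ 2 * q.νC := by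
    have e1 : 2 * q.νC = 64 * q.a ^ 2 * Real.exp 1 ^ 2 * q.L * ((q.t : ℝ) ^ 2 * q.d + 1)
        * q.C / (2 * (q.μ * q.a) - 2) := by unfold νC; ring
    rw [e1]
    refine div_le_div_of_nonneg_right ?_ hy2.le
    have h0 : 0 ≤ q.a ^ 2 * q.L * ((q.t : ℝ) ^ 2 * q.d + 1) * q.C := by positivity
    rw [hc]
    nlinarith [mul_le_mul_of_nonneg_left he h0]
  unfold deviation
  set N := (n : ℝ) + K
  set ℓ := Real.log (2 * n / δ)
  calc 4 * ℓ * (c * q.a ^ 2 * (q.Q * b ^ 2) * S₄ + c * q.a ^ 2 * (q.C * b) * S₃)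
      ≤ 4 * ℓ * (c * q.a ^ 2 * (q.Q * b ^ 2) * (5 / 4 / ((2 * (q.μ * q.a) - 3) * N ^ 3))
        + c * q.a ^ 2 * (q.C * b) * (5 / 4 / ((2 * (q.μ * q.a) - 2) * N ^ 2))) := by gcongr
    _ = ℓ * ((5 * c * q.a ^ 2 * q.Q / (2 * (q.μ * q.a) - 3)) * b ^ 2 / N
        + (5 * c * q.a ^ 2 * q.C / (2 * (q.μ * q.a) - 2)) * b) / N ^ 2 := by
        generalize 2 * (q.μ * q.a) - 3 = w₃ at *
        generalize 2 * (q.μ * q.a) - 2 = w₂ at *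
        field_simp
    _ ≤ ℓ * (q.ν₂ * b ^ 2 / N + 2 * q.νC * b) / N ^ 2 := by gcongr

end IsTuned
end Params

/-! ### Measurability with respect to the history -/

section History

variable {Ω : Type u} {S : Type v} [MeasurableSpace S] {d : ℕ}
  {x₀ : Ω → E d} {M : ℕ → Ω → E d} {Z : ℕ → Ω → S}

theorem history_mono : Monotone (history x₀ M Z) := by
  intro i j hij
  refine sup_le_sup_left ?_ _
  refine iSup_mono fun ℓ => iSup_le fun hℓ => ?_
  exact le_iSup_of_le (hℓ.trans hij) le_rfl

theorem history_le [mΩ : MeasurableSpace Ω] (h0 : Measurable x₀) (hM : ∀ k, Measurable (M k))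
    (hZ : ∀ k, Measurable (Z k)) (k : ℕ) : history x₀ M Z k ≤ mΩ :=
  sup_le h0.comap_le (iSup_le fun ℓ => iSup_le fun _ => sup_le (hM ℓ).comap_le (hZ ℓ).comap_le)

theorem measurable_history_init (k : ℕ) : Measurable[history x₀ M Z k] x₀ :=
  measurable_iff_comap_le.2 le_sup_left

theorem measurable_history_noise (k : ℕ) : Measurable[history x₀ M Z k] (M k) :=
  measurable_iff_comap_le.2
    (le_sup_of_le_right (le_iSup_of_le k (le_iSup_of_le le_rfl le_sup_left)))

theorem measurable_history_state (k : ℕ) : Measurable[history x₀ M Z k] (Z k) :=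
  measurable_iff_comap_le.2
    (le_sup_of_le_right (le_iSup_of_le k (le_iSup_of_le le_rfl le_sup_right)))

end History

theorem measurable_uncurry_of_lipschitz {S : Type v} [MeasurableSpace S] {d : ℕ}
    {φ : E d → S → E d} {c : ℝ} (hφ : ∀ x, Measurable (φ x))
    (hl : ∀ x y z, ‖φ x z - φ y z‖ ≤ c * ‖x - y‖) : Measurable (Function.uncurry φ) :=
  measurable_uncurry_of_continuous_of_measurable (fun z =>
    (LipschitzWith.of_dist_le_mul (K := c.toNNReal) fun x y => by
      rw [dist_eq_norm, dist_eq_norm]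
      exact (hl x y z).trans
        (mul_le_mul_of_nonneg_right (Real.le_coe_toNNReal c) (norm_nonneg _))).continuous) hφ

namespace IsSetting

variable {S : Type v} [MeasurableSpace S] {q : Params} {f : E q.d → ℝ}
  {p : Kernel S S} [IsMarkovKernel p] {π : Measure S} [IsProbabilityMeasure π]
  {g : E q.d → S → E q.d} (h : IsSetting q f p π g)

include h

theorem measurable_uncurry_sample : Measurable (Function.uncurry g) :=
  measurable_uncurry_of_lipschitz h.sample.measurable h.sample.lipschitz

theorem measurable_uncurry_poissonSol :
    Measurable (Function.uncurry fun x z => poissonSol p π q.t (g x) z) :=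
  measurable_uncurry_of_lipschitz (c := 3 * q.t * q.Lg)
    (fun x => measurable_poissonSol h.ergodic (h.sample.measurable x) (h.sample.norm_le x))
    fun x y z => by
      rw [mul_assoc]
      exact h.norm_poissonSol_sub_le x y z

theorem measurable_subopt : Measurable (subopt f) :=
  (h.smooth.differentiable.continuous.sub continuous_const).measurable

theorem measurable_gradient : Measurable (gradient f) :=
  (continuous_gradient h.smooth).measurable

theorem integral_poissonSol (x : E q.d) (z : S) :
    ∫ w, poissonSol p π q.t (g x) w ∂p z
      = poissonSol p π q.t (g x) z - (g x z - gradient f x) := by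
  have h3 := poissonSol_sub_integral h.ergodic (h.sample.measurable x) (h.sample.norm_le x) z
  rw [← h.sample.mean x] at h3
  rw [← h3, sub_sub_cancel]

variable {Ω : Type u} {K : ℝ} {M x : ℕ → Ω → E q.d} {Z : ℕ → Ω → S}

theorem measurable_history_iterate [MeasurableSpace Ω] (hx : IsSGD g Z M x q.a K) (k : ℕ) :
    Measurable[history (x 0) M Z k] (x k) := by
  induction k with
  | zero => exact measurable_history_init 0
  | succ k ih =>
    have e : x (k + 1) = fun ω => x k ω - (q.a / ((k : ℝ) + K)) • (Function.uncurry g (x k ω, Z k ω)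
        + M (k + 1) ω) := funext fun ω => hx.step k ω
    rw [e]
    have h1 := ih.mono (history_mono k.le_succ) le_rfl
    have h2 := (measurable_history_state (x₀ := x 0) (M := M) (Z := Z) k).mono
      (history_mono k.le_succ) le_rfl
    have h3 := measurable_history_noise (x₀ := x 0) (M := M) (Z := Z) (k + 1)
    exact h1.sub (((h.measurable_uncurry_sample.comp (h1.prodMk h2)).add h3).fun_const_smul _)

omit h in
/-- The innovations are martingale differences, also after multiplication with `F`-measurable
vectors. -/
theorem condExp_inner_innovation (h : IsSetting q f p π g) {F mΩ : MeasurableSpace Ω}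
    (hle : F ≤ mΩ) {P : Measure Ω} [IsProbabilityMeasure P] {X U M' : Ω → E q.d} {Y Y' : Ω → S}
    (hX : Measurable[F] X) (hY : Measurable[F] Y) (hY' : Measurable Y')
    (htrans : ∀ s : Set S, MeasurableSet s →
      P⟦Y' ⁻¹' s | F⟧ =ᵐ[P] fun ω => (p (Y ω)).real s)
    (hM : Integrable M' P) (hM0 : P[M' | F] =ᵐ[P] 0)
    (hG : ∀ᵐ ω ∂P, ‖g (X ω) (Y ω) + M' ω‖ ^ 2 ≤ abcBound f q.A q.B q.C (X ω))
    (hU : Measurable[F] U) {c : ℝ}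
    (hUc : ∀ ω, ‖U ω‖ * ((2 + 6 * q.t) * growth q f (X ω)) ≤ c) :
    P[fun ω => inner ℝ (U ω) (innovation q p π g (X ω) (Y ω) (Y' ω) (M' ω)) | F] =ᵐ[P] 0 := by
  have ht : (0 : ℝ) ≤ q.t := q.t.cast_nonneg
  have hg0 : ∀ ω, 0 ≤ ‖U ω‖ * growth q f (X ω) := fun ω =>
    mul_nonneg (norm_nonneg _) (Real.sqrt_nonneg _)
  -- the noise part
  have hM1 : Integrable (fun ω => inner ℝ (U ω) (M' ω)) P := by
    refine Integrable.of_bound ((hU.mono hle le_rfl).aestronglyMeasurable.inner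
      hM.aestronglyMeasurable) c ?_
    filter_upwards [hG] with ω hω
    have h1 : ‖M' ω‖ ≤ 2 * growth q f (X ω) := by
      have h2 : ‖g (X ω) (Y ω) + M' ω‖ ≤ growth q f (X ω) :=
        Real.le_sqrt_of_sq_le hω
      have h3 : ‖g (X ω) (Y ω)‖ ≤ growth q f (X ω) := h.sample.norm_le _ _
      have h4 := norm_sub_le (g (X ω) (Y ω) + M' ω) (g (X ω) (Y ω))
      rw [add_sub_cancel_left] at h4
      linarith
    refine (norm_inner_le_norm _ _).trans ?_
    have := mul_le_mul_of_nonneg_left h1 (norm_nonneg (U ω))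
    have := mul_nonneg ht (hg0 ω)
    linarith [hUc ω]
  have hM2 : P[fun ω => inner ℝ (U ω) (M' ω) | F] =ᵐ[P] 0 := by
    have h1 := condExp_bilin_of_stronglyMeasurable_left (μ := P) (innerSL ℝ)
      hU.stronglyMeasurable (g := M') hM1 hM
    refine h1.trans ?_
    filter_upwards [hM0] with ω hω
    rw [hω]
    simp
  -- the part of the Markov chain
  have hH := h.measurable_uncurry_poissonSol
  have hb : ∀ ω z, |inner ℝ (U ω) (poissonSol p π q.t (g (X ω)) z)| ≤ c := fun ω z => by
    refine (abs_real_inner_le_norm _ _).trans ?_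
    have := mul_le_mul_of_nonneg_left (h.norm_poissonSol_le (X ω) z) (norm_nonneg (U ω))
    have := mul_nonneg ht (hg0 ω)
    linarith [hUc ω, hg0 ω]
  have hN1 : Integrable (fun ω => inner ℝ (U ω) (poissonSol p π q.t (g (X ω)) (Y' ω))) P :=
    Integrable.of_bound ((hU.mono hle le_rfl).inner (hH.comp
      ((hX.mono hle le_rfl).prodMk hY'))).aestronglyMeasurable c
      (ae_of_all _ fun ω => hb ω _)
  have hN2 := condExp_comp_next (P := P) hle hY hY' htrans
    (hU.prodMk hX) (Φ := fun r : (E q.d × E q.d) × S =>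
      inner ℝ r.1.1 (poissonSol p π q.t (g r.1.2) r.2))
    ((measurable_fst.comp measurable_fst).inner (hH.comp
      ((measurable_snd.comp measurable_fst).prodMk measurable_snd))) hb
  -- the compensator is known at time `k`
  let J : Ω → ℝ := fun ω =>
    inner ℝ (U ω) (∫ w, poissonSol p π q.t (g (X ω)) w ∂p (Y ω))
  have hJm : Measurable[F] J := by
    have e : J = fun ω => inner ℝ (U ω)
        (Function.uncurry (fun x z => poissonSol p π q.t (g x) z) (X ω, Y ω)
          - (Function.uncurry g (X ω, Y ω) - gradient f (X ω))) :=
      funext fun ω => by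
        simp only [J, h.integral_poissonSol]
        rfl
    rw [e]
    exact hU.inner ((hH.comp (hX.prodMk hY)).sub
      ((h.measurable_uncurry_sample.comp (hX.prodMk hY)).sub (h.measurable_gradient.comp hX)))
  have hJe : ∀ ω, J ω = ∫ z, inner ℝ (U ω) (poissonSol p π q.t (g (X ω)) z) ∂p (Y ω) :=
    fun ω => (integral_inner (integrable_of_norm_le
      (measurable_poissonSol h.ergodic (h.sample.measurable _) (h.sample.norm_le _))
      (h.norm_poissonSol_le (X ω))) (U ω)).symm
  have hJi : Integrable J P :=
    Integrable.of_bound (hJm.mono hle le_rfl).aestronglyMeasurable c (ae_of_all _ fun ω => by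
      rw [hJe]
      simpa using norm_integral_le_of_norm_le_const (μ := p (Y ω))
        (ae_of_all _ fun z => (Real.norm_eq_abs _).trans_le (hb ω z)))
  have e : (fun ω => inner ℝ (U ω)
      (innovation q p π g (X ω) (Y ω) (Y' ω) (M' ω)))
      = (fun ω => inner ℝ (U ω) (M' ω))
        + ((fun ω => inner ℝ (U ω) (poissonSol p π q.t (g (X ω)) (Y' ω))) - J) :=
    funext fun ω => by
      simp only [innovation, Pi.add_apply, Pi.sub_apply, J, inner_add_right, inner_sub_right]
  rw [e]
  filter_upwards [condExp_add hM1 (hN1.sub hJi) F, condExp_sub hN1 hJi F, hM2, hN2] with ω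
    h1 h2 h3 h4
  rw [h1, Pi.add_apply, h2, Pi.sub_apply, h3, h4,
    condExp_of_stronglyMeasurable hle hJm.stronglyMeasurable hJi, hJe]
  simp

end IsSetting

/-! ### The high-probability bound -/

namespace Params

variable (q : Params)

theorem measurable_level (K δ Kbar logbar : ℝ) (k : ℕ) :
    Measurable fun Δ₀ => q.level K δ Kbar logbar Δ₀ k := by
  unfold level excess Γ₂ Γ₁ ν₁ D₁
  fun_prop

theorem measurable_deviation (K δ : ℝ) (k : ℕ) : Measurable fun b => q.deviation K δ b k := by
  unfold deviation
  fun_prop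

theorem measurable_incr (K : ℝ) (n i : ℕ) : Measurable fun b => q.incr K b n i := by
  unfold incr
  fun_prop

end Params

namespace IsSetting

variable {S : Type v} [MeasurableSpace S] {q : Params} {f : E q.d → ℝ}
  {p : Kernel S S} [IsMarkovKernel p] {π : Measure S} [IsProbabilityMeasure π]
  {g : E q.d → S → E q.d} (h : IsSetting q f p π g)
  {Ω : Type u} [mΩ : MeasurableSpace Ω] {P : Measure Ω} [IsProbabilityMeasure P]
  {π₀ : Measure S} {M x : ℕ → Ω → E q.d} {Z : ℕ → Ω → S} {δ K Kbar logbar : ℝ}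

include h

set_option maxHeartbeats 1000000 in
/-- The event that the martingale part is the first to become too large at time `n`. The increments
are stopped when the bound on the suboptimality first fails, which makes them bounded by quantities
that are known at time `0`. -/
theorem measure_deviation_le (hδ : 0 < δ) (hδ' : δ < 1) (hK : q.minK₀ δ ≤ K)
    (hlogbar : Real.log (2 * K / δ) / Real.log (2 / δ) ≤ logbar)
    (hx : IsSGD g Z M x q.a K) (hZ : IsMarkovChain P (history (x 0) M Z) Z π₀ p)
    (hM : IsMartingaleDifference P (history (x 0) M Z) M)
    (hG : ∀ k, ∀ᵐ ω ∂P, ‖noisyGradient g Z M x k ω‖ ^ 2 ≤ abcBound f q.A q.B q.C (x k ω))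
    {n : ℕ} (hn : 1 ≤ n) :
    P {ω | (∀ i < n, subopt f (x i ω)
          ≤ q.level K δ Kbar logbar (subopt f (x 0 ω)) i / (i + K)) ∧
        √(q.deviation K δ (q.level K δ Kbar logbar (subopt f (x 0 ω)) n) n) / (n + K)
          < ∑ i ∈ Finset.range n, damping (q.μ * q.a) K i n * (-(q.a / (i + K)) *
            inner ℝ (gradient f (x i ω)) (innovation q p π g (x i ω) (Z i ω) (Z (i + 1) ω)
              (M (i + 1) ω)))}
      ≤ ENNReal.ofReal (δ / (2 * (n : ℝ) ^ 2)) := by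
  have T := h.tuned
  have ha := T.a_pos
  have hL := T.L_pos
  have hC := T.C_nonneg
  have hQ := T.Q_pos
  have hK0 : 2000 ≤ K := T.two_thousand_le hK
  have hn1 : (1 : ℝ) ≤ n := by exact_mod_cast hn
  have hmeas := h.measurable_history_iterate hx
  have hle := history_le hx.measurable_zero hM.measurable hZ.measurable
  have hmono := history_mono (x₀ := x 0) (M := M) (Z := Z)
  let b : ℕ → Ω → ℝ := fun i ω => q.level K δ Kbar logbar (subopt f (x 0 ω)) i
  have hbpos : ∀ i ω, 0 < b i ω := fun i ω =>
    T.level_pos hδ hδ' hK hlogbar (h.subopt_nonneg _) i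
  have hbm : ∀ i k, Measurable[history (x 0) M Z k] (b i) := fun i k =>
    (q.measurable_level K δ Kbar logbar i).comp
      (h.measurable_subopt.comp (measurable_history_init k))
  let τ : Ω → ℝ := fun ω => √(q.deviation K δ (b n ω) n) / (n + K)
  have hτpos : ∀ ω, 0 < τ ω := fun ω =>
    div_pos (Real.sqrt_pos.2 (T.deviation_pos hδ hδ' hK (hbpos n ω) hn)) (by positivity)
  have hτm : ∀ k, Measurable[history (x 0) M Z k] τ := fun k =>
    (((q.measurable_deviation K δ n).comp (hbm n k)).sqrt).div_const _
  set ℓ := Real.log (2 * (n : ℝ) ^ 2 / δ) with hℓ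
  have hℓ0 : 0 < ℓ := Real.log_pos (by
    rw [lt_div_iff₀ hδ]
    nlinarith [one_le_pow₀ hn1 (n := 2)])
  have hℓle : ℓ ≤ 2 * Real.log (2 * n / δ) := by
    rw [show 2 * Real.log (2 * n / δ) = Real.log ((2 * n / δ) ^ 2) by
      rw [Real.log_pow]; norm_num]
    refine Real.log_le_log (by positivity) ?_
    rw [div_pow, div_le_div_iff₀ hδ (by positivity)]
    have h0 : 0 ≤ 2 * (n : ℝ) ^ 2 * δ := by positivity
    nlinarith [mul_le_mul_of_nonneg_left hδ'.le h0]
  let A : ℕ → Set Ω := fun i => {ω | ∀ j ≤ i, subopt f (x j ω) ≤ b j ω / (j + K)}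
  have hA : ∀ i, MeasurableSet[history (x 0) M Z i] (A i) := fun i => by
    have e : A i = ⋂ j, ⋂ _ : j ≤ i, {ω | subopt f (x j ω) ≤ b j ω / (j + K)} := by
      ext ω
      simp [A]
    rw [e]
    refine MeasurableSet.iInter fun j => MeasurableSet.iInter fun hj => ?_
    exact measurableSet_le (h.measurable_subopt.comp ((hmeas j).mono (hmono hj) le_rfl))
      ((hbm j i).div_const _)
  let U : ℕ → Ω → E q.d := fun i => (A i).indicator fun ω =>
    (-(2 * ℓ / τ ω * (damping (q.μ * q.a) K i n * (q.a / (i + K))))) • gradient f (x i ω)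
  have hU : ∀ i, Measurable[history (x 0) M Z i] (U i) := fun i =>
    (((((hτm i).const_div (2 * ℓ)).mul_const _).neg).smul
      (h.measurable_gradient.comp (hmeas i))).indicator (hA i)
  let ξ : ℕ → Ω → E q.d := fun i ω =>
    innovation q p π g (x i ω) (Z i ω) (Z (i + 1) ω) (M (i + 1) ω)
  let θ : ℕ → Ω → ℝ := fun i ω => inner ℝ (U i ω) (ξ i ω)
  let s : ℕ → Ω → ℝ := fun i ω => 2 * ℓ / τ ω * q.incr K (b n ω) n i
  have hξm : ∀ i, Measurable[history (x 0) M Z (i + 1)] (ξ i) := fun i => by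
    have h1 := (hmeas i).mono (hmono i.le_succ) le_rfl
    have h2 := (measurable_history_state (x₀ := x 0) (M := M) (Z := Z) i).mono
      (hmono i.le_succ) le_rfl
    have h3 := measurable_history_state (x₀ := x 0) (M := M) (Z := Z) (i + 1)
    have h4 := measurable_history_noise (x₀ := x 0) (M := M) (Z := Z) (i + 1)
    have hH := h.measurable_uncurry_poissonSol
    have e : ξ i = fun ω => M (i + 1) ω
        + (Function.uncurry (fun x z => poissonSol p π q.t (g x) z) (x i ω, Z (i + 1) ω)
          - (Function.uncurry (fun x z => poissonSol p π q.t (g x) z) (x i ω, Z i ω)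
            - (Function.uncurry g (x i ω, Z i ω) - gradient f (x i ω)))) :=
      funext fun ω => by
        simp only [ξ, innovation, h.integral_poissonSol]
        rfl
    rw [e]
    exact h4.add ((hH.comp (h1.prodMk h3)).sub ((hH.comp (h1.prodMk h2)).sub
      ((h.measurable_uncurry_sample.comp (h1.prodMk h2)).sub (h.measurable_gradient.comp h1))))
  have hs0 : ∀ i ω, 0 ≤ s i ω := fun i ω => by
    have := hτpos ω
    simp only [s, Params.incr]
    positivity
  have hUs : ∀ i < n, ∀ ω, ‖U i ω‖ * ((2 + 6 * q.t) * growth q f (x i ω)) ≤ s i ω := by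
    intro i hi ω
    by_cases hω : ω ∈ A i
    · have hΔ : subopt f (x i ω) ≤ b n ω / (i + K) := (hω i le_rfl).trans
        (div_le_div_of_nonneg_right
          (T.level_mono hδ hδ' hK hlogbar (h.subopt_nonneg _) hi.le) (by positivity))
      have hΔ0 := h.subopt_nonneg (x i ω)
      have h1 : ‖gradient f (x i ω)‖ * ((2 + 6 * q.t) * growth q f (x i ω))
          ≤ √(80 * q.L * ((q.t : ℝ) ^ 2 * q.d + 1)
            * (b n ω / (i + K) * (q.Q * (b n ω / (i + K)) + q.C))) := by
        refine Real.le_sqrt_of_sq_le ((h.norm_gradient_mul_growth_sq_le _).trans ?_)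
        have hbi : 0 ≤ b n ω / (i + K) := hΔ0.trans hΔ
        gcongr
      have hτ := hτpos ω
      have e : ‖U i ω‖ = 2 * ℓ / τ ω * (|damping (q.μ * q.a) K i n| * (q.a / (i + K)))
          * ‖gradient f (x i ω)‖ := by
        simp only [U, Set.indicator_of_mem hω]
        rw [norm_smul, norm_neg, Real.norm_eq_abs, abs_mul, abs_mul,
          abs_of_nonneg (show 0 ≤ 2 * ℓ / τ ω by positivity),
          abs_of_nonneg (show 0 ≤ q.a / ((i : ℝ) + K) by positivity)]
      rw [e]
      calc 2 * ℓ / τ ω * (|damping (q.μ * q.a) K i n| * (q.a / (i + K)))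
            * ‖gradient f (x i ω)‖ * ((2 + 6 * q.t) * growth q f (x i ω))
          = 2 * ℓ / τ ω * (|damping (q.μ * q.a) K i n| * (q.a / (i + K)))
            * (‖gradient f (x i ω)‖ * ((2 + 6 * q.t) * growth q f (x i ω))) := by ring
        _ ≤ 2 * ℓ / τ ω * (|damping (q.μ * q.a) K i n| * (q.a / (i + K)))
            * √(80 * q.L * ((q.t : ℝ) ^ 2 * q.d + 1)
              * (b n ω / (i + K) * (q.Q * (b n ω / (i + K)) + q.C))) := by gcongr
        _ = s i ω := by simp only [s, Params.incr]; ring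
    · simp only [U, Set.indicator_of_notMem hω, norm_zero, zero_mul]
      exact hs0 i ω
  have hsum : ∀ ω, ∑ i ∈ Finset.range n, s i ω ^ 2 ≤ 2 * ℓ := by
    intro ω
    have hτ := hτpos ω
    have h1 := T.sum_incr_sq_le hδ hδ' hK (hbpos n ω) hn
    have h2 : τ ω ^ 2 = q.deviation K δ (b n ω) n / (n + K) ^ 2 := by
      simp only [τ]
      rw [div_pow, Real.sq_sqrt (T.deviation_pos hδ hδ' hK (hbpos n ω) hn).le]
    rw [← h2] at h1
    simp only [s, mul_pow]
    rw [← Finset.mul_sum]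
    have h0 : 0 ≤ ∑ i ∈ Finset.range n, q.incr K (b n ω) n i ^ 2 :=
      Finset.sum_nonneg fun i _ => sq_nonneg _
    generalize ∑ i ∈ Finset.range n, q.incr K (b n ω) n i ^ 2 = V at *
    have h3 : 2 * ℓ * V ≤ τ ω ^ 2 := by nlinarith
    calc (2 * ℓ / τ ω) ^ 2 * V = 2 * ℓ * (2 * ℓ * V) / τ ω ^ 2 := by ring
      _ ≤ 2 * ℓ * τ ω ^ 2 / τ ω ^ 2 := by gcongr
      _ = 2 * ℓ := by field_simp
  have hbound : ∀ i < n, ∀ᵐ ω ∂P, |θ i ω| ≤ s i ω := fun i hi => by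
    filter_upwards [hG i] with ω hω
    refine (abs_real_inner_le_norm _ _).trans (le_trans ?_ (hUs i hi ω))
    gcongr
    exact h.norm_innovation_le _ _ _ _ hω
  have hsc : ∀ i < n, ∀ ω, s i ω ≤ √(2 * ℓ) := fun i hi ω =>
    Real.le_sqrt_of_sq_le ((Finset.single_le_sum (f := fun i => s i ω ^ 2)
      (fun j _ => sq_nonneg _) (Finset.mem_range.2 hi)).trans (hsum ω))
  have hcond : ∀ i < n, P[θ i | history (x 0) M Z i] =ᵐ[P] 0 := fun i hi =>
    h.condExp_inner_innovation (hle i) (hmeas i) (measurable_history_state i)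
      (hZ.measurable (i + 1)) (hZ.transition i) (hM.integrable (i + 1)) (hM.condExp_eq_zero i)
      (hG i) (hU i) (fun ω => (hUs i hi ω).trans (hsc i hi ω))
  have hmain := measure_sum_ge_le_exp (P := P) hmono hle
    (fun i => ((hU i).mono (hmono i.le_succ) le_rfl).inner (hξm i))
    (fun i => ((hτm i).const_div (2 * ℓ)).mul ((q.measurable_incr K n i).comp (hbm n i)))
    hbound hsum hcond
  have hexp : Real.exp (-ℓ) = δ / (2 * (n : ℝ) ^ 2) := by
    rw [Real.exp_neg, hℓ, Real.exp_log (by positivity), inv_div]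
  rw [hexp] at hmain
  refine (measure_mono ?_).trans hmain
  rintro ω ⟨hω, hdev⟩
  have hτ := hτpos ω
  have e : ∑ i ∈ Finset.range n, θ i ω = 2 * ℓ / τ ω * ∑ i ∈ Finset.range n,
      damping (q.μ * q.a) K i n * (-(q.a / (i + K)) * inner ℝ (gradient f (x i ω)) (ξ i ω)) := by
    rw [Finset.mul_sum]
    refine Finset.sum_congr rfl fun i hi => ?_
    have hωi : ω ∈ A i := fun j hj => hω j (hj.trans_lt (Finset.mem_range.1 hi))
    simp only [θ, U, Set.indicator_of_mem hωi]
    rw [inner_smul_left]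
    simp only [map_neg, conj_trivial]
    ring
  change 2 * ℓ ≤ ∑ i ∈ Finset.range n, θ i ω
  rw [e]
  calc 2 * ℓ = 2 * ℓ / τ ω * τ ω := by field_simp
    _ ≤ _ := mul_le_mul_of_nonneg_left hdev.le (by positivity)

/-- The high-probability bound for a non-constant objective: off the exceptional events, strong
induction along the path gives the bound at all times. -/
theorem ofReal_one_sub_le_measure (hδ : 0 < δ) (hδ' : δ < 1) (hK : q.minK₀ δ ≤ K)
    (hKbar : K / Real.log (2 / δ) ≤ Kbar)
    (hlogbar : Real.log (2 * K / δ) / Real.log (2 / δ) ≤ logbar)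
    (hx : IsSGD g Z M x q.a K) (hZ : IsMarkovChain P (history (x 0) M Z) Z π₀ p)
    (hM : IsMartingaleDifference P (history (x 0) M Z) M)
    (hG : ∀ k, ∀ᵐ ω ∂P, ‖noisyGradient g Z M x k ω‖ ^ 2 ≤ abcBound f q.A q.B q.C (x k ω)) :
    ENNReal.ofReal (1 - δ) ≤ P {ω | ∀ k : ℕ, 1 ≤ k →
      subopt f (x k ω) ≤ q.bound K δ Kbar logbar (subopt f (x 0 ω)) k} := by
  have T := h.tuned
  have hK0 : 2000 ≤ K := T.two_thousand_le hK
  set good := {ω | ∀ k : ℕ, 1 ≤ k →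
      subopt f (x k ω) ≤ q.bound K δ Kbar logbar (subopt f (x 0 ω)) k} with hgood
  let b : ℕ → Ω → ℝ := fun i ω => q.level K δ Kbar logbar (subopt f (x 0 ω)) i
  -- the bound holds before time `n`, but the martingale part at time `n` is too large
  let bad : ℕ → Set Ω := fun n => {ω | (∀ i < n, subopt f (x i ω) ≤ b i ω / (i + K)) ∧
    √(q.deviation K δ (b n ω) n) / (n + K)
      < ∑ i ∈ Finset.range n, damping (q.μ * q.a) K i n * (-(q.a / (i + K)) *
        inner ℝ (gradient f (x i ω)) (innovation q p π g (x i ω) (Z i ω) (Z (i + 1) ω)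
          (M (i + 1) ω)))}
  have hbad : ∀ n, P (bad (n + 1)) ≤ ENNReal.ofReal (δ / (2 * ((n : ℝ) + 1) ^ 2)) := fun n => by
    have := h.measure_deviation_le (Kbar := Kbar) hδ hδ' hK hlogbar hx hZ hM hG
      (n := n + 1) (by omega)
    push_cast at this
    simpa only [bad, b, Nat.cast_add, Nat.cast_one] using this
  have hsub : ∀ᵐ ω ∂P, ω ∉ good → ω ∈ ⋃ n, bad (n + 1) := by
    filter_upwards [ae_all_iff.2 hG] with ω hω hng
    by_contra hnb
    simp only [Set.mem_iUnion, not_exists] at hnb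
    have key : ∀ k, subopt f (x k ω) ≤ b k ω / (k + K) := by
      intro k
      induction k using Nat.strong_induction_on with
      | _ k ih =>
        rcases Nat.eq_zero_or_pos k with rfl | hk
        · rw [le_div_iff₀ (by positivity)]
          have := T.excess_pos (Kbar := Kbar) hδ hδ' hK hlogbar (h.subopt_nonneg (x 0 ω)) 0
          simp only [b, Params.level, Nat.cast_zero, zero_add]
          linarith
        · obtain ⟨n, rfl⟩ : ∃ n, k = n + 1 := ⟨k - 1, by omega⟩
          refine h.subopt_le_of_forall_lt hδ hδ' hK hKbar hlogbar (x := fun i => x i ω)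
            (M := fun i => M i ω) (z := fun i => Z i ω) (fun i => hx.step i ω) hω hk rfl
            (fun i hi => (ih i hi).trans ?_) ?_
          · exact div_le_div_of_nonneg_right
              (T.level_mono hδ hδ' hK hlogbar (h.subopt_nonneg _) hi.le) (by positivity)
          · by_contra! hlt
            exact hnb n ⟨ih, hlt⟩
    exact hng fun k hk => by
      rw [q.bound_eq _ _ _ _ _ hk]
      exact key k
  have hsum : HasSum (fun n : ℕ => δ / (2 * ((n : ℝ) + 1) ^ 2)) (δ / 2 * (Real.pi ^ 2 / 6)) := by
    have h1 := (hasSum_nat_add_iff' 1).2 hasSum_zeta_two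
    simp only [Finset.range_one, Finset.sum_singleton, Nat.cast_zero, ne_eq, OfNat.ofNat_ne_zero,
      not_false_eq_true, zero_pow, div_zero, sub_zero, Nat.cast_add, Nat.cast_one] at h1
    refine (h1.mul_left (δ / 2)).congr_fun fun n => ?_
    field_simp
  have hunion : P (⋃ n, bad (n + 1)) ≤ ENNReal.ofReal δ := by
    calc P (⋃ n, bad (n + 1)) ≤ ∑' n, P (bad (n + 1)) := measure_iUnion_le _
      _ ≤ ∑' n : ℕ, ENNReal.ofReal (δ / (2 * ((n : ℝ) + 1) ^ 2)) := ENNReal.tsum_le_tsum hbad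
      _ = ENNReal.ofReal (δ / 2 * (Real.pi ^ 2 / 6)) := by
          rw [← ENNReal.ofReal_tsum_of_nonneg (fun n => by positivity) hsum.summable,
            hsum.tsum_eq]
      _ ≤ ENNReal.ofReal δ := by
          refine ENNReal.ofReal_le_ofReal ?_
          have hpi : Real.pi ^ 2 ≤ 12 := by
            nlinarith [Real.pi_lt_d2, Real.pi_pos]
          nlinarith
  have hcompl : P goodᶜ ≤ ENNReal.ofReal δ := (measure_mono_ae hsub).trans hunion
  have hone : (1 : ENNReal) ≤ P good + P goodᶜ := by
    rw [← measure_univ (μ := P), ← Set.union_compl_self good]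
    exact measure_union_le _ _
  rw [ENNReal.ofReal_sub _ hδ.le, ENNReal.ofReal_one, tsub_le_iff_right]
  exact hone.trans (by gcongr)

end IsSetting

/-! ### The orders of the threshold and of the bound -/

theorem two_mul_sqrt_mul_le {x y : ℝ} (hx : 0 ≤ x) (hy : 0 ≤ y) : 2 * √(x * y) ≤ x + y := by
  rw [Real.sqrt_mul hx]
  nlinarith [Real.sq_sqrt hx, Real.sq_sqrt hy, sq_nonneg (√x - √y)]

namespace Params

/-- The sign conditions under which all constants are nonnegative; degenerate cases (`d = 0`, or no
growth) are included. -/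
structure IsAdmissible (q : Params) : Prop where
  L_pos : 0 < q.L
  Lg_nonneg : 0 ≤ q.Lg
  A_nonneg : 0 ≤ q.A
  B_nonneg : 0 ≤ q.B
  C_nonneg : 0 ≤ q.C
  a_pos : 0 < q.a
  two_le : 2 ≤ q.μ * q.a
  m₁_pos : 0 < q.m₁
  m₂_pos : 0 < q.m₂
  m₃_pos : 0 < q.m₃
  m₄_pos : 0 < q.m₄

/-- The threshold is at most of order `log (1 / δ)`. -/
theorem minK₀_le (q : Params) : ∃ κ : ℝ, ∀ δ : ℝ, 0 < δ → δ < 1 →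
    q.minK₀ δ ≤ κ * Real.log (2 / δ) := by
  have hl2 : 0 < Real.log 2 := Real.log_pos one_lt_two
  set c₁ := |max (q.a * q.L / 2 * (2 * q.A + q.B / q.μ)) (q.μ * q.a)|
  set c₂ := |2 * q.D₂|
  set c := 24 * q.ν₂ * (2 * Real.log (48 * q.ν₂) + 1) with hc
  have hconst : ∀ s δ : ℝ, 0 < δ → δ < 1 → |s| ≤ |s| / Real.log 2 * Real.log (2 / δ) := by
    intro s δ hδ hδ'
    rw [div_mul_eq_mul_div, le_div_iff₀ hl2]
    refine mul_le_mul_of_nonneg_left (Real.log_le_log two_pos ?_) (abs_nonneg s)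
    rw [le_div_iff₀ hδ]
    linarith
  refine ⟨c₁ / Real.log 2 + c₂ / Real.log 2 + |c| * (|Real.log c| / Real.log 2 + 1),
    fun δ hδ hδ' => ?_⟩
  have hl : 0 < Real.log (2 / δ) := Real.log_pos (by rw [lt_div_iff₀ hδ]; linarith)
  have h1 := hconst (max (q.a * q.L / 2 * (2 * q.A + q.B / q.μ)) (q.μ * q.a)) δ hδ hδ'
  have h2 := hconst (2 * q.D₂) δ hδ hδ'
  have h3 : c * Real.log (48 * q.ν₂ * (2 * Real.log (48 * q.ν₂) + 1) / δ)
      ≤ |c| * (|Real.log c| / Real.log 2 + 1) * Real.log (2 / δ) := by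
    have e : 48 * q.ν₂ * (2 * Real.log (48 * q.ν₂) + 1) / δ = c * (2 / δ) := by rw [hc]; ring
    rw [e]
    rcases eq_or_ne c 0 with h0 | h0
    · simp [h0]
    · rw [Real.log_mul h0 (by positivity)]
      have h4 := hconst (Real.log c) δ hδ hδ'
      calc c * (Real.log c + Real.log (2 / δ))
          ≤ |c| * |Real.log c + Real.log (2 / δ)| := by
            rw [← abs_mul]; exact le_abs_self _
        _ ≤ |c| * (|Real.log c| + |Real.log (2 / δ)|) := by gcongr; exact abs_add_le _ _
        _ ≤ |c| * (|Real.log c| / Real.log 2 * Real.log (2 / δ) + Real.log (2 / δ)) := by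
            rw [abs_of_pos hl]
            gcongr
        _ = _ := by ring
  have p1 : 0 ≤ c₁ / Real.log 2 * Real.log (2 / δ) := by positivity
  have p2 : 0 ≤ c₂ / Real.log 2 * Real.log (2 / δ) := by positivity
  have p3 : 0 ≤ |c| * (|Real.log c| / Real.log 2 + 1) * Real.log (2 / δ) := by positivity
  unfold minK₀
  rw [add_mul, add_mul]
  refine max_le ?_ (max_le ?_ ?_)
  · linarith [le_abs_self (max (q.a * q.L / 2 * (2 * q.A + q.B / q.μ)) (q.μ * q.a))]
  · linarith [le_abs_self (2 * q.D₂)]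
  · linarith

namespace IsAdmissible

variable {q : Params} (h : q.IsAdmissible) {Δ₀ : ℝ}

include h

theorem D₁_nonneg (hΔ : 0 ≤ Δ₀) : 0 ≤ q.D₁ Δ₀ := by
  obtain ⟨_, _, _, _, _, _, h2, _, _, _, _⟩ := h
  have : 0 < q.μ * q.a - 1 := by linarith
  unfold D₁
  positivity

theorem D₂_nonneg : 0 ≤ q.D₂ := by
  obtain ⟨_, _, _, _, _, _, h2, _, _, _, _⟩ := h
  have : 0 < q.μ * q.a - 1 := by linarith
  unfold D₂
  positivity

theorem ν₁_nonneg (hΔ : 0 ≤ Δ₀) : 0 ≤ q.ν₁ Δ₀ := by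
  have h1 := h.D₁_nonneg hΔ
  have h2 := h.D₂_nonneg
  obtain ⟨_, _, _, _, _, _, h2, _, _, _, _⟩ := h
  have : 0 < 2 * q.μ * q.a - 3 := by linarith
  have : 0 < 2 * q.μ * q.a - 2 := by linarith
  unfold ν₁
  positivity

theorem Γ₁_nonneg (hΔ : 0 ≤ Δ₀) : 0 ≤ q.Γ₁ Δ₀ := by
  have h1 := h.D₁_nonneg hΔ
  have h2 := h.D₂_nonneg
  obtain ⟨_, _, _, _, _, _, h2, _, _, _, _⟩ := h
  unfold Γ₁
  positivity

theorem Γ₂_nonneg (hΔ : 0 ≤ Δ₀) {Kbar logbar : ℝ} (hl : 0 ≤ logbar) :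
    0 ≤ q.Γ₂ Kbar logbar Δ₀ := by
  have h1 := h.ν₁_nonneg hΔ
  unfold Γ₂
  positivity

variable {δ K Kbar logbar : ℝ} (hδ : 0 < δ) (hδ' : δ < 1) (hK : q.minK₀ δ ≤ K)

include hK in
theorem two_le_K : 2 ≤ K :=
  h.two_le.trans ((le_max_right _ _).trans ((le_max_left _ _).trans hK))

include hδ hδ' hK in
theorem log_K_pos : 0 < Real.log (2 * K / δ) := by
  have := h.two_le_K hK
  refine Real.log_pos ?_
  rw [lt_div_iff₀ hδ]
  linarith

include hδ hδ' hK in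
theorem bound_zero_nonneg (hlogbar : Real.log (2 * K / δ) / Real.log (2 / δ) ≤ logbar) {k : ℕ}
    (hk : 1 ≤ k) : 0 ≤ q.bound K δ Kbar logbar 0 k := by
  have h1 := h.log_K_pos hδ hδ' hK
  have h2 := IsTuned.log_two_div_pos hδ hδ'
  have h3 := IsTuned.log_two_div_le hδ hk
  have h4 : 0 ≤ logbar := le_trans (by positivity) hlogbar
  have h5 := h.Γ₁_nonneg le_rfl
  have h6 := h.Γ₂_nonneg (Kbar := Kbar) le_rfl h4
  have h7 : 0 ≤ Real.log (2 * k / δ) := h2.le.trans h3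
  have h8 := h.two_le_K hK
  unfold bound
  positivity

set_option maxHeartbeats 1000000 in
omit h in
/-- The bound is at most of order `t² log (k / δ) / (μ² k)`. -/
theorem bound_le (d : ℕ) (L Lg A B C m₁ m₂ m₃ m₄ r R Kbar logbar : ℝ) : ∃ H : ℝ,
    ∀ (t : ℕ) (μ a : ℝ), 1 ≤ t → 0 < μ → μ ≤ L → a ≤ r / μ →
    ∀ q : Params,
      q = { d := d, t := t, μ := μ, L := L, Lg := Lg, A := A, B := B, C := C, a := a,
            m₁ := m₁, m₂ := m₂, m₃ := m₃, m₄ := m₄ } → q.IsAdmissible →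
    ∀ δ K : ℝ, 0 < δ → δ < 1 → q.minK₀ δ ≤ K → K / Real.log (2 / δ) ≤ Kbar →
      Real.log (2 * K / δ) / Real.log (2 / δ) ≤ logbar →
    ∀ Δ₀ : ℝ, 0 ≤ Δ₀ → Δ₀ ≤ R → ∀ k : ℕ, 1 ≤ k →
      q.bound K δ Kbar logbar Δ₀ k
        ≤ H * ((t : ℝ) ^ 2 * Real.log (2 * k / δ) / (μ ^ 2 * k)) := by
  obtain ⟨e, he⟩ : ∃ x, x = Real.exp 1 := ⟨_, rfl⟩
  obtain ⟨s, hs⟩ : ∃ x, x = √(d : ℝ) := ⟨_, rfl⟩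
  obtain ⟨d₁, hd₁⟩ : ∃ x, x = 2 * m₁ * L * s * R * (r * L) + 10 * m₂ * s * (r * L)
    + e * m₄ * (L + Lg) * s * r ^ 2 := ⟨_, rfl⟩
  obtain ⟨d₂, hd₂⟩ : ∃ x, x = 8 * m₁ * L * s * (r * L) + e * m₃ * (L + Lg) * L * s * r ^ 2 :=
    ⟨_, rfl⟩
  obtain ⟨γ₁, hγ₁⟩ : ∃ x, x = e * C * L * r ^ 2 + 2 * (d₁ + d₂ * R) := ⟨_, rfl⟩
  obtain ⟨ρ₁, hρ₁⟩ : ∃ x, x = R / 4 + 10 * m₂ / (8 * m₁ * L) + m₄ / (m₃ * L) := ⟨_, rfl⟩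
  obtain ⟨ρ₂, hρ₂⟩ : ∃ x, x = r * C / (m₃ * L) := ⟨_, rfl⟩
  obtain ⟨n₁, hn₁⟩ : ∃ x, x = 32 * e ^ 2 * L * (d + 1)
    * ((2 * A * L + B) * (2 * R + ρ₁ + ρ₂) + C) * r ^ 2 := ⟨_, rfl⟩
  obtain ⟨γ₂, hγ₂⟩ : ∃ x, x = n₁ * (5 + 12 * logbar) + Kbar * R * L ^ 2 + 2 * γ₁ := ⟨_, rfl⟩
  refine ⟨Kbar * R * L ^ 2 + 2 * γ₁ + γ₂ * (logbar + 1), ?_⟩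
  rintro t μ a ht hμ hμL har q hq h δ K hδ hδ' hK hKbar hlogbar Δ₀ hΔ hΔR k hk
  have hK0 := h.two_le_K hK
  have hlK := h.log_K_pos hδ hδ' hK
  have hl2 := IsTuned.log_two_div_pos hδ hδ'
  have hl := IsTuned.log_two_div_le hδ hk
  have hν0 := h.ν₁_nonneg hΔ
  have hΓ0 := h.Γ₁_nonneg hΔ
  have hD₂0 := h.D₂_nonneg
  have hlb : 0 ≤ logbar := le_trans (by positivity) hlogbar
  have hKb : 0 ≤ Kbar := le_trans (by positivity) hKbar
  have hΓ₂0 := h.Γ₂_nonneg (Kbar := Kbar) hΔ hlb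
  have hR : 0 ≤ R := hΔ.trans hΔR
  have ht1 : (1 : ℝ) ≤ t := by exact_mod_cast ht
  have hk1 : (1 : ℝ) ≤ k := by exact_mod_cast hk
  have hl' : 1 / 2 ≤ Real.log (2 * k / δ) := by
    have h1 : Real.log 2 ≤ Real.log (2 * k / δ) := by
      refine Real.log_le_log two_pos ?_
      rw [le_div_iff₀ hδ]
      nlinarith
    linarith [Real.log_two_gt_d9]
  have hr : μ * a ≤ r := by
    rw [le_div_iff₀ hμ] at har
    linarith
  have hD₁0 := h.D₁_nonneg hΔ
  have eD₁ : q.D₁ Δ₀ = 2 * a * m₁ * t * L * s * Δ₀ + 10 * a * m₂ * t * s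
      + e * a ^ 2 * m₄ * t * (L + Lg) * s / (μ * a - 1) := by subst hq he hs; rfl
  have eD₂ : q.D₂ = 8 * a * m₁ * t * L * s
      + e * a ^ 2 * m₃ * t * (L + Lg) * L * s / (μ * a - 1) := by subst hq he hs; rfl
  have eν₁ : q.ν₁ Δ₀ = 32 * (a * e) ^ 2 * L * ((t : ℝ) ^ 2 * d + 1)
      * ((2 * A * L + B) / (2 * μ * a - 3)
        * (2 * Δ₀ + q.D₁ Δ₀ / q.D₂ + e * a ^ 2 * C * L / q.D₂)
        + C / (2 * μ * a - 2)) := by subst hq he hs; rfl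
  have eΓ₁ : q.Γ₁ Δ₀ = e * a ^ 2 * C * L + 2 * (q.D₁ Δ₀ + q.D₂ * Δ₀) := by subst hq he hs; rfl
  obtain ⟨hL, hLg, hA, hB, hC, ha, hy, hm₁, hm₂, hm₃, hm₄⟩ :
      0 < L ∧ 0 ≤ Lg ∧ 0 ≤ A ∧ 0 ≤ B ∧ 0 ≤ C ∧ 0 < a ∧ 2 ≤ μ * a ∧ 0 < m₁ ∧ 0 < m₂ ∧ 0 < m₃
        ∧ 0 < m₄ := by
    subst hq
    exact ⟨h.1, h.2, h.3, h.4, h.5, h.6, h.7, h.8, h.9, h.10, h.11⟩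
  have hr0 : 0 < r := by linarith
  have hy1 : 1 ≤ μ * a - 1 := by linarith
  obtain ⟨W, hW⟩ : ∃ x, x = (t : ℝ) ^ 2 / μ ^ 2 := ⟨_, rfl⟩
  have hW0 : 0 ≤ W := by rw [hW]; positivity
  have hLW : 1 ≤ L ^ 2 * W := by
    rw [hW, mul_div_assoc', le_div_iff₀ (by positivity), one_mul]
    have h1 : μ ^ 2 ≤ L ^ 2 := by gcongr
    exact h1.trans (le_mul_of_one_le_right (sq_nonneg L) (one_le_pow₀ ht1))
  have hat2 : a ^ 2 * t ^ 2 ≤ r ^ 2 * W := by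
    rw [hW, mul_div_assoc', le_div_iff₀ (by positivity)]
    have h1 : (μ * a) ^ 2 ≤ r ^ 2 := by gcongr
    calc a ^ 2 * t ^ 2 * μ ^ 2 = (μ * a) ^ 2 * t ^ 2 := by ring
      _ ≤ _ := by gcongr
  have hat : a ^ 2 * t ≤ r ^ 2 * W := by
    refine le_trans ?_ hat2
    gcongr
    exact le_self_pow₀ ht1 (by norm_num)
  have ha2 : a ^ 2 ≤ r ^ 2 * W := by
    refine le_trans ?_ hat
    exact le_mul_of_one_le_right (sq_nonneg a) ht1
  have hat1 : a * t ≤ r * L * W := by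
    rw [hW, mul_div_assoc', le_div_iff₀ (by positivity)]
    calc a * t * μ ^ 2 = (μ * a) * μ * (t * 1) := by ring
      _ ≤ r * L * (t * t) := by gcongr
      _ = _ := by ring
  have hs0 : 0 ≤ s := hs ▸ Real.sqrt_nonneg _
  have he0 : 0 < e := he ▸ Real.exp_pos 1
  -- the constants `D₁`, `D₂`, `Γ₁`
  have hD₁ : q.D₁ Δ₀ ≤ d₁ * W := by
    have h3 : e * m₄ * (L + Lg) * s * (a ^ 2 * t) / (μ * a - 1)
        ≤ e * m₄ * (L + Lg) * s * (r ^ 2 * W) :=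
      (div_le_self (by positivity) hy1).trans (by gcongr)
    calc q.D₁ Δ₀ = 2 * m₁ * L * s * Δ₀ * (a * t) + 10 * m₂ * s * (a * t)
          + e * m₄ * (L + Lg) * s * (a ^ 2 * t) / (μ * a - 1) := by
          rw [eD₁]; ring
      _ ≤ 2 * m₁ * L * s * R * (r * L * W) + 10 * m₂ * s * (r * L * W)
          + e * m₄ * (L + Lg) * s * (r ^ 2 * W) := by gcongr
      _ = _ := by rw [hd₁]; ring
  have hD₂ : q.D₂ ≤ d₂ * W := by
    have h3 : e * m₃ * (L + Lg) * L * s * (a ^ 2 * t) / (μ * a - 1)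
        ≤ e * m₃ * (L + Lg) * L * s * (r ^ 2 * W) :=
      (div_le_self (by positivity) hy1).trans (by gcongr)
    calc q.D₂ = 8 * m₁ * L * s * (a * t)
          + e * m₃ * (L + Lg) * L * s * (a ^ 2 * t) / (μ * a - 1) := by
          rw [eD₂]; ring
      _ ≤ 8 * m₁ * L * s * (r * L * W) + e * m₃ * (L + Lg) * L * s * (r ^ 2 * W) := by gcongr
      _ = _ := by rw [hd₂]; ring
  have hΓ₁ : q.Γ₁ Δ₀ ≤ γ₁ * W := by
    calc q.Γ₁ Δ₀ = e * C * L * a ^ 2 + 2 * (q.D₁ Δ₀ + q.D₂ * Δ₀) := by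
          rw [eΓ₁]; ring
      _ ≤ e * C * L * (r ^ 2 * W) + 2 * (d₁ * W + d₂ * W * R) := by
          have : 0 ≤ d₂ * W := hD₂0.trans hD₂
          gcongr
      _ = _ := by rw [hγ₁]; ring
  -- the quotients by `D₂` that enter `ν₁`
  have hρ₁0 : 0 ≤ ρ₁ := by rw [hρ₁]; positivity
  have hρ₂0 : 0 ≤ ρ₂ := by rw [hρ₂]; positivity
  have hq₁ : q.D₁ Δ₀ / q.D₂ ≤ ρ₁ := by
    refine div_le_of_le_mul₀ hD₂0 hρ₁0 ?_
    obtain ⟨X, hX⟩ : ∃ x, x = 8 * a * m₁ * t * L * s := ⟨_, rfl⟩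
    obtain ⟨Y, hY⟩ : ∃ x, x = e * a ^ 2 * m₃ * t * (L + Lg) * L * s / (μ * a - 1) := ⟨_, rfl⟩
    have hX0 : 0 ≤ X := by rw [hX]; positivity
    have hY0 : 0 ≤ Y := by rw [hY]; exact div_nonneg (by positivity) (by linarith)
    have e1 : q.D₂ = X + Y := by rw [eD₂]; rw [hX, hY]
    have e2 : q.D₁ Δ₀ = X * (Δ₀ / 4) + X * (10 * m₂ / (8 * m₁ * L)) + Y * (m₄ / (m₃ * L)) := by
      have hne : μ * a - 1 ≠ 0 := by linarith
      rw [eD₁]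
      rw [hX, hY]
      field_simp
      ring
    rw [e1, e2, hρ₁]
    have p1 : X * (Δ₀ / 4) ≤ X * (R / 4) := by gcongr
    have p2 : 0 ≤ Y * (R / 4) := by positivity
    have p3 : 0 ≤ Y * (10 * m₂ / (8 * m₁ * L)) := by positivity
    have p4 : 0 ≤ X * (m₄ / (m₃ * L)) := by positivity
    linarith
  have hq₂ : e * a ^ 2 * C * L / q.D₂ ≤ ρ₂ := by
    rcases Nat.eq_zero_or_pos d with hd | hd
    · have e1 : s = 0 := by rw [hs, hd]; simp
      rw [eD₂]
      rw [e1]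
      simpa using hρ₂0
    · refine div_le_of_le_mul₀ hD₂0 hρ₂0 ?_
      have hs1 : 1 ≤ s := by rw [hs]; exact Real.one_le_sqrt.2 (by exact_mod_cast hd)
      have p1 : e * a ^ 2 * m₃ * 1 * (L + 0) * L * 1 / r
          ≤ e * a ^ 2 * m₃ * t * (L + Lg) * L * s / (μ * a - 1) := by
        have : 0 < μ * a - 1 := by linarith
        gcongr
        linarith
      have p2 : 0 ≤ 8 * a * m₁ * t * L * s := by positivity
      have p3 : e * a ^ 2 * m₃ * 1 * (L + 0) * L * 1 / r ≤ q.D₂ := by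
        rw [eD₂]
        linarith
      calc e * a ^ 2 * C * L = ρ₂ * (e * a ^ 2 * m₃ * 1 * (L + 0) * L * 1 / r) := by
            rw [hρ₂, add_zero]; field_simp
        _ ≤ _ := by gcongr
  have hν : q.ν₁ Δ₀ ≤ n₁ * W := by
    have p1 : (2 * A * L + B) / (2 * μ * a - 3) ≤ 2 * A * L + B :=
      div_le_self (by positivity) (by linarith)
    have p2 : C / (2 * μ * a - 2) ≤ C := div_le_self hC (by linarith)
    have p3 : (a * e) ^ 2 * ((t : ℝ) ^ 2 * d + 1) ≤ e ^ 2 * (r ^ 2 * W) * (d + 1) := by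
      calc (a * e) ^ 2 * ((t : ℝ) ^ 2 * d + 1) ≤ (a * e) ^ 2 * ((t : ℝ) ^ 2 * d + t ^ 2) := by
            gcongr
            exact one_le_pow₀ ht1
        _ = e ^ 2 * (a ^ 2 * t ^ 2) * (d + 1) := by ring
        _ ≤ _ := by gcongr
    have p4 : 0 ≤ 2 * A * L + B := by positivity
    calc q.ν₁ Δ₀ = 32 * L * ((a * e) ^ 2 * ((t : ℝ) ^ 2 * d + 1))
          * ((2 * A * L + B) / (2 * μ * a - 3)
            * (2 * Δ₀ + q.D₁ Δ₀ / q.D₂ + e * a ^ 2 * C * L / q.D₂) + C / (2 * μ * a - 2)) := by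
          rw [eν₁]; ring
      _ ≤ 32 * L * (e ^ 2 * (r ^ 2 * W) * (d + 1))
          * ((2 * A * L + B) * (2 * R + ρ₁ + ρ₂) + C) := by
          have p6 : (2 * A * L + B) / (2 * μ * a - 3)
              * (2 * Δ₀ + q.D₁ Δ₀ / q.D₂ + e * a ^ 2 * C * L / q.D₂)
              ≤ (2 * A * L + B) * (2 * R + ρ₁ + ρ₂) :=
            mul_le_mul p1 (by linarith) (by positivity) p4
          have p7 : 0 ≤ (2 * A * L + B) * (2 * R + ρ₁ + ρ₂) + C := by positivity
          refine (mul_le_mul_of_nonneg_left (add_le_add p6 p2) (by positivity)).trans ?_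
          gcongr
      _ = _ := by rw [hn₁]; ring
  -- `Γ₂`, with the square root bounded by the arithmetic mean
  have hΓ₂ : q.Γ₂ Kbar logbar Δ₀ ≤ γ₂ * W := by
    have p0 : 0 ≤ Kbar * Δ₀ + 2 * q.Γ₁ Δ₀ := add_nonneg (by positivity) (by linarith)
    have p3 := two_mul_sqrt_mul_le hν0 p0
    have p4 : Kbar * Δ₀ ≤ Kbar * R * (L ^ 2 * W) := by
      calc Kbar * Δ₀ ≤ Kbar * R * 1 := by rw [mul_one]; gcongr
        _ ≤ _ := by gcongr
    have p5 := mul_le_mul_of_nonneg_right hν (show 0 ≤ 5 + 12 * logbar by linarith)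
    have e1 : q.Γ₂ Kbar logbar Δ₀ = 4 * q.ν₁ Δ₀ * (1 + 3 * logbar)
        + 2 * √(q.ν₁ Δ₀ * (Kbar * Δ₀ + 2 * q.Γ₁ Δ₀)) := rfl
    rw [e1, hγ₂]
    linarith only [p3, p4, p5, hΓ₁]
  have hKl : K ≤ Kbar * Real.log (2 * k / δ) := by
    rw [div_le_iff₀ hl2] at hKbar
    exact hKbar.trans (by gcongr)
  have hlKl : Real.log (2 * K / δ) ≤ logbar * Real.log (2 * k / δ) := by
    rw [div_le_iff₀ hl2] at hlogbar
    exact hlogbar.trans (by gcongr)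
  unfold bound
  generalize Real.log (2 * k / δ) = ℓ at *
  generalize Real.log (2 * K / δ) = ℓK at *
  generalize q.Γ₂ Kbar logbar Δ₀ = G₂ at *
  generalize q.Γ₁ Δ₀ = G₁ at *
  have hnum : K * Δ₀ + G₁ + G₂ * ℓK + G₂ * ℓ
      ≤ (Kbar * R * L ^ 2 + 2 * γ₁ + γ₂ * (logbar + 1)) * (W * ℓ) := by
    have p1 : K * Δ₀ ≤ Kbar * R * L ^ 2 * (W * ℓ) := by
      calc K * Δ₀ ≤ (Kbar * ℓ) * R * 1 := by
            rw [mul_one]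
            gcongr
        _ ≤ (Kbar * ℓ) * R * (L ^ 2 * W) := by
            have : 0 ≤ ℓ := by linarith
            gcongr
        _ = _ := by ring
    have p2 : G₁ ≤ 2 * γ₁ * (W * ℓ) := by
      calc G₁ ≤ γ₁ * W * 1 := by rw [mul_one]; exact hΓ₁
        _ ≤ γ₁ * W * (2 * ℓ) := by
            have : 0 ≤ γ₁ * W := hΓ0.trans hΓ₁
            gcongr
            linarith only [hl']
        _ = _ := by ring
    have p3 : G₂ * ℓK + G₂ * ℓ ≤ γ₂ * (logbar + 1) * (W * ℓ) := by
      calc G₂ * ℓK + G₂ * ℓ ≤ G₂ * (logbar * ℓ) + G₂ * ℓ := by gcongr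
        _ = G₂ * ((logbar + 1) * ℓ) := by ring
        _ ≤ γ₂ * W * ((logbar + 1) * ℓ) := by
            have : 0 ≤ (logbar + 1) * ℓ := mul_nonneg (by linarith) (by linarith)
            gcongr
        _ = _ := by ring
    linarith only [p1, p2, p3]
  have hnum0 : 0 ≤ K * Δ₀ + G₁ + G₂ * ℓK + G₂ * ℓ := by
    have : 0 ≤ ℓ := by linarith
    positivity
  calc (K * Δ₀ + G₁ + G₂ * ℓK + G₂ * ℓ) / (k + K) ≤ (K * Δ₀ + G₁ + G₂ * ℓK + G₂ * ℓ) / k := by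
        gcongr
        linarith
    _ ≤ (Kbar * R * L ^ 2 + 2 * γ₁ + γ₂ * (logbar + 1)) * (W * ℓ) / k := by gcongr
    _ = _ := by rw [hW]; field_simp

end IsAdmissible
end Params

end MarkovSGD

theorem mainTheorem1 (L A B C : ℝ) (hL : 0 < L) (hA : 0 ≤ A) (hB : 0 ≤ B) (hC : 0 ≤ C) :
    ∃ m₁ m₂ m₃ m₄ : ℝ, 0 < m₁ ∧ 0 < m₂ ∧ 0 < m₃ ∧ 0 < m₄ ∧
      (∀ (d t : ℕ) (μ Lg a : ℝ), 0 < μ → 0 ≤ Lg → 2 / μ ≤ a →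
      ∀ q : MarkovSGD.Params,
        q = { d := d, t := t, μ := μ, L := L, Lg := Lg, A := A, B := B, C := C, a := a,
              m₁ := m₁, m₂ := m₂, m₃ := m₃, m₄ := m₄ } →
      ∀ f : MarkovSGD.E d → ℝ, MarkovSGD.IsSmooth f L → MarkovSGD.IsPL f μ →
      ∀ (S : Type v) [MeasurableSpace S] (p : Kernel S S) [IsMarkovKernel p]
        (π₀ π : Measure S) [IsProbabilityMeasure π₀] [IsProbabilityMeasure π]
        (g : MarkovSGD.E d → S → MarkovSGD.E d),
        MarkovSGD.IsGeometricallyErgodic p π t →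
        MarkovSGD.IsGradientSample f π g Lg A B C →
      ∀ δ K₀ : ℝ, 0 < δ → δ < 1 → q.minK₀ δ ≤ K₀ →
      ∀ Kbar logbar : ℝ, K₀ / Real.log (2 / δ) ≤ Kbar →
        Real.log (2 * K₀ / δ) / Real.log (2 / δ) ≤ logbar →
      ∀ (Ω : Type u) [MeasurableSpace Ω] (P : Measure Ω) [IsProbabilityMeasure P]
        (Z : ℕ → Ω → S) (M x : ℕ → Ω → MarkovSGD.E d),
        MarkovSGD.IsSGD g Z M x a K₀ →
        MarkovSGD.IsMarkovChain P (MarkovSGD.history (x 0) M Z) Z π₀ p →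
        MarkovSGD.IsMartingaleDifference P (MarkovSGD.history (x 0) M Z) M →
        (∀ k, ∀ᵐ ω ∂P, ‖MarkovSGD.noisyGradient g Z M x k ω‖ ^ 2
            ≤ MarkovSGD.abcBound f A B C (x k ω)) →
        ENNReal.ofReal (1 - δ) ≤
          P {ω | ∀ k : ℕ, 1 ≤ k →
            MarkovSGD.subopt f (x k ω)
              ≤ q.bound K₀ δ Kbar logbar (MarkovSGD.subopt f (x 0 ω)) k}) ∧
      (∀ (d t : ℕ) (μ Lg a : ℝ), 0 < μ → 0 ≤ Lg → 2 / μ ≤ a →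
        ∀ q : MarkovSGD.Params,
          q = { d := d, t := t, μ := μ, L := L, Lg := Lg, A := A, B := B, C := C, a := a,
                m₁ := m₁, m₂ := m₂, m₃ := m₃, m₄ := m₄ } →
        ∃ κ : ℝ, ∀ δ : ℝ, 0 < δ → δ < 1 → q.minK₀ δ ≤ κ * Real.log (2 / δ)) ∧
      (∀ (d : ℕ) (Lg r R Kbar logbar : ℝ), 0 ≤ Lg → ∃ H : ℝ,
        ∀ (t : ℕ) (μ a : ℝ), 1 ≤ t → 0 < μ → μ ≤ L → 2 / μ ≤ a → a ≤ r / μ →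
        ∀ q : MarkovSGD.Params,
          q = { d := d, t := t, μ := μ, L := L, Lg := Lg, A := A, B := B, C := C, a := a,
                m₁ := m₁, m₂ := m₂, m₃ := m₃, m₄ := m₄ } →
        ∀ δ K₀ : ℝ, 0 < δ → δ < 1 → q.minK₀ δ ≤ K₀ →
          K₀ / Real.log (2 / δ) ≤ Kbar →
          Real.log (2 * K₀ / δ) / Real.log (2 / δ) ≤ logbar →
        ∀ Δ₀ : ℝ, 0 ≤ Δ₀ → Δ₀ ≤ R → ∀ k : ℕ, 1 ≤ k →
          q.bound K₀ δ Kbar logbar Δ₀ k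
            ≤ H * ((t : ℝ) ^ 2 * Real.log (2 * k / δ) / (μ ^ 2 * k))) := by
  set Q := 2 * A * L + B with hQ
  have hQ0 : 0 ≤ Q := by positivity
  -- the constants for which the errors `err₁`, `err₂` of the Markovian bias are at most fractions
  -- of `D₁`, `D₂`
  have hm₁ : 0 < 60 * (2 * L + Q) / L := by positivity
  have hm₂ : 0 < 45 * C + 1 := by positivity
  have hm₃ : 0 < 300 * Q / L + 1 := by positivity
  have hm₄ : 0 < 300 * C + 1 := by positivity
  have hadm : ∀ (d t : ℕ) (μ Lg a : ℝ), 0 < μ → 0 ≤ Lg → 2 / μ ≤ a →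
      ∀ q : MarkovSGD.Params,
        q = { d := d, t := t, μ := μ, L := L, Lg := Lg, A := A, B := B, C := C, a := a,
              m₁ := 60 * (2 * L + Q) / L, m₂ := 45 * C + 1, m₃ := 300 * Q / L + 1,
              m₄ := 300 * C + 1 } → q.IsAdmissible := by
    rintro d t μ Lg a hμ hLg ha q rfl
    have ha0 : 0 < a := lt_of_lt_of_le (by positivity) ha
    rw [div_le_iff₀ hμ] at ha
    exact ⟨hL, hLg, hA, hB, hC, ha0, by simpa only [mul_comm] using ha, hm₁, hm₂, hm₃, hm₄⟩
  refine ⟨_, _, _, _, hm₁, hm₂, hm₃, hm₄, ?_, fun d t μ Lg a _ _ _ q _ => q.minK₀_le, ?_⟩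
  · intro d t μ Lg a hμ hLg ha q hq f hf hp S _ p _ π₀ π _ _ g herg hg δ K₀ hδ hδ' hK Kbar logbar
      hKbar hlogbar Ω _ P _ Z M x hx hZ hM hG
    have hq' := hadm d t μ Lg a hμ hLg ha q hq
    by_cases hconst : ∃ y, 0 < MarkovSGD.subopt f y
    · obtain ⟨y, hy⟩ := hconst
      subst hq
      refine MarkovSGD.IsSetting.ofReal_one_sub_le_measure (π := π) ?_ hδ hδ' hK hKbar hlogbar hx hZ
        hM hG
      exact
        { tuned :=
            { one_le_d := MarkovSGD.pos_dim_of_subopt_pos hy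
              one_le_t := herg.one_le
              μ_pos := hμ
              μ_le := MarkovSGD.le_of_subopt_pos hL hf hp hy
              Lg_nonneg := hLg
              C_nonneg := hC
              two_le := hq'.two_le
              le_Q := MarkovSGD.two_mul_le_of_subopt_pos hL hμ hA hB hC hf hp hg hy
              m₁_eq := rfl
              m₂_eq := rfl
              m₃_eq := rfl
              m₄_eq := rfl }
          A_nonneg := hA
          B_nonneg := hB
          smooth := hf
          pl := hp
          ergodic := herg
          sample := hg }
    · -- a constant objective: the suboptimality vanishes and the bound is nonnegative
      have h0 : ∀ y, MarkovSGD.subopt f y = 0 := fun y =>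
        le_antisymm (not_lt.1 fun hy => hconst ⟨y, hy⟩) (hp.subopt_nonneg y)
      have huniv : {ω | ∀ k : ℕ, 1 ≤ k → MarkovSGD.subopt f (x k ω)
          ≤ q.bound K₀ δ Kbar logbar (MarkovSGD.subopt f (x 0 ω)) k} = Set.univ := by
        refine Set.eq_univ_of_forall fun ω k hk => ?_
        rw [h0, h0]
        exact hq'.bound_zero_nonneg hδ hδ' hK hlogbar hk
      rw [huniv, measure_univ, ENNReal.ofReal_le_one]
      linarith
  · intro d Lg r R Kbar logbar hLg
    obtain ⟨H, hH⟩ := MarkovSGD.Params.IsAdmissible.bound_le d L Lg A B C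
      (60 * (2 * L + Q) / L) (45 * C + 1) (300 * Q / L + 1) (300 * C + 1) r R Kbar logbar
    exact ⟨H, fun t μ a ht hμ hμL ha har q hq => hH t μ a ht hμ hμL har q hq
      (hadm d t μ Lg a hμ hLg ha q hq)⟩
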